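/- Let $N\in\mathbb N$, let $\mathcal A$ be a separable metric space, $\sigma\in(0,2)$, and consider $$\sup_{\alpha\in\mathcal A}\{f^\alpha(x)+c^\alpha(x)u(x)-b^\alpha\cdot\nabla u(x)-\mathcal I^\alpha[u](x)\}=0\quad\text{in }\mathbb R^N,\qquad(1)$$ $$\mathcal I^\alpha[\phi](x)=\int_{\mathbb R^N\setminus\{0\}}\big(\phi(x+\eta^\alpha(z))-\phi(x)-\eta^\alpha(z)\cdot\nabla\phi(x)1_{|z|<1}\big)\,\nu_\alpha(dz),$$ where $b^\alpha\in\mathbb R^N$ and $\nu_\alpha$ are nonnegative Borel measures. Assume, with constants $\lambda,K>0$ independent of $\alpha$: - $c^\alpha\ge\lambda$; $f^\alpha(x),c^\alpha(x),\eta^\alpha(z)$ are continuous in each of $\alpha,x,z$; $f^\alpha,c^\alpha$ are bounded and Lipschitz in $x$ with constants at most $K$; $|b^\alpha|\le K$, $|\eta^\alpha(z)|\le K$; - $|\eta^\alpha(z)|\le K|z|$ for $|z|<1$, and $\int_{|z|\le1}|z|^2\nu_\alpha(dz)+\nu_\alpha(|z|>1)\le K$; - $1_{|z|<1}\nu_\alpha(dz)$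 is symmetric and has a Lebesgue density bounded by $K|z|^{-N-\sigma}$ on $0<|z|<1$; - $|\eta^\alpha(z)-2\eta^\alpha(0)+\eta^\alpha(-z)|\le K|z|^2$ for $|z|<1$. **Scheme.** For $h,k>0$ and $\delta\in(0,1)$ let $x_j=hj$, $j\in\mathbb Z^N$, and let $\omega_j(y)=\prod_{i=1}^N\max\{0,1-|y_i/h-j_i|\}$ be the multilinear interpolation basis. Write $i_h[g](y)=\sum_j g(x_j)\omega_j(y)$. Let $a^\alpha_\delta=\frac12\int_{|z|<\delta}\eta^\alpha(z)\eta^\alpha(z)^T\nu_\alpha(dz)$, let $s_i$ be the columns of its positive semidefinite square root, and let $b^\alpha_\delta=b^\alpha-\int_{\delta<|z|<1}\eta^\alpha(z)\,\nu_\alpha(dz)$ with components $b_i$ ($b_i^+=\max\{b_i,0\}$, $b_i^-=\max\{-b_i,0\}$). The scheme is $$\sup_{\alpha\in\mathcal A}\{f^\alpha(x)+c^\alpha(x)u_h(x)-\bar{\mathcal L}^\alpha[u_h](x)-\mathcal I^{\alpha,\delta}_h[u_h](x)\}=0\quad\text{for all }x\in\mathbb R^N,\qquad(2)$$ $$\bar{\mathcal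 L}^\alpha[\phi](x)=\sum_{i=1}^N\frac{i_h[\phi(x+\cdot)](ks_i)+i_h[\phi(x+\cdot)](-ks_i)-2\phi(x)}{k^2}+\sum_{i=1}^N\Big(b_i^+\frac{\phi(x+he_i)-\phi(x)}h+b_i^-\frac{\phi(x-he_i)-\phi(x)}h\Big),$$ $$\mathcal I_h^{\alpha,\delta}[\phi](x)=\sum_{j\in\mathbb Z^N}(\phi(x+x_j)-\phi(x))\int_{|z|>\delta}\omega_j(\eta^\alpha(z))\,\nu_\alpha(dz).$$ For positive $X,Y$, write $X\asymp Y$ if $c_1Y\le X\le c_2Y$, where $c_1,c_2>0$ are arbitrary fixed constants. **Theorem.** Let $u$ be a bounded continuous viscosity solution of (1). For all $c_1,c_2>0$ there is a constant $C>0$, independent of $h,k,\delta$, such that for all $h,\delta\in(0,1)$ and $k>0$ with $k^2\asymp h^2/\delta^{2-\sigma/2}$, every bounded continuous solution $u_h$ of (2) satisfies the following on $\mathbb R^N$. (a) $|u-u_h|\le C\,h^{1/2}$ if $0<\sigma\le\frac65$ and $\delta\asymp h^{1/\sigma}$; and $|u-u_h|\le C\,h^{\frac{2(3-\sigma)}{6+\sigma}}$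 if $\frac65<\sigma<2$ and $\delta\asymp h^{\frac6{6+\sigma}}$. (b) If moreover $\eta^\alpha(-z)=-\eta^\alpha(z)$ for $|z|<1$ and all $\alpha$, then $|u-u_h|\le C\,h^{1/2}$ if $0<\sigma\le\frac43$ and $\delta\asymp h^{1/\sigma}$; and $|u-u_h|\le C\,h^{\frac{4-\sigma}{4+\sigma}}$ if $\frac43<\sigma<2$ and $\delta\asymp h^{\frac4{4+\sigma}}$. -/

import Mathlib

open MeasureTheory Metric Set
open scoped BoundedContinuousFunction

noncomputable section

/-- `ℝ^N` with the Euclidean norm. -/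
abbrev RN (N : ℕ) : Type := EuclideanSpace ℝ (Fin N)

/-- The coefficients of the equation
`sup_α { f^α(x) + c^α(x) u(x) - b^α · ∇u(x) - I^α[u](x) } = 0` in `ℝ^N`,
where the nonlocal operator `I^α` is given by the jump map `η^α` and the Lévy measure `ν_α`.
This is raw data; all assumptions are stated separately. -/
structure HJBData (N : ℕ) (A : Type*) where
  /-- running cost -/
  f : A → RN N → ℝ
  /-- zeroth order coefficient -/
  c : A → RN N → ℝ
  /-- drift -/
  b : A → RN N
  /-- jump map -/
  η : A → RN N → RN N
  /-- Lévy measures (the origin is excluded from all integrals) -/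
  ν : A → Measure (RN N)

namespace HJBData

variable {N : ℕ} {A : Type*}

/-! ### Assumptions on the coefficients -/

/-- `c ≥ λ > 0`, and `f, c, η` are continuous in each of the variables `α`, `x`, `z`. -/
def ContinuousCoercive [TopologicalSpace A] (P : HJBData N A) : Prop :=
  (∃ lam : ℝ, 0 < lam ∧ ∀ α x, lam ≤ P.c α x) ∧
  (∀ α, Continuous (P.f α)) ∧ (∀ x, Continuous fun α => P.f α x) ∧
  (∀ α, Continuous (P.c α)) ∧ (∀ x, Continuous fun α => P.c α x) ∧
  (∀ α, Continuous (P.η α)) ∧ (∀ z, Continuous fun α => P.η α z)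

/-- `f` and `c` are bounded and Lipschitz in `x`, and `b`, `η` are bounded, uniformly in `α`. -/
def UniformlyBounded (P : HJBData N A) : Prop :=
  ∃ K : ℝ, ∀ α,
    (∀ x, |P.f α x| ≤ K) ∧ (∀ x y, |P.f α x - P.f α y| ≤ K * ‖x - y‖) ∧
    (∀ x, |P.c α x| ≤ K) ∧ (∀ x y, |P.c α x - P.c α y| ≤ K * ‖x - y‖) ∧
    ‖P.b α‖ ≤ K ∧ (∀ z, ‖P.η α z‖ ≤ K)

/-- `|η^α(z)| ≤ K |z|` for `|z| < 1`. -/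
def JumpLinearGrowth (P : HJBData N A) : Prop :=
  ∃ K : ℝ, ∀ α z, ‖z‖ < 1 → ‖P.η α z‖ ≤ K * ‖z‖

/-- `∫_{|z| ≤ 1} |z|² ν_α(dz) + ν_α(|z| > 1) ≤ K`, uniformly in `α`.  (In particular `ν_α` is
a Radon measure on `ℝ^N \ {0}`.) -/
def LevyBound (P : HJBData N A) : Prop :=
  ∃ K : ℝ, ∀ α,
    (∫⁻ z in closedBall 0 1, ENNReal.ofReal (‖z‖ ^ 2) ∂(P.ν α)) + P.ν α {z | 1 < ‖z‖}
      ≤ ENNReal.ofReal K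

/-- The restriction of `ν_α` to `|z| < 1` is symmetric under `z ↦ -z`. -/
def LevySymmetric (P : HJBData N A) : Prop :=
  ∀ α, ((P.ν α).restrict (ball 0 1)).map (fun z => -z) = (P.ν α).restrict (ball 0 1)

/-- On `|z| < 1` the measure `ν_α` has a Lebesgue density bounded by `C / |z|^{N+σ}`,
with `C` independent of `α`. -/
def LevyDensityBound (P : HJBData N A) (σ : ℝ) : Prop :=
  ∃ C : ℝ, 0 < C ∧ ∀ α, ∃ g : RN N → ENNReal, Measurable g ∧
    (P.ν α).restrict (ball 0 1) = (volume.restrict (ball 0 1)).withDensity g ∧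
    ∀ z, z ≠ 0 → ‖z‖ < 1 → g z ≤ ENNReal.ofReal (C / ‖z‖ ^ ((N : ℝ) + σ))

/-- `η^α(-z) = -η^α(z)` for `|z| < 1`. -/
def JumpOdd (P : HJBData N A) : Prop :=
  ∀ α z, ‖z‖ < 1 → P.η α (-z) = -P.η α z

/-- `|η^α(z) - 2 η^α(0) + η^α(-z)| ≤ K |z|²` for `|z| < 1`. -/
def JumpSecondDifference (P : HJBData N A) : Prop :=
  ∃ K : ℝ, ∀ α z, ‖z‖ < 1 →
    ‖P.η α z - (2 : ℝ) • P.η α 0 + P.η α (-z)‖ ≤ K * ‖z‖ ^ 2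

/-! ### The equation and its viscosity solutions -/

/-- `I^α[φ](x) = ∫_{z ≠ 0} (φ(x + η^α(z)) - φ(x) - η^α(z)·∇φ(x) 1_{|z|<1}) ν_α(dz)`. -/
def nonlocal (P : HJBData N A) (α : A) (φ : RN N → ℝ) (x : RN N) : ℝ :=
  ∫ z in {0}ᶜ, (φ (x + P.η α z) - φ x
    - (ball (0 : RN N) 1).indicator (fun z => fderiv ℝ φ x (P.η α z)) z) ∂(P.ν α)

/-- `sup_α { f^α(x) + c^α(x) r - b^α·∇φ(x) - I^α[φ](x) }`, a supremum in `[-∞, ∞]`. -/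
def hamiltonian (P : HJBData N A) (r : ℝ) (φ : RN N → ℝ) (x : RN N) : EReal :=
  ⨆ α, ((P.f α x + P.c α x * r - fderiv ℝ φ x (P.b α) - P.nonlocal α φ x : ℝ) : EReal)

/-- Bounded continuous viscosity solutions: sub- and supersolution tests with `C²` functions
touching `u` globally from above and from below.  (As the jumps `η^α` are bounded and
`|η^α(z)| ≤ K|z|` near `0`, the operator `I^α[φ](x)` only sees `φ` on a bounded set and is
well defined for every `C²` function `φ`.) -/
def IsViscositySolution (P : HJBData N A) (u : RN N →ᵇ ℝ) : Prop :=
  (∀ (φ : RN N → ℝ) (x : RN N), ContDiff ℝ 2 φ →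
    (∀ y, u y - φ y ≤ u x - φ x) → P.hamiltonian (u x) φ x ≤ 0) ∧
  (∀ (φ : RN N → ℝ) (x : RN N), ContDiff ℝ 2 φ →
    (∀ y, u x - φ x ≤ u y - φ y) → 0 ≤ P.hamiltonian (u x) φ x)

/-! ### The numerical scheme -/

/-- The grid point `x_j = h j`, `j ∈ ℤ^N`. -/
def gridPoint (h : ℝ) (j : Fin N → ℤ) : RN N := WithLp.toLp 2 fun i => h * (j i : ℝ)

/-- The basis function `ω_j` of multilinear interpolation on the grid `h ℤ^N`
(the tensor product of one-dimensional hat functions). -/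
def hat (h : ℝ) (j : Fin N → ℤ) (y : RN N) : ℝ :=
  ∏ i, max 0 (1 - |y i / h - (j i : ℝ)|)

/-- Multilinear interpolation on the grid `h ℤ^N` (a locally finite sum). -/
def interp (h : ℝ) (g : RN N → ℝ) (y : RN N) : ℝ :=
  ∑' j : Fin N → ℤ, g (gridPoint h j) * hat h j y

/-- `a^α_δ = ½ ∫_{|z|<δ} η^α(z) η^α(z)ᵀ ν_α(dz)`. -/
def diffusion (P : HJBData N A) (δ : ℝ) (α : A) : Matrix (Fin N) (Fin N) ℝ :=
  Matrix.of fun i j => (1 / 2 : ℝ) * ∫ z in ball 0 δ, P.η α z i * P.η α z j ∂(P.ν α)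

section
open scoped MatrixOrder

/-- The `i`-th column of the positive semidefinite square root of `a^α_δ`. -/
def sqrtCol (P : HJBData N A) (δ : ℝ) (α : A) (i : Fin N) : RN N :=
  WithLp.toLp 2 fun r => CFC.sqrt (P.diffusion δ α) r i

end

/-- The semi-Lagrangian discretization of `tr[a^α_δ D²φ](x)`.  Off-grid values are interpolated
on the grid `x + h ℤ^N` centred at `x`. -/
def discreteDiffusion (P : HJBData N A) (h k δ : ℝ) (α : A) (φ : RN N → ℝ) (x : RN N) : ℝ :=
  ∑ i, (interp h (fun y => φ (x + y)) (k • P.sqrtCol δ α i)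
      + interp h (fun y => φ (x + y)) (-(k • P.sqrtCol δ α i)) - 2 * φ x) / k ^ 2

/-- `b^α_δ = b^α - ∫_{δ<|z|<1} η^α(z) ν_α(dz)`. -/
def effectiveDrift (P : HJBData N A) (δ : ℝ) (α : A) : RN N :=
  P.b α - ∫ z in {z | δ < ‖z‖ ∧ ‖z‖ < 1}, P.η α z ∂(P.ν α)

/-- The upwind difference discretization of `b^α_δ · ∇φ(x)`, with
`r⁺ = max r 0` and `r⁻ = max (-r) 0`. -/
def upwindDrift (P : HJBData N A) (h δ : ℝ) (α : A) (φ : RN N → ℝ) (x : RN N) : ℝ :=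
  ∑ i, (max (P.effectiveDrift δ α i) 0 * ((φ (x + EuclideanSpace.single i h) - φ x) / h)
      + max (-P.effectiveDrift δ α i) 0 * ((φ (x - EuclideanSpace.single i h) - φ x) / h))

/-- The quadrature weight `κ_j = ∫_{|z|>δ} ω_j(η^α(z)) ν_α(dz)`. -/
def weight (P : HJBData N A) (h δ : ℝ) (α : A) (j : Fin N → ℤ) : ℝ :=
  ∫ z in {z | δ < ‖z‖}, hat h j (P.η α z) ∂(P.ν α)

/-- The quadrature `∑_j (φ(x + x_j) - φ(x)) κ_j`.  (Only finitely many weights are nonzero,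
since `η^α` is bounded.) -/
def discreteNonlocal (P : HJBData N A) (h δ : ℝ) (α : A) (φ : RN N → ℝ) (x : RN N) : ℝ :=
  ∑' j : Fin N → ℤ, (φ (x + gridPoint h j) - φ x) * P.weight h δ α j

/-- Bounded continuous solutions of the numerical scheme, an equation at every `x ∈ ℝ^N`. -/
def IsSchemeSolution (P : HJBData N A) (h k δ : ℝ) (v : RN N →ᵇ ℝ) : Prop :=
  ∀ x, (⨆ α, ((P.f α x + P.c α x * v x
      - (P.discreteDiffusion h k δ α v x + P.upwindDrift h δ α v x)
      - P.discreteNonlocal h δ α v x : ℝ) : EReal)) = 0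

/-! ### Convergence rates -/

/-- `X` and `Y` are of the same order, with constants `c₁` and `c₂`. -/
def SameOrder (c₁ c₂ X Y : ℝ) : Prop := c₁ * Y ≤ X ∧ X ≤ c₂ * Y

/-- When `δ` is of order `h^p` and `k²` is of order `h² / δ^{2-σ/2}`, solutions of the scheme
satisfy `|u - u_h| ≤ C h^r`, with `C` independent of `h`, `k`, `δ`. -/
def HasRate (P : HJBData N A) (σ : ℝ) (u : RN N →ᵇ ℝ) (p r : ℝ) : Prop :=
  ∀ c₁ c₂ : ℝ, 0 < c₁ → 0 < c₂ → ∃ C : ℝ, 0 < C ∧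
    ∀ h k δ : ℝ, 0 < h → h < 1 → 0 < k → 0 < δ → δ < 1 →
      SameOrder c₁ c₂ (k ^ 2) (h ^ 2 / δ ^ (2 - σ / 2)) →
      SameOrder c₁ c₂ δ (h ^ p) →
      ∀ uh : RN N →ᵇ ℝ, P.IsSchemeSolution h k δ uh →
        ∀ x, |u x - uh x| ≤ C * h ^ r

end HJBData

end

/-! The equation and the scheme are suprema over `α` of linear expressions, so being a subsolution
means satisfying one linear inequality for each `α`. Such inequalities survive averaging over
translates of the unknown: the operators are translation invariant, and the Lipschitz coefficients
`f`, `c` cost only `O(ε)` at scale `ε`. Both one-sided bounds therefore regularize a subsolution and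
then compare. The mollified `u` is a subsolution of the scheme up to the truncation error, and
`scheme_comparison` bounds `u - u_h`. The mollified `u_h` is a subsolution of the equation up to the
truncation error, and `le_viscositySolution` bounds `u_h - u`.

A Lipschitz function mollified at scale `ε` has derivatives of order `j` of size `ε^(1-j)`. Hence
`consistency` gives an error `ε + ε Q`, where `Q` collects `δ^(m-σ)/ε^m` (small jumps replaced by a
diffusion, with `m = 3`, or `m = 4` for odd jumps), `h²/(k²ε²)` and `k²δ^(2(2-σ))/ε⁴`
(semi-Lagrangian diffusion), `h/ε²` (upwinding) and `h²δ^(-σ)/ε²` (quadrature). With `ε = h^r` and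
`r` such that `Q` stays bounded, the rate is `h^r`. The coupling `k² ≍ h²/δ^(2-σ/2)` balances the
two diffusion terms when `ε = h δ^(-σ/2)`, the scale at which the quadrature term is of order one.

Two facts about viscosity solutions are needed. First, mollifying a Lipschitz viscosity subsolution
of a linear equation gives a classical one (`neg_generator_mollify_le`). This is proved without
doubling of variables, by comparison with the resolvent of a finite difference approximation of the
generator. Second, `u`, which is only assumed continuous, is Lipschitz
(`lipschitz_viscositySolution`). Its sup-convolutions are Lipschitz almost-subsolutions, and their
smoothed translates can be compared with `u`. -/

noncomputable section

/-! ### Taylor remainders along lines -/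

section Taylor

/-- On `[0, 1]` integration does not enlarge a bound, so the lemmas below descend one derivative at
a time with the same constant and no factorials. -/
lemma abs_le_of_deriv_bound {f f' : ℝ → ℝ} {B : ℝ} (hf : ∀ t, HasDerivAt f (f' t) t)
    (h0 : f 0 = 0) (hB : ∀ t ∈ Icc (0 : ℝ) 1, |f' t| ≤ B) :
    ∀ t ∈ Icc (0 : ℝ) 1, |f t| ≤ B := by
  intro t ht
  have h := (convex_Icc (0 : ℝ) 1).norm_image_sub_le_of_norm_hasDerivWithin_le
    (f := f) (f' := f') (C := B) (fun x _ => (hf x).hasDerivWithinAt) hB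
    (left_mem_Icc.2 zero_le_one) ht
  have hB0 : 0 ≤ B := (abs_nonneg _).trans (hB t ht)
  rw [h0, sub_zero, sub_zero, Real.norm_eq_abs, Real.norm_eq_abs, abs_of_nonneg ht.1] at h
  exact h.trans (mul_le_of_le_one_right hB0 ht.2)

lemma taylor_two_line {g g₁ g₂ : ℝ → ℝ} {B : ℝ} (h0 : ∀ t, HasDerivAt g (g₁ t) t)
    (h1 : ∀ t, HasDerivAt g₁ (g₂ t) t) (hB : ∀ t, |g₂ t| ≤ B) : |g 1 - g 0 - g₁ 0| ≤ B := by
  have e1 := abs_le_of_deriv_bound (f := fun t => g₁ t - g₁ 0)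
    (fun t => (h1 t).sub_const _) (by simp) (fun t _ => hB t)
  have e0 := abs_le_of_deriv_bound (f := fun t => g t - g 0 - t * g₁ 0)
    (fun t => (((h0 t).sub_const _).sub ((hasDerivAt_id t).mul_const _)).congr_deriv (by simp))
    (by simp) e1
  simpa using e0 1 ⟨zero_le_one, le_rfl⟩

lemma taylor_three_line {g g₁ g₂ g₃ : ℝ → ℝ} {B : ℝ} (h0 : ∀ t, HasDerivAt g (g₁ t) t)
    (h1 : ∀ t, HasDerivAt g₁ (g₂ t) t) (h2 : ∀ t, HasDerivAt g₂ (g₃ t) t)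
    (hB : ∀ t, |g₃ t| ≤ B) : |g 1 - g 0 - g₁ 0 - 1 / 2 * g₂ 0| ≤ B := by
  have e2 := abs_le_of_deriv_bound (f := fun t => g₂ t - g₂ 0)
    (fun t => (h2 t).sub_const _) (by simp) (fun t _ => hB t)
  have e1 := abs_le_of_deriv_bound (f := fun t => g₁ t - g₁ 0 - t * g₂ 0)
    (fun t => (((h1 t).sub_const _).sub ((hasDerivAt_id t).mul_const _)).congr_deriv (by simp))
    (by simp) e2
  have e0 := abs_le_of_deriv_bound (f := fun t => g t - g 0 - t * g₁ 0 - t ^ 2 / 2 * g₂ 0)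
    (fun t => by
      have hsq : HasDerivAt (fun s : ℝ => s ^ 2 / 2) t t := by
        simpa using (hasDerivAt_pow 2 t).div_const 2
      exact ((((h0 t).sub_const (g 0)).sub ((hasDerivAt_id t).mul_const
        (g₁ 0))).sub (hsq.mul_const (g₂ 0))).congr_deriv (by simp))
    (by simp) e1
  simpa using e0 1 ⟨zero_le_one, le_rfl⟩

/-- In the symmetric combination the derivatives of orders one and three cancel, which leaves a
fourth order remainder. The factor `2` comes from bounding `g₄ t + g₄ (-t)`. -/
lemma taylor_four_line {g g₁ g₂ g₃ g₄ : ℝ → ℝ} {B : ℝ} (h0 : ∀ t, HasDerivAt g (g₁ t) t)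
    (h1 : ∀ t, HasDerivAt g₁ (g₂ t) t) (h2 : ∀ t, HasDerivAt g₂ (g₃ t) t)
    (h3 : ∀ t, HasDerivAt g₃ (g₄ t) t) (hB : ∀ t, |g₄ t| ≤ B) :
    |g 1 + g (-1) - 2 * g 0 - g₂ 0| ≤ 2 * B := by
  have neg : ∀ {g : ℝ → ℝ} {g' : ℝ → ℝ}, (∀ t, HasDerivAt g (g' t) t) →
      ∀ t, HasDerivAt (fun s => g (-s)) (-g' (-t)) t := fun {g g'} hg t => by
    exact ((hg (-t)).scomp t (hasDerivAt_neg t)).congr_deriv (by simp)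
  have e3 := abs_le_of_deriv_bound (B := 2 * B) (f := fun t => g₃ t - g₃ (-t))
    (fun t => (h3 t).sub (neg h3 t)) (by simp) (fun t _ => by
      have u1 := hB t
      have u2 := hB (-t)
      rw [abs_le] at *
      constructor <;> linarith)
  have e2 := abs_le_of_deriv_bound (f := fun t => g₂ t + g₂ (-t) - 2 * g₂ 0)
    (fun t => (((h2 t).add (neg h2 t)).sub_const (2 * g₂ 0)).congr_deriv (by ring))
    (by simp; ring) e3
  have e1 := abs_le_of_deriv_bound (f := fun t => g₁ t - g₁ (-t) - 2 * t * g₂ 0)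
    (fun t => by
      have := ((h1 t).sub (neg h1 t)).sub (((hasDerivAt_id t).const_mul 2).mul_const (g₂ 0))
      exact this.congr_deriv (by simp))
    (by simp) e2
  have e0 := abs_le_of_deriv_bound (f := fun t => g t + g (-t) - 2 * g 0 - t ^ 2 * g₂ 0)
    (fun t => by
      have := (((h0 t).add (neg h0 t)).sub_const (2 * g 0)).sub ((hasDerivAt_pow 2 t).mul_const
        (g₂ 0))
      exact this.congr_deriv (by simp; ring)) (by simp; ring) e1
  simpa using e0 1 ⟨zero_le_one, le_rfl⟩

variable {E : Type*} [NormedAddCommGroup E] [NormedSpace ℝ E]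

lemma hasDerivAt_iteratedFDeriv_line {ρ : E → ℝ} (hρ : ContDiff ℝ (⊤ : ℕ∞) ρ) (x v : E) (m : ℕ)
    (t : ℝ) : HasDerivAt (fun s : ℝ => iteratedFDeriv ℝ m ρ (x + s • v) fun _ => v)
      (iteratedFDeriv ℝ (m + 1) ρ (x + t • v) fun _ => v) t := by
  have line : HasDerivAt (fun s : ℝ => x + s • v) v t := by
    simpa using ((hasDerivAt_id t).smul_const v).const_add x
  have hd : DifferentiableAt ℝ (iteratedFDeriv ℝ m ρ) (x + t • v) :=
    hρ.differentiable_iteratedFDeriv (by exact_mod_cast ENat.natCast_lt_top m) _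
  have h := hd.hasFDerivAt.comp_hasDerivAt t line
  rw [iteratedFDeriv_succ_apply_left]
  exact ((ContinuousMultilinearMap.apply ℝ (fun _ : Fin m => E) ℝ
    (fun _ => v)).hasFDerivAt.comp_hasDerivAt t h)

lemma exists_norm_bound {E F : Type*} [NormedAddCommGroup E] [NormedAddCommGroup F] {f : E → F}
    (hc : HasCompactSupport f) (hf : Continuous f) : ∃ C : ℝ, 0 ≤ C ∧ ∀ y, ‖f y‖ ≤ C := by
  obtain ⟨C, h⟩ := hc.exists_bound_of_continuous hf
  exact ⟨C, (norm_nonneg _).trans (h 0), h⟩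

lemma exists_fderiv_bound {F : Type*} [NormedAddCommGroup F] [NormedSpace ℝ F] {f : E → F}
    (hf : ContDiff ℝ 1 f) (hc : HasCompactSupport f) :
    ∃ C : ℝ, 0 ≤ C ∧ ∀ y, ‖fderiv ℝ f y‖ ≤ C :=
  exists_norm_bound (hc.fderiv ℝ) (hf.continuous_fderiv one_ne_zero)

/-- Taylor estimates of a smooth compactly supported function, uniform in the base point. -/
lemma exists_taylor_bound {ρ : E → ℝ} (hρ : ContDiff ℝ (⊤ : ℕ∞) ρ) (hc : HasCompactSupport ρ) :
    ∃ C : ℝ, 0 < C ∧ ∀ x, ‖fderiv ℝ ρ x‖ ≤ C ∧ ‖fderiv ℝ (fderiv ℝ ρ) x‖ ≤ C ∧ ∀ v,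
      |ρ (x + v) - ρ x - fderiv ℝ ρ x v| ≤ C * ‖v‖ ^ 2 ∧
      |ρ (x + v) - ρ x - fderiv ℝ ρ x v - 1 / 2 * fderiv ℝ (fderiv ℝ ρ) x v v| ≤ C * ‖v‖ ^ 3 ∧
      |ρ (x + v) + ρ (x - v) - 2 * ρ x - fderiv ℝ (fderiv ℝ ρ) x v v| ≤ C * ‖v‖ ^ 4 := by
  have top0 : ((⊤ : ℕ∞) : WithTop ℕ∞) ≠ 0 := by simp
  have c1 : ContDiff ℝ 1 (fderiv ℝ ρ) := hρ.fderiv_right (by norm_cast)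
  obtain ⟨C1, p1, h1⟩ := exists_fderiv_bound (hρ.of_le (by norm_cast)) hc
  have hc1 := hc.fderiv ℝ
  obtain ⟨C2, p2, h2⟩ := exists_fderiv_bound c1 hc1
  have hb : ∀ m : ℕ, ∃ C : ℝ, 0 ≤ C ∧ ∀ y, ‖iteratedFDeriv ℝ m ρ y‖ ≤ C := fun m =>
    exists_norm_bound (hc.iteratedFDeriv m)
      (hρ.continuous_iteratedFDeriv (by exact_mod_cast le_top))
  obtain ⟨C2', p2', h2'⟩ := hb 2
  obtain ⟨C3, p3, h3⟩ := hb 3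
  obtain ⟨C4, p4, h4⟩ := hb 4
  refine ⟨C1 + C2 + C2' + C3 + 2 * C4 + 1, by positivity, fun x => ⟨(h1 x).trans (by linarith),
    (h2 x).trans (by linarith), fun v => ?_⟩⟩
  have line : ∀ t : ℝ, HasDerivAt (fun s : ℝ => x + s • v) v t := fun t => by
    simpa using ((hasDerivAt_id t).smul_const v).const_add x
  have dm := hasDerivAt_iteratedFDeriv_line hρ x v
  have bm : ∀ (m : ℕ) (C : ℝ), (∀ y, ‖iteratedFDeriv ℝ m ρ y‖ ≤ C) →
      ∀ y, |iteratedFDeriv ℝ m ρ y fun _ => v| ≤ C * ‖v‖ ^ m := fun m C hC y => by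
    refine ((iteratedFDeriv ℝ m ρ y).le_opNorm _).trans ?_
    rw [Finset.prod_const, Finset.card_univ, Fintype.card_fin]
    gcongr
    exact hC y
  have i2 : ∀ y, fderiv ℝ (fderiv ℝ ρ) y v v = iteratedFDeriv ℝ 2 ρ y fun _ => v := fun y => by
    rw [iteratedFDeriv_two_apply]
  have d0 : ∀ t : ℝ, HasDerivAt (fun s : ℝ => ρ (x + s • v)) (fderiv ℝ ρ (x + t • v) v) t :=
    fun t => ((hρ.differentiable top0 _).hasFDerivAt.comp_hasDerivAt t (line t))
  have d1 : ∀ t : ℝ, HasDerivAt (fun s : ℝ => fderiv ℝ ρ (x + s • v) v)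
      (iteratedFDeriv ℝ 2 ρ (x + t • v) fun _ => v) t := fun t => by
    have := dm 1 t
    simpa using this
  have d2 := dm 2
  have d3 := dm 3
  have b2 := bm 2 C2' h2'
  have b3 := bm 3 C3 h3
  have b4 := bm 4 C4 h4
  rw [i2 x]
  refine ⟨?_, ?_, ?_⟩
  · have := taylor_two_line d0 d1 (fun t => b2 _)
    simp only [one_smul, zero_smul, add_zero] at this
    exact this.trans (by gcongr; linarith)
  · have := taylor_three_line d0 d1 d2 (fun t => b3 _)
    simp only [one_smul, zero_smul, add_zero] at this
    exact this.trans (by gcongr; linarith)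
  · have := taylor_four_line d0 d1 d2 d3 (fun t => b4 _)
    simp only [one_smul, zero_smul, add_zero, neg_smul, ← sub_eq_add_neg] at this
    rw [← mul_assoc] at this
    exact this.trans (by gcongr; linarith)

end Taylor

/-! ### Mollification at unit scale -/

section Mollify

variable {N : ℕ}

lemma integral_sub_sub {X : Type*} [MeasurableSpace X] {μ : Measure X} {f g h : X → ℝ}
    (hf : Integrable f μ) (hg : Integrable g μ) (hh : Integrable h μ) :
    ∫ y, (f y - g y - h y) ∂μ = ∫ y, f y ∂μ - ∫ y, g y ∂μ - ∫ y, h y ∂μ := by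
  rw [integral_sub (f := fun y => f y - g y) (hf.sub hg) hh, integral_sub hf hg]

lemma integral_add_sub {X : Type*} [MeasurableSpace X] {μ : Measure X} {f g h : X → ℝ}
    (hf : Integrable f μ) (hg : Integrable g μ) (hh : Integrable h μ) :
    ∫ y, (f y + g y - h y) ∂μ = ∫ y, f y ∂μ + ∫ y, g y ∂μ - ∫ y, h y ∂μ := by
  rw [integral_sub (f := fun y => f y + g y) (hf.add hg) hh, integral_add hf hg]

/-- A smooth probability density supported in the unit ball. -/
def kern (N : ℕ) : RN N → ℝ :=
  (⟨1 / 2, 1, by norm_num, by norm_num⟩ : ContDiffBump (0 : RN N)).normed volume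

lemma kern_nonneg (y : RN N) : 0 ≤ kern N y := ContDiffBump.nonneg_normed _ _

lemma integral_kern : ∫ y, kern N y = 1 := ContDiffBump.integral_normed _

lemma contDiff_kern : ContDiff ℝ (⊤ : ℕ∞) (kern N) := ContDiffBump.contDiff_normed _

lemma continuous_kern : Continuous (kern N) := contDiff_kern.continuous

lemma tsupport_kern : tsupport (kern N) = closedBall 0 1 := ContDiffBump.tsupport_normed_eq _

lemma hasCompactSupport_kern : HasCompactSupport (kern N) :=
  ContDiffBump.hasCompactSupport_normed _

lemma kern_eq_zero {y : RN N} (hy : 1 < ‖y‖) : kern N y = 0 :=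
  image_eq_zero_of_notMem_tsupport (by rw [tsupport_kern]; simpa using hy)

lemma fderiv_kern_eq_zero {y : RN N} (hy : 1 < ‖y‖) : fderiv ℝ (kern N) y = 0 :=
  fderiv_of_notMem_tsupport ℝ (by rw [tsupport_kern]; simpa using hy)

lemma fderiv_fderiv_kern_eq_zero {y : RN N} (hy : 1 < ‖y‖) :
    fderiv ℝ (fderiv ℝ (kern N)) y = 0 :=
  fderiv_of_notMem_tsupport ℝ fun h => by
    have := tsupport_fderiv_subset ℝ h
    rw [tsupport_kern] at this
    simp at this
    linarith

lemma integrable_kern : Integrable (kern N) :=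
  continuous_kern.integrable_of_hasCompactSupport hasCompactSupport_kern

/-- Regularization of `w` at scale `ε`. -/
def mollify (ε : ℝ) (w : RN N → ℝ) (x : RN N) : ℝ := ∫ y, w (x - ε • y) * kern N y

variable {w w' : RN N → ℝ} {ε : ℝ}

lemma integrable_mollify (hw : Continuous w) (ε : ℝ) (x : RN N) :
    Integrable fun y => w (x - ε • y) * kern N y :=
  ((hw.comp (by fun_prop)).mul continuous_kern).integrable_of_hasCompactSupport
    hasCompactSupport_kern.mul_left

lemma mollify_const (ε a : ℝ) (x : RN N) : mollify ε (fun _ => a) x = a := by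
  simp [mollify, integral_const_mul, integral_kern]

lemma mollify_add (hw : Continuous w) (hw' : Continuous w') (ε : ℝ) (x : RN N) :
    mollify ε (fun y => w y + w' y) x = mollify ε w x + mollify ε w' x := by
  simp only [mollify, add_mul]
  exact integral_add (integrable_mollify hw ε x) (integrable_mollify hw' ε x)

lemma mollify_sub (hw : Continuous w) (hw' : Continuous w') (ε : ℝ) (x : RN N) :
    mollify ε (fun y => w y - w' y) x = mollify ε w x - mollify ε w' x := by
  simp only [mollify, sub_mul]
  exact integral_sub (integrable_mollify hw ε x) (integrable_mollify hw' ε x)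

lemma mollify_const_mul (a ε : ℝ) (w : RN N → ℝ) (x : RN N) :
    mollify ε (fun y => a * w y) x = a * mollify ε w x := by
  simp only [mollify, mul_assoc, integral_const_mul]

lemma mollify_sum {ι : Type*} (s : Finset ι) {f : ι → RN N → ℝ} (hf : ∀ i, Continuous (f i))
    (ε : ℝ) (x : RN N) :
    mollify ε (fun y => ∑ i ∈ s, f i y) x = ∑ i ∈ s, mollify ε (f i) x := by
  simp only [mollify, Finset.sum_mul]
  exact integral_finsetSum _ fun i _ => integrable_mollify (hf i) ε x

lemma mollify_shift (ε : ℝ) (w : RN N → ℝ) (e x : RN N) :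
    mollify ε (fun y => w (y + e)) x = mollify ε w (x + e) := by
  simp only [mollify]
  congr 1 with y
  congr 2
  abel

lemma mollify_mono (hw : Continuous w) (hw' : Continuous w') (hε : 0 ≤ ε) {x : RN N}
    (h : ∀ z, ‖z - x‖ ≤ ε → w z ≤ w' z) : mollify ε w x ≤ mollify ε w' x := by
  refine integral_mono (integrable_mollify hw ε x) (integrable_mollify hw' ε x) fun y => ?_
  rcases le_or_gt ‖y‖ 1 with hy | hy
  · refine mul_le_mul_of_nonneg_right (h _ ?_) (kern_nonneg y)
    rw [sub_sub_cancel_left, norm_neg, norm_smul, Real.norm_eq_abs, abs_of_nonneg hε]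
    exact mul_le_of_le_one_right hε hy
  · simp [kern_eq_zero hy]

lemma abs_mollify_sub_le (hw : Continuous w) (hε : 0 ≤ ε) {x : RN N} {a B : ℝ}
    (h : ∀ z, ‖z - x‖ ≤ ε → |w z - a| ≤ B) : |mollify ε w x - a| ≤ B := by
  have h1 := mollify_mono (w' := fun _ => a + B) hw continuous_const hε
    (fun z hz => by linarith [(abs_le.1 (h z hz)).2])
  have h2 := mollify_mono (w := fun _ => a - B) continuous_const hw hε
    (fun z hz => by linarith [(abs_le.1 (h z hz)).1])
  rw [mollify_const] at h1 h2
  rw [abs_le]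
  constructor <;> linarith

lemma abs_mollify_le (hw : Continuous w) (hε : 0 ≤ ε) {B : ℝ} (h : ∀ z, |w z| ≤ B) (x : RN N) :
    |mollify ε w x| ≤ B := by
  simpa using abs_mollify_sub_le (a := 0) hw hε (x := x) (by simpa using fun z _ => h z)

lemma abs_mollify_sub_mollify_le (hw : Continuous w) (hε : 0 ≤ ε) {x x' : RN N} {B : ℝ}
    (h : ∀ z, |w (z + (x - x')) - w z| ≤ B) : |mollify ε w x - mollify ε w x'| ≤ B := by
  have h1 := mollify_shift ε w (x - x') x'
  rw [add_sub_cancel] at h1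
  rw [← h1, ← mollify_sub (w := fun y => w (y + (x - x'))) (hw.comp (by fun_prop)) hw]
  exact abs_mollify_le ((hw.comp (by fun_prop)).sub hw) hε h x'

lemma mollify_eq_scale (hε : ε ≠ 0) (w : RN N → ℝ) :
    mollify ε w = fun x => mollify 1 (fun y => w (ε • y)) (ε⁻¹ • x) := by
  ext x
  simp only [mollify, smul_sub, smul_smul, mul_inv_cancel₀ hε, one_smul]

lemma contDiff_mollify (hw : Continuous w) (hε : ε ≠ 0) : ContDiff ℝ 2 (mollify ε w) := by
  rw [mollify_eq_scale hε]
  have h1 : ∀ w : RN N → ℝ, Continuous w → ContDiff ℝ 2 (mollify 1 w) := fun w hw => by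
    have := hasCompactSupport_kern.contDiff_convolution_left (n := 2) (ContinuousLinearMap.mul ℝ ℝ)
      
      (contDiff_kern.of_le (by norm_cast)) (hw.locallyIntegrable (μ := (volume : Measure (RN N))))
    have e : mollify 1 w = convolution (kern N) w (ContinuousLinearMap.mul ℝ ℝ) volume := by
      funext x
      simp only [mollify, convolution, one_smul, ContinuousLinearMap.mul_apply']
      congr 1 with y
      ring
    rw [e]
    exact_mod_cast this
  exact (h1 _ (hw.comp (by fun_prop))).comp (contDiff_const_smul _)

/-- Second, third and fourth order Taylor estimates of a function varying by `S` at scale `ε`. -/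
structure TaylorBd (φ : RN N → ℝ) (S ε : ℝ) : Prop where
  contDiff : ContDiff ℝ 2 φ
  taylor : ∀ x, ‖fderiv ℝ φ x‖ ≤ S / ε ∧ ∃ q : RN N →L[ℝ] RN N →L[ℝ] ℝ, ∀ v,
    |φ (x + v) - φ x - fderiv ℝ φ x v| ≤ S / ε ^ 2 * ‖v‖ ^ 2 ∧
    |φ (x + v) - φ x - fderiv ℝ φ x v - 1 / 2 * q v v| ≤ S / ε ^ 3 * ‖v‖ ^ 3 ∧
    |φ (x + v) + φ (x - v) - 2 * φ x - q v v| ≤ S / ε ^ 4 * ‖v‖ ^ 4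

/-- Increments of the mollified function are moved onto the kernel, and the Taylor polynomial of the
kernel integrates to `p` and `q`. The growth `1 + ‖x - y‖` covers bounded and Lipschitz functions at
once, and the estimates hold for every `v`, as the nonlocal terms require. -/
lemma exists_taylor_mollify_one (N : ℕ) : ∃ C : ℝ, 0 < C ∧ ∀ (w : RN N → ℝ) (S : ℝ),
    Continuous w → 0 ≤ S → (∀ x y, |w x - w y| ≤ S * (1 + ‖x - y‖)) →
    ∀ x, ∃ (p : RN N →L[ℝ] ℝ) (q : RN N →L[ℝ] RN N →L[ℝ] ℝ), ‖p‖ ≤ C * S ∧ ∀ v,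
    |mollify 1 w (x + v) - mollify 1 w x - p v| ≤ C * S * ‖v‖ ^ 2 ∧
    |mollify 1 w (x + v) - mollify 1 w x - p v - 1 / 2 * q v v| ≤ C * S * ‖v‖ ^ 3 ∧
    |mollify 1 w (x + v) + mollify 1 w (x - v) - 2 * mollify 1 w x - q v v|
      ≤ C * S * ‖v‖ ^ 4 := by
  obtain ⟨C, hC, hT⟩ := exists_taylor_bound (contDiff_kern (N := N)) hasCompactSupport_kern
  -- For `‖v‖ ≤ 1` all shifted kernels live in the ball of radius `2`, where `w` differs from its
  -- value at the centre by at most `3 S`.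
  set V : ℝ := volume.real (closedBall (0 : RN N) 2) with hV
  have hV0 : 0 ≤ V := measureReal_nonneg
  refine ⟨4 + 6 * V * C, by positivity, fun w S hw hS hosc x => ?_⟩
  have cD1 : Continuous (fderiv ℝ (kern N)) := contDiff_kern.continuous_fderiv (by simp)
  have cD2 : Continuous (fderiv ℝ (fderiv ℝ (kern N))) := by
    have c1 : ContDiff ℝ 1 (fderiv ℝ (kern N)) := contDiff_kern.fderiv_right (by norm_cast)
    exact c1.continuous_fderiv one_ne_zero
  have cw : Continuous fun y => w (x - y) - w x := by fun_prop
  have osc2 : ∀ y, ‖y‖ ≤ 2 → |w (x - y) - w x| ≤ 3 * S := fun y hy => by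
    refine (hosc _ _).trans ?_
    rw [sub_sub_cancel_left, norm_neg, mul_comm]
    gcongr
    linarith
  have key : ∀ {F : Type} [NormedAddCommGroup F] [NormedSpace ℝ F] (R : RN N → F) (B : ℝ),
      Continuous R → (∀ y, 2 < ‖y‖ → R y = 0) → (∀ y, ‖R y‖ ≤ B) →
      Integrable (fun y => (w (x - y) - w x) • R y) ∧
      ‖∫ y, (w (x - y) - w x) • R y‖ ≤ 3 * S * B * V := by
    intro F _ _ R B hR h0 hB
    have hB0 : 0 ≤ B := (norm_nonneg _).trans (hB 0)
    have hsup : HasCompactSupport fun y => (w (x - y) - w x) • R y :=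
      HasCompactSupport.intro (isCompact_closedBall 0 2) fun y hy => by
        rw [h0 y (by simpa using hy), smul_zero]
    refine ⟨(cw.smul hR).integrable_of_hasCompactSupport hsup, ?_⟩
    rw [← setIntegral_eq_integral_of_forall_compl_eq_zero (s := closedBall 0 2)
      (fun y hy => by rw [h0 y (by simpa using hy), smul_zero])]
    refine norm_setIntegral_le_of_norm_le_const
      (isCompact_closedBall _ _).measure_lt_top fun y hy => ?_
    rw [norm_smul]
    exact mul_le_mul (osc2 y (by simpa using hy)) (hB y) (norm_nonneg _) (by positivity)
  obtain ⟨ip, bp⟩ := key (fderiv ℝ (kern N)) C cD1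
    (fun y hy => fderiv_kern_eq_zero (by linarith)) (fun y => (hT y).1)
  obtain ⟨iq, bq⟩ := key (fderiv ℝ (fderiv ℝ (kern N))) C cD2
    (fun y hy => fderiv_fderiv_kern_eq_zero (by linarith)) (fun y => (hT y).2.1)
  set p : RN N →L[ℝ] ℝ := ∫ y, (w (x - y) - w x) • fderiv ℝ (kern N) y with hp
  set q : RN N →L[ℝ] RN N →L[ℝ] ℝ :=
    ∫ y, (w (x - y) - w x) • fderiv ℝ (fderiv ℝ (kern N)) y with hq
  have papp : ∀ v, p v = ∫ y, (w (x - y) - w x) • fderiv ℝ (kern N) y v := fun v => by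
    rw [hp, ContinuousLinearMap.integral_apply ip]; rfl
  have ip' : ∀ v, Integrable fun y => (w (x - y) - w x) • fderiv ℝ (kern N) y v := fun v =>
    ip.apply_continuousLinearMap v
  have qapp : ∀ v, q v v = ∫ y, (w (x - y) - w x) • fderiv ℝ (fderiv ℝ (kern N)) y v v :=
    fun v => by
      rw [hq, ContinuousLinearMap.integral_apply iq, ContinuousLinearMap.integral_apply
        (iq.apply_continuousLinearMap v)]; rfl
  have iq' : ∀ v, Integrable fun y => (w (x - y) - w x) • fderiv ℝ (fderiv ℝ (kern N)) y v v :=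
    fun v => (iq.apply_continuousLinearMap v).apply_continuousLinearMap v
  have ik : ∀ v, Integrable fun y => (w (x - y) - w x) • (kern N (y + v) - kern N y) := fun v =>
    (cw.smul ((continuous_kern.comp (by fun_prop)).sub
      continuous_kern)).integrable_of_hasCompactSupport
        (HasCompactSupport.intro (isCompact_closedBall 0 (1 + ‖v‖)) fun y hy => by
          have hy : 1 + ‖v‖ < ‖y‖ := by simpa using hy
          have := norm_sub_le (y + v) v
          rw [add_sub_cancel_right] at this
          simp [kern_eq_zero (show 1 < ‖y + v‖ by linarith),
            kern_eq_zero (show 1 < ‖y‖ by linarith [norm_nonneg v])])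
  -- Increments of the kernel have zero integral, so `w x` may be subtracted and only the
  -- oscillation of `w` enters.
  have diff : ∀ v, mollify 1 w (x + v) - mollify 1 w x
      = ∫ y, (w (x - y) - w x) • (kern N (y + v) - kern N y) := fun v => by
    have e1 : mollify 1 w (x + v) = ∫ y, w (x - y) * kern N (y + v) := by
      rw [mollify, ← integral_add_right_eq_self _ v]
      congr 1 with y
      congr 2
      rw [one_smul]
      abel
    have i1 : Integrable fun y => w (x - y) * kern N (y + v) := by
      have := (integrable_mollify hw 1 (x + v)).comp_add_right v
      refine this.congr (Filter.Eventually.of_forall fun y => ?_)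
      simp only [one_smul]
      congr 2
      abel
    have i2 : Integrable fun y => w (x - y) * kern N y := by
      simpa using integrable_mollify hw 1 x
    have i3 : Integrable fun y => kern N (y + v) - kern N y :=
      (integrable_kern.comp_add_right v).sub integrable_kern
    have z : ∫ y, w x * (kern N (y + v) - kern N y) = 0 := by
      rw [integral_const_mul, integral_sub (integrable_kern.comp_add_right v) integrable_kern,
        integral_add_right_eq_self, sub_self, mul_zero]
    have e2 : mollify 1 w x = ∫ y, w (x - y) * kern N y := by simp [mollify]
    calc _ = (∫ y, w (x - y) * kern N (y + v)) - (∫ y, w (x - y) * kern N y)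
          - ∫ y, w x * (kern N (y + v) - kern N y) := by rw [e1, e2, z, sub_zero]
      _ = ∫ y, (w (x - y) * kern N (y + v) - w (x - y) * kern N y
          - w x * (kern N (y + v) - kern N y)) := by
        rw [integral_sub_sub i1 i2 (i3.const_mul _)]
      _ = _ := by
        congr 1 with y
        rw [smul_eq_mul]
        ring
  have bnd : ∀ v, |mollify 1 w (x + v) - mollify 1 w x| ≤ S * (1 + ‖v‖) := fun v => by
    refine abs_mollify_sub_mollify_le hw zero_le_one fun z => ?_
    simpa using hosc (z + (x + v - x)) z
  have bp' : ∀ v, |p v| ≤ 3 * S * C * V * ‖v‖ := fun v =>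
    (p.le_opNorm v).trans (by gcongr)
  have bq' : ∀ v, |q v v| ≤ 3 * S * C * V * ‖v‖ ^ 2 := fun v =>
    (q.le_opNorm₂ v v).trans (by rw [mul_assoc, ← sq]; gcongr)
  have hSCV : 0 ≤ S * C * V := by positivity
  refine ⟨p, q, bp.trans (by nlinarith), fun v => ?_⟩
  have h2' : ∀ y : RN N, ‖v‖ ≤ 1 → 2 < ‖y‖ → kern N (y + v) = 0 := fun y hv hy => by
    have := norm_sub_le (y + v) v
    rw [add_sub_cancel_right] at this
    exact kern_eq_zero (by linarith)
  have h2'' : ∀ y : RN N, ‖v‖ ≤ 1 → 2 < ‖y‖ → kern N (y - v) = 0 := fun y hv hy => by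
    have := norm_add_le (y - v) v
    rw [sub_add_cancel] at this
    exact kern_eq_zero (by linarith)
  rcases le_or_gt ‖v‖ 1 with hv | hv
  · refine ⟨?_, ?_, ?_⟩
    · have := (key (fun y => kern N (y + v) - kern N y - fderiv ℝ (kern N) y v) (C * ‖v‖ ^ 2)
        (by have := continuous_kern (N := N); fun_prop) (fun y hy => by
          simp [h2' y hv hy, kern_eq_zero (show 1 < ‖y‖ by linarith),
            fderiv_kern_eq_zero (show 1 < ‖y‖ by linarith)]) (fun y => ((hT y).2.2 v).1)).2
      simp only [smul_sub (w _ - w _) (_ - _) _] at this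
      rw [integral_sub (ik v) (ip' v), ← papp, ← diff] at this
      refine this.trans ?_
      have : 0 ≤ ‖v‖ ^ 2 := by positivity
      nlinarith [mul_nonneg hSCV this, mul_nonneg hS this]
    · have := (key (fun y => kern N (y + v) - kern N y - fderiv ℝ (kern N) y v
          - 1 / 2 * fderiv ℝ (fderiv ℝ (kern N)) y v v) (C * ‖v‖ ^ 3)
        (by have := continuous_kern (N := N); fun_prop) (fun y hy => by
          simp [h2' y hv hy, kern_eq_zero (show 1 < ‖y‖ by linarith),
            fderiv_kern_eq_zero (show 1 < ‖y‖ by linarith),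
            fderiv_fderiv_kern_eq_zero (show 1 < ‖y‖ by linarith)])
          (fun y => ((hT y).2.2 v).2.1)).2
      simp only [smul_sub (w _ - w _) (_ - _) _, ← mul_smul_comm] at this
      rw [integral_sub_sub (ik v) (ip' v) ((iq' v).const_mul _),
        integral_const_mul, ← papp, ← qapp, ← diff] at this
      refine this.trans ?_
      have : 0 ≤ ‖v‖ ^ 3 := by positivity
      nlinarith [mul_nonneg hSCV this, mul_nonneg hS this]
    · have := (key (fun y => (kern N (y + v) - kern N y) + (kern N (y + -v) - kern N y)
          - fderiv ℝ (fderiv ℝ (kern N)) y v v) (C * ‖v‖ ^ 4)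
        (by have := continuous_kern (N := N); fun_prop) (fun y hy => by
          simp [h2' y hv hy, ← sub_eq_add_neg, h2'' y hv hy,
            kern_eq_zero (show 1 < ‖y‖ by linarith),
            fderiv_fderiv_kern_eq_zero (show 1 < ‖y‖ by linarith)])
          (fun y => by
            have := ((hT y).2.2 v).2.2
            rw [sub_eq_add_neg y v] at this
            rw [Real.norm_eq_abs]
            convert this using 2
            ring)).2
      simp only [smul_sub (w _ - w _) (_ + _) _, smul_add] at this
      rw [integral_add_sub (ik v) (ik (-v)) (iq' v),
        ← qapp, ← diff, ← diff, ← sub_eq_add_neg] at this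
      have h3 : mollify 1 w (x + v) - mollify 1 w x + (mollify 1 w (x - v) - mollify 1 w x) - q v v
          = mollify 1 w (x + v) + mollify 1 w (x - v) - 2 * mollify 1 w x - q v v := by ring
      rw [h3] at this
      refine this.trans ?_
      have : 0 ≤ ‖v‖ ^ 4 := by positivity
      nlinarith [mul_nonneg hSCV this, mul_nonneg hS this]
  -- For `‖v‖ > 1` no cancellation is needed: each term is bounded separately, and lower powers of
  -- `‖v‖` are dominated by higher ones.
  · have b1 := bnd v
    have b2 := bnd (-v)
    have b3 := bp' v
    have b4 := bq' v
    rw [norm_neg, ← sub_eq_add_neg] at b2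
    have e2 : ‖v‖ ≤ ‖v‖ ^ 2 := by nlinarith
    have e3 : ‖v‖ ^ 2 ≤ ‖v‖ ^ 3 := by nlinarith [sq_nonneg ‖v‖]
    have e4 : ‖v‖ ^ 3 ≤ ‖v‖ ^ 4 := by nlinarith [pow_pos (zero_lt_one.trans hv) 3]
    have hSv : S * (1 + ‖v‖) ≤ 2 * (S * ‖v‖) := by nlinarith
    have f2 := mul_le_mul_of_nonneg_left e2 hS
    have f3 := mul_le_mul_of_nonneg_left e3 hS
    have f4 := mul_le_mul_of_nonneg_left e4 hS
    have g2 := mul_le_mul_of_nonneg_left e2 hSCV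
    have g3 := mul_le_mul_of_nonneg_left e3 hSCV
    have g4 := mul_le_mul_of_nonneg_left e4 hSCV
    have n2 : 0 ≤ S * ‖v‖ := by positivity
    have n3 : 0 ≤ S * C * V * ‖v‖ := by positivity
    refine ⟨?_, ?_, ?_⟩ <;> rw [abs_le] at * <;> constructor <;> linarith

end Mollify

/-! ### Mollification at scale `ε`, and penalized maxima -/

section MollifyTaylor

variable {N : ℕ}

lemma hasFDerivAt_of_abs_le {E : Type*} [NormedAddCommGroup E] [NormedSpace ℝ E] {φ : E → ℝ}
    {x : E} {p : E →L[ℝ] ℝ} {B : ℝ} (h : ∀ v, |φ (x + v) - φ x - p v| ≤ B * ‖v‖ ^ 2) :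
    HasFDerivAt φ p x := by
  rw [hasFDerivAt_iff_isLittleO_nhds_zero]
  have h1 : (fun v => φ (x + v) - φ x - p v) =O[nhds 0] fun v => ‖v‖ ^ 2 :=
    Asymptotics.IsBigO.of_bound B (Filter.Eventually.of_forall fun v => by
      simpa using h v)
  exact h1.trans_isLittleO (Asymptotics.isLittleO_norm_pow_id one_lt_two)

lemma exists_taylorBd_mollify (N : ℕ) : ∃ C : ℝ, 0 < C ∧ ∀ (w : RN N → ℝ) (S ε : ℝ),
    Continuous w → 0 ≤ S → 0 < ε → (∀ x y, |w x - w y| ≤ S * (1 + ‖x - y‖ / ε)) →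
    TaylorBd (mollify ε w) (C * S) ε := by
  obtain ⟨C, hC, hT⟩ := exists_taylor_mollify_one N
  refine ⟨C, hC, fun w S ε hw hS hε hosc => ⟨contDiff_mollify hw hε.ne', fun x => ?_⟩⟩
  obtain ⟨p, q, hp, hpq⟩ := hT (fun y => w (ε • y)) S (hw.comp (by fun_prop)) hS
    (fun x y => by
      refine (hosc _ _).trans_eq ?_
      rw [← smul_sub, norm_smul, Real.norm_eq_abs, abs_of_pos hε, mul_div_cancel_left₀ _ hε.ne'])
    (ε⁻¹ • x)
  have nv : ∀ v : RN N, ‖ε⁻¹ • v‖ = ‖v‖ / ε := fun v => by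
    rw [norm_smul, norm_inv, Real.norm_eq_abs, abs_of_pos hε, inv_mul_eq_div]
  have hd : HasFDerivAt (mollify ε w) (ε⁻¹ • p) x := by
    refine hasFDerivAt_of_abs_le (B := C * S / ε ^ 2) fun v => ?_
    have := (hpq (ε⁻¹ • v)).1
    rw [nv, ← smul_add] at this
    rw [mollify_eq_scale hε.ne']
    refine le_of_le_of_eq (le_of_eq_of_le ?_ this) ?_
    · simp
    · ring
  refine ⟨?_, ε⁻¹ ^ 2 • q, fun v => ?_⟩
  · rw [hd.fderiv, norm_smul, norm_inv, Real.norm_eq_abs, abs_of_pos hε, inv_mul_eq_div]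
    gcongr
  · obtain ⟨h2, h3, h4⟩ := hpq (ε⁻¹ • v)
    rw [nv, ← smul_add] at h2 h3 h4
    rw [← smul_sub] at h4
    rw [hd.fderiv, mollify_eq_scale hε.ne']
    refine ⟨le_of_le_of_eq (le_of_eq_of_le ?_ h2) ?_, le_of_le_of_eq (le_of_eq_of_le ?_ h3) ?_,
      le_of_le_of_eq (le_of_eq_of_le ?_ h4) ?_⟩
    · simp
    · ring
    · congr 1
      simp
      ring
    · ring
    · congr 1
      simp
      ring
    · ring

namespace TaylorBd

variable {φ : RN N → ℝ} {S ε : ℝ}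

lemma mono {S' ε' : ℝ} (h : TaylorBd φ S ε) (hS : S ≤ S') (hS0 : 0 ≤ S') (hε' : 0 < ε')
    (hε : ε' ≤ ε) : TaylorBd φ S' ε' := by
  refine ⟨h.contDiff, fun x => ?_⟩
  obtain ⟨hp, q, hq⟩ := h.taylor x
  refine ⟨hp.trans (by gcongr), q, fun v => ?_⟩
  obtain ⟨h2, h3, h4⟩ := hq v
  exact ⟨h2.trans (by gcongr), h3.trans (by gcongr),
    h4.trans (by gcongr)⟩

lemma abs_sub_sub_le (h : TaylorBd φ S ε) (x v : RN N) :
    |φ (x + v) - φ x - fderiv ℝ φ x v| ≤ S / ε ^ 2 * ‖v‖ ^ 2 := by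
  obtain ⟨_, q, hq⟩ := h.taylor x
  exact (hq v).1

lemma continuous (h : TaylorBd φ S ε) : Continuous φ := h.contDiff.continuous

lemma abs_fderiv_le (h : TaylorBd φ S ε) (x v : RN N) : |fderiv ℝ φ x v| ≤ S / ε * ‖v‖ :=
  ((fderiv ℝ φ x).le_opNorm v).trans (by gcongr; exact (h.taylor x).1)

lemma abs_sub_le (h : TaylorBd φ S ε) (x v : RN N) :
    |φ (x + v) - φ x| ≤ S / ε * ‖v‖ + S / ε ^ 2 * ‖v‖ ^ 2 := by
  have h1 := h.abs_sub_sub_le x v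
  have h2 := h.abs_fderiv_le x v
  rw [abs_le] at *
  constructor <;> linarith

lemma hasFDerivAt (h : TaylorBd φ S ε) (x : RN N) : HasFDerivAt φ (fderiv ℝ φ x) x :=
  (h.contDiff.differentiable two_ne_zero x).hasFDerivAt

lemma comp_add_right (h : TaylorBd φ S ε) (e : RN N) : TaylorBd (fun y => φ (y + e)) S ε := by
  refine ⟨h.contDiff.comp (by fun_prop), fun x => ?_⟩
  obtain ⟨hp, q, hq⟩ := h.taylor (x + e)
  rw [fderiv_comp_add_right]
  refine ⟨hp, q, fun v => ?_⟩
  rw [add_right_comm x v e, show x - v + e = x + e - v by abel]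
  exact hq v

end TaylorBd

lemma continuous_of_lipschitz {w : RN N → ℝ} {l : ℝ} (h : ∀ x y, |w x - w y| ≤ l * ‖x - y‖) :
    Continuous w := by
  refine (LipschitzWith.of_dist_le_mul (K := l.toNNReal) fun x y => ?_).continuous
  rw [Real.dist_eq, dist_eq_norm]
  exact (h x y).trans (by gcongr; exact Real.le_coe_toNNReal l)

lemma lipschitz_mollify {w : RN N → ℝ} {l ε : ℝ} (hε : 0 ≤ ε)
    (h : ∀ x y, |w x - w y| ≤ l * ‖x - y‖) (x y : RN N) :
    |mollify ε w x - mollify ε w y| ≤ l * ‖x - y‖ :=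
  abs_mollify_sub_mollify_le (continuous_of_lipschitz h) hε fun z => by
    simpa using h (z + (x - y)) z

lemma abs_mollify_sub_self_le {w : RN N → ℝ} {l ε : ℝ} (hε : 0 ≤ ε) (hl : 0 ≤ l)
    (h : ∀ x y, |w x - w y| ≤ l * ‖x - y‖) (x : RN N) : |mollify ε w x - w x| ≤ l * ε :=
  abs_mollify_sub_le (continuous_of_lipschitz h) hε fun z hz => (h z x).trans (by gcongr)

lemma continuous_mollify {w : RN N → ℝ} (hw : Continuous w) {ε : ℝ} (hε : ε ≠ 0) :
    Continuous (mollify ε w) := (contDiff_mollify hw hε).continuous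

/-- At scale `ε` the oscillation is `l ε`. This gain of one power of `ε` over a merely bounded
function is what produces the rates. -/
lemma exists_taylorBd_lipschitz (N : ℕ) : ∃ C : ℝ, 0 < C ∧ ∀ (w : RN N → ℝ) (l ε : ℝ),
    0 ≤ l → 0 < ε → (∀ x y, |w x - w y| ≤ l * ‖x - y‖) →
    TaylorBd (mollify ε w) (C * (l * ε)) ε := by
  obtain ⟨C, hC, h⟩ := exists_taylorBd_mollify N
  refine ⟨C, hC, fun w l ε hl hε hw =>
    h w (l * ε) ε (continuous_of_lipschitz hw) (by positivity) hε fun x y => (hw x y).trans ?_⟩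
  have : l * ε * (1 + ‖x - y‖ / ε) = l * ε + l * ‖x - y‖ := by field_simp
  rw [this]
  have : 0 ≤ l * ε := by positivity
  linarith

/-- Serves `neg_generator_mollify_le`, where the function to be mollified contains the image of a
jump operator and only a sup bound is kept. -/
lemma exists_taylorBd_bounded (N : ℕ) : ∃ C : ℝ, 0 < C ∧ ∀ (w : RN N → ℝ) (B ε : ℝ),
    Continuous w → 0 < ε → (∀ x, |w x| ≤ B) → TaylorBd (mollify ε w) (C * B) ε := by
  obtain ⟨C, hC, h⟩ := exists_taylorBd_mollify N
  refine ⟨C * 2, by positivity, fun w B ε hw hε hB => ?_⟩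
  have hB0 : 0 ≤ B := (abs_nonneg _).trans (hB 0)
  rw [mul_assoc]
  refine h w (2 * B) ε hw (by positivity) hε fun x y => ?_
  have : 0 ≤ 2 * B * (‖x - y‖ / ε) := by positivity
  have h1 := hB x
  have h2 := hB y
  rw [abs_le] at *
  constructor <;> nlinarith

/-- A smooth penalization growing linearly at infinity. -/
lemma exists_penalization (N : ℕ) : ∃ (ζ : RN N → ℝ) (S : ℝ), 0 ≤ S ∧ TaylorBd ζ S 1 ∧
    ∀ x, ‖x‖ - 1 ≤ ζ x := by
  obtain ⟨C, hC, h⟩ := exists_taylorBd_lipschitz N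
  have hl : ∀ x y : RN N, |‖x‖ - ‖y‖| ≤ 1 * ‖x - y‖ := fun x y => by
    simpa using abs_norm_sub_norm_le x y
  refine ⟨mollify 1 norm, C * (1 * 1), by positivity, h norm 1 1 zero_le_one one_pos hl,
    fun x => ?_⟩
  have := abs_mollify_sub_self_le zero_le_one zero_le_one hl x
  linarith [(abs_le.1 this).1]

/-- A bounded continuous function has an almost maximum at which a penalized maximum is attained. -/
lemma exists_penalized_max {v ζ : RN N → ℝ} (hv : Continuous v) {B : ℝ} (hB : ∀ x, |v x| ≤ B)
    (hζ : Continuous ζ) (hζ' : ∀ x, ‖x‖ - 1 ≤ ζ x) {κ : ℝ} (hκ : 0 < κ) :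
    ∃ x, ∀ y, v y - κ * ζ y ≤ v x - κ * ζ x := by
  have h : Continuous fun x => κ * ζ x - v x := by fun_prop
  have hlim : Filter.Tendsto (fun x => κ * ζ x - v x) (Filter.cocompact (RN N)) Filter.atTop := by
    have h1 : Filter.Tendsto (fun x : RN N => κ * (‖x‖ + -1) + -B) (Filter.cocompact (RN N))
        Filter.atTop :=
      Filter.tendsto_atTop_add_const_right _ _ (Filter.Tendsto.const_mul_atTop hκ
        (Filter.tendsto_atTop_add_const_right _ _ (tendsto_norm_cocompact_atTop (E := RN N))))
    refine Filter.tendsto_atTop_mono (fun x => ?_) h1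
    have := mul_le_mul_of_nonneg_left (hζ' x) hκ.le
    have := (abs_le.1 (hB x)).2
    linarith
  obtain ⟨x, hx⟩ := h.exists_forall_le hlim
  exact ⟨x, fun y => by linarith [hx y]⟩

end MollifyTaylor

/-! ### Finite difference operators with nonnegative weights -/

section Jump

variable {N : ℕ}

/-- Translation invariant finite difference operators `φ ↦ ∑ i, W i (φ(x + y i) - φ(x))` with
nonnegative weights of total mass at most `Λ`. -/
def IsJump (T : (RN N → ℝ) → RN N → ℝ) (Λ : ℝ) : Prop :=
  ∃ (ι : Type) (_ : Fintype ι) (y : ι → RN N) (W : ι → ℝ), (∀ i, 0 ≤ W i) ∧ ∑ i, W i ≤ Λ ∧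
    ∀ φ x, T φ x = ∑ i, W i * (φ (x + y i) - φ x)

namespace IsJump

variable {T T' : (RN N → ℝ) → RN N → ℝ} {Λ Λ' : ℝ}

lemma nonneg (h : IsJump T Λ) : 0 ≤ Λ := by
  obtain ⟨ι, _, y, W, hW, hΛ, _⟩ := h
  exact (Finset.sum_nonneg fun i _ => hW i).trans hΛ

lemma mono (h : IsJump T Λ) (hΛ : Λ ≤ Λ') : IsJump T Λ' := by
  obtain ⟨ι, i1, y, W, hW, hs, hT⟩ := h
  exact ⟨ι, i1, y, W, hW, hs.trans hΛ, hT⟩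

lemma zero : IsJump (fun (_ : RN N → ℝ) _ => 0) 0 :=
  ⟨Empty, inferInstance, Empty.elim, Empty.elim, by simp, by simp, by simp⟩

lemma add (h : IsJump T Λ) (h' : IsJump T' Λ') :
    IsJump (fun φ x => T φ x + T' φ x) (Λ + Λ') := by
  obtain ⟨ι, i1, y, W, hW, hs, hT⟩ := h
  obtain ⟨ι', i1', y', W', hW', hs', hT'⟩ := h'
  refine ⟨ι ⊕ ι', inferInstance, Sum.elim y y', Sum.elim W W', ?_, ?_, fun φ x => ?_⟩
  · rintro (i | i)
    · exact hW i
    · exact hW' i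
  · simpa using add_le_add hs hs'
  · simp [hT, hT']

lemma const_mul (h : IsJump T Λ) {a : ℝ} (ha : 0 ≤ a) :
    IsJump (fun φ x => a * T φ x) (a * Λ) := by
  obtain ⟨ι, i1, y, W, hW, hs, hT⟩ := h
  refine ⟨ι, i1, y, fun i => a * W i, fun i => mul_nonneg ha (hW i), ?_, fun φ x => ?_⟩
  · rw [← Finset.mul_sum]
    gcongr
  · simp [hT, Finset.mul_sum, mul_assoc]

lemma sum {ι : Type*} (s : Finset ι) {T : ι → (RN N → ℝ) → RN N → ℝ} {Λ : ι → ℝ}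
    (h : ∀ i, IsJump (T i) (Λ i)) : IsJump (fun φ x => ∑ i ∈ s, T i φ x) (∑ i ∈ s, Λ i) := by
  classical
  induction s using Finset.induction_on with
  | empty => simpa using zero
  | insert a s ha ih =>
    simp only [Finset.sum_insert ha]
    exact (h a).add ih

lemma difference (y : RN N) : IsJump (fun φ x => φ (x + y) - φ x) 1 :=
  ⟨Unit, inferInstance, fun _ => y, fun _ => 1, by simp, by simp, by simp⟩

lemma map_sub (h : IsJump T Λ) (φ ψ : RN N → ℝ) (x : RN N) :
    T (fun y => φ y - ψ y) x = T φ x - T ψ x := by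
  obtain ⟨ι, i1, y, W, hW, hs, hT⟩ := h
  simp only [hT, ← Finset.sum_sub_distrib]
  congr 1 with i
  ring

lemma map_const_mul (h : IsJump T Λ) (a : ℝ) (φ : RN N → ℝ) (x : RN N) :
    T (fun y => a * φ y) x = a * T φ x := by
  obtain ⟨ι, i1, y, W, hW, hs, hT⟩ := h
  simp only [hT, Finset.mul_sum]
  congr 1 with i
  ring

lemma map_const (h : IsJump T Λ) (a : ℝ) (x : RN N) : T (fun _ => a) x = 0 := by
  obtain ⟨ι, i1, y, W, hW, hs, hT⟩ := h
  simp [hT]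

lemma shift (h : IsJump T Λ) (φ : RN N → ℝ) (e x : RN N) :
    T (fun y => φ (y + e)) x = T φ (x + e) := by
  obtain ⟨ι, i1, y, W, hW, hs, hT⟩ := h
  simp only [hT]
  congr 1 with i
  rw [add_right_comm]

lemma continuous (h : IsJump T Λ) {φ : RN N → ℝ} (hφ : Continuous φ) : Continuous (T φ) := by
  obtain ⟨ι, i1, y, W, hW, hs, hT⟩ := h
  rw [show T φ = fun x => ∑ i, W i * (φ (x + y i) - φ x) from funext (hT φ)]
  fun_prop

lemma mollify_comm (h : IsJump T Λ) {φ : RN N → ℝ} (hφ : Continuous φ) (ε : ℝ) (x : RN N) :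
    mollify ε (T φ) x = T (mollify ε φ) x := by
  obtain ⟨ι, i1, y, W, hW, hs, hT⟩ := h
  rw [show T φ = fun x => ∑ i, W i * (φ (x + y i) - φ x) from funext (hT φ),
    mollify_sum _ (fun i => by fun_prop), hT]
  refine Finset.sum_congr rfl fun i _ => ?_
  rw [mollify_const_mul, mollify_sub (w := fun z => φ (z + y i)) (by fun_prop) hφ, mollify_shift]

lemma le_of_almost_max (h : IsJump T Λ) {φ : RN N → ℝ} {x : RN N} {τ : ℝ} (hτ : 0 ≤ τ)
    (hφ : ∀ y, φ y ≤ φ x + τ) : T φ x ≤ τ * Λ := by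
  obtain ⟨ι, i1, y, W, hW, hs, hT⟩ := h
  rw [hT]
  calc ∑ i, W i * (φ (x + y i) - φ x) ≤ ∑ i, W i * τ :=
        Finset.sum_le_sum fun i _ => mul_le_mul_of_nonneg_left
          (by linarith [hφ (x + y i)]) (hW i)
    _ = τ * ∑ i, W i := by rw [← Finset.sum_mul, mul_comm]
    _ ≤ τ * Λ := by gcongr

end IsJump

/-- Maximum principle for families of jump operators of bounded total mass. -/
lemma jump_max_principle {d : RN N → ℝ} {Λ lam B M₀ : ℝ} (hlam : 0 < lam) (hB : 0 ≤ B)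
    (hM₀ : ∀ x, d x ≤ M₀)
    (h : ∀ x, 0 < d x → ∀ τ, 0 < τ → ∃ T c, IsJump (N := N) T Λ ∧ lam ≤ c ∧
      c * d x - T d x ≤ B + τ) (x₀ : RN N) : d x₀ ≤ B / lam := by
  by_contra! hcon
  have hbdd : BddAbove (range d) := ⟨M₀, by rintro _ ⟨x, rfl⟩; exact hM₀ x⟩
  set M := sSup (range d) with hM
  have hle : ∀ y, d y ≤ M := fun y => le_csSup hbdd ⟨y, rfl⟩
  have hBl : B < lam * M := by
    rw [div_lt_iff₀ hlam] at hcon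
    nlinarith [hle x₀]
  have hMpos : 0 < M := by
    by_contra! hneg
    nlinarith
  have hΛ : 0 ≤ Λ := by
    obtain ⟨T, c, hT, _⟩ := h x₀ (lt_of_le_of_lt (by positivity) hcon) 1 one_pos
    exact hT.nonneg
  -- Where `d x > M - τ` one has `T d x ≤ τ Λ`, so the hypothesis would give `lam * M - B ≤ τ (1 + Λ
  -- + lam)`, which this `τ` makes at most half of `lam * M - B`. The bound `M / 2` ensures `0 < d
  -- x`. The mass `Λ` enters only the choice of `τ`, not the conclusion.
  set τ := min ((lam * M - B) / (2 * (1 + Λ + lam))) (M / 2) with hτ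
  have hτ0 : 0 < τ := lt_min (div_pos (by linarith) (by positivity)) (by linarith)
  have hτ1 : τ * (2 * (1 + Λ + lam)) ≤ lam * M - B := by
    rw [← le_div_iff₀ (by positivity)]
    exact min_le_left _ _
  have hτ2 : τ ≤ M / 2 := min_le_right _ _
  obtain ⟨_, ⟨x, rfl⟩, hx⟩ := exists_lt_of_lt_csSup (range_nonempty d) (show M - τ < M by linarith)
  have hdx : 0 < d x := by linarith
  obtain ⟨T, c, hT, hc, hTd⟩ := h x hdx τ hτ0
  have h1 := hT.le_of_almost_max hτ0.le (x := x) (φ := d) fun y => by linarith [hle y]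
  have h2 : lam * d x ≤ c * d x := by gcongr
  have h3 : lam * (M - τ) ≤ lam * d x := by gcongr
  nlinarith

lemma IsJump.max_principle {T : (RN N → ℝ) → RN N → ℝ} {Λ : ℝ} (hT : IsJump T Λ)
    {d : RN N → ℝ} {μ B M₀ : ℝ} (hμ : 0 < μ) (hB : 0 ≤ B) (hM₀ : ∀ x, d x ≤ M₀)
    (h : ∀ x, μ * d x - T d x ≤ B) (x : RN N) : d x ≤ B / μ :=
  jump_max_principle hμ hB hM₀ (fun x _ τ hτ => ⟨T, μ, hT, le_rfl, by linarith [h x]⟩) x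

/-- The resolvent equation of a jump operator. -/
lemma IsJump.exists_resolvent {T : (RN N → ℝ) → RN N → ℝ} {Λ : ℝ} (hT : IsJump T Λ)
    {g : RN N → ℝ} {μ B l : ℝ} (hμ : 0 < μ) (hl : 0 ≤ l) (hB : ∀ x, |g x| ≤ B)
    (hg : ∀ x y, |g x - g y| ≤ l * ‖x - y‖) :
    ∃ (v : RN N → ℝ) (B' : ℝ), (∀ x, |v x| ≤ B') ∧
      (∀ x y, |v x - v y| ≤ l / μ * ‖x - y‖) ∧ ∀ x, μ * v x - T v x = g x := by
  have hT' := hT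
  obtain ⟨ι, i1, y, W, hW, hs, hTe⟩ := hT
  set m := ∑ i, W i with hm
  have hm0 : 0 ≤ m := Finset.sum_nonneg fun i _ => hW i
  have cg : Continuous g := continuous_of_lipschitz hg
  have hμm : 0 < μ + m := by linarith
  -- Solving for the diagonal term turns the equation into `v = Φ v`, a contraction with factor `m /
  -- (μ + m)`.
  let Φ : (RN N →ᵇ ℝ) → (RN N →ᵇ ℝ) := fun v =>
    BoundedContinuousFunction.ofNormedAddCommGroup
      (fun x => (g x + ∑ i, W i * v (x + y i)) / (μ + m))
      (by fun_prop) ((B + ∑ i, W i * ‖v‖) / (μ + m)) (fun x => by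
        rw [norm_div, Real.norm_eq_abs (μ + m), abs_of_pos hμm]
        gcongr
        refine (norm_add_le _ _).trans (add_le_add (hB x) ((norm_sum_le _ _).trans ?_))
        refine Finset.sum_le_sum fun i _ => ?_
        rw [norm_mul, Real.norm_eq_abs, abs_of_nonneg (hW i)]
        exact mul_le_mul_of_nonneg_left (v.norm_coe_le_norm _) (hW i))
  have hΦ : ∀ v x, Φ v x = (g x + ∑ i, W i * v (x + y i)) / (μ + m) := fun _ _ => rfl
  have hK : m / (μ + m) < 1 := by
    rw [div_lt_one hμm]
    linarith
  have hcontr : ContractingWith (m / (μ + m)).toNNReal Φ := by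
    refine ⟨by rw [← NNReal.coe_lt_coe, Real.coe_toNNReal _ (by positivity)]; exact_mod_cast hK,
      LipschitzWith.of_dist_le_mul fun v w => ?_⟩
    rw [Real.coe_toNNReal _ (by positivity)]
    refine (BoundedContinuousFunction.dist_le (by positivity)).2 fun x => ?_
    rw [hΦ, hΦ, Real.dist_eq, ← sub_div, abs_div, abs_of_pos hμm, add_sub_add_left_eq_sub,
      ← Finset.sum_sub_distrib, div_mul_eq_mul_div]
    gcongr
    rw [hm, Finset.sum_mul]
    refine (Finset.abs_sum_le_sum_abs _ _).trans (Finset.sum_le_sum fun i _ => ?_)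
    rw [← mul_sub, abs_mul, abs_of_nonneg (hW i)]
    exact mul_le_mul_of_nonneg_left ((Real.dist_eq _ _).symm.trans_le
      (BoundedContinuousFunction.dist_coe_le_dist _)) (hW i)
  set v := ContractingWith.fixedPoint Φ hcontr with hv
  have hfix : Φ v = v := hcontr.fixedPoint_isFixedPt
  have heq : ∀ x, μ * v x - T v x = g x := fun x => by
    have h1 : v x = (g x + ∑ i, W i * v (x + y i)) / (μ + m) := by
      rw [← hΦ, hfix]
    rw [eq_div_iff hμm.ne'] at h1
    rw [hTe]
    simp only [mul_sub, Finset.sum_sub_distrib, ← Finset.sum_mul]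
    rw [← hm]
    linarith
  -- By translation invariance the difference of `v` and a translate solves the same equation, with
  -- the increment of `g` on the right.
  have one : ∀ x z, v x - v z ≤ l / μ * ‖x - z‖ := fun x z => by
    have := hT'.max_principle (d := fun y => v (y + (x - z)) - v y) (B := l * ‖x - z‖)
      (M₀ := 2 * ‖v‖) hμ (by positivity) (fun y => by
        have h1 := (abs_le.1 (v.norm_coe_le_norm (y + (x - z)))).2
        have h2 := (abs_le.1 (v.norm_coe_le_norm y)).1
        linarith) (fun y => by
        rw [hT'.map_sub (fun y => v (y + (x - z))) v, hT'.shift v]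
        have h1 := heq (y + (x - z))
        have h2 := heq y
        have h3 := (abs_le.1 (hg (y + (x - z)) y)).2
        rw [add_sub_cancel_left] at h3
        linarith) z
    rw [add_sub_cancel] at this
    rwa [div_mul_eq_mul_div]
  refine ⟨v, ‖v‖, fun x => v.norm_coe_le_norm x, fun x z => ?_, heq⟩
  rw [abs_le]
  have h1 := one x z
  have h2 := one z x
  rw [norm_sub_rev] at h2
  constructor <;> linarith

end Jump

/-! ### Radial integrals -/

section Radial

lemma lintegral_norm_rpow {N : ℕ} (hN : N ≠ 0) {s : Set ℝ} (hs : MeasurableSet s)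
    (hs0 : s ⊆ Ioi 0) (q : ℝ) (hint : IntegrableOn (fun r : ℝ => r ^ ((N : ℝ) - 1 + q)) s) :
    ∫⁻ z in {z : RN N | ‖z‖ ∈ s}, ENNReal.ofReal (‖z‖ ^ q)
      = ENNReal.ofReal (N * volume.real (ball (0 : RN N) 1) *
        ∫ r in s, r ^ ((N : ℝ) - 1 + q)) := by
  obtain ⟨n, rfl⟩ := Nat.exists_eq_succ_of_ne_zero hN
  have hdim : Module.finrank ℝ (RN (n + 1)) = n + 1 := finrank_euclideanSpace_fin
  set f : ℝ → ℝ := s.indicator fun r => r ^ q with hf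
  have hcongr : EqOn (fun y : ℝ => y ^ (Module.finrank ℝ (RN (n + 1)) - 1) • f y)
      (s.indicator fun r : ℝ => r ^ (((n + 1 : ℕ) : ℝ) - 1 + q)) (Ioi 0) := fun y hy => by
    have hy : 0 < y := hy
    by_cases h : y ∈ s
    · simp only [hf, indicator_of_mem h, hdim, smul_eq_mul, Nat.add_sub_cancel]
      rw [Real.rpow_add hy, ← Real.rpow_natCast]
      simp
    · simp [hf, h]
  have hI : IntegrableOn (s.indicator fun r : ℝ => r ^ (((n + 1 : ℕ) : ℝ) - 1 + q)) (Ioi 0) :=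
    ((integrable_indicator_iff hs).2 hint).integrableOn
  have hi : Integrable (fun z : RN (n + 1) => f ‖z‖) := by
    rw [integrable_fun_norm_addHaar, integrableOn_congr_fun hcongr measurableSet_Ioi]
    exact hI
  have hval := integral_fun_norm_addHaar (volume : Measure (RN (n + 1))) f
  rw [setIntegral_congr_fun measurableSet_Ioi hcongr, setIntegral_indicator hs,
    inter_eq_self_of_subset_right hs0, hdim] at hval
  have hnn : ∀ r, 0 ≤ f r := fun r => indicator_nonneg (fun x hx => (Real.rpow_pos_of_pos
    (hs0 hx) _).le) r
  have hm : MeasurableSet {z : RN (n + 1) | ‖z‖ ∈ s} := measurable_norm hs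
  calc _ = ∫⁻ z, ENNReal.ofReal (f ‖z‖) := by
        rw [← lintegral_indicator hm]
        congr 1 with z
        by_cases h : ‖z‖ ∈ s
        · simp [hf, h]
        · simp [hf, h]
    _ = ENNReal.ofReal (∫ z : RN (n + 1), f ‖z‖) :=
        (ofReal_integral_eq_lintegral_ofReal hi
          (Filter.Eventually.of_forall fun z => hnn _)).symm
    _ = _ := by
        rw [hval, nsmul_eq_mul, smul_eq_mul, mul_assoc]

end Radial

/-! ### Moments and tails of the Lévy measures -/

namespace HJBData

variable {N : ℕ} {A : Type*} {P : HJBData N A} {σ : ℝ}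

lemma lintegral_le_of_density {C : ℝ} {ν : Measure (RN N)} {g : RN N → ENNReal}
    (hC : 0 < C) (hgm : Measurable g)
    (hg : ν.restrict (ball 0 1) = (volume.restrict (ball 0 1)).withDensity g)
    (hgb : ∀ z, z ≠ 0 → ‖z‖ < 1 → g z ≤ ENNReal.ofReal (C / ‖z‖ ^ ((N : ℝ) + σ)))
    {s : Set ℝ} (hs : MeasurableSet s) (hs0 : s ⊆ Ioo 0 1) (q : ℝ) :
    ∫⁻ z in {z | ‖z‖ ∈ s}, ENNReal.ofReal (‖z‖ ^ q) ∂ν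
      ≤ ENNReal.ofReal C * ∫⁻ z in {z : RN N | ‖z‖ ∈ s},
        ENNReal.ofReal (‖z‖ ^ (q - (N + σ))) := by
  have hm : MeasurableSet {z : RN N | ‖z‖ ∈ s} := measurable_norm hs
  have hsub : {z : RN N | ‖z‖ ∈ s} ⊆ ball 0 1 := fun z hz => by simpa using (hs0 hz).2
  have h1 : ν.restrict {z | ‖z‖ ∈ s}
      = (volume.restrict {z : RN N | ‖z‖ ∈ s}).withDensity g := by
    rw [← Measure.restrict_restrict_of_subset hsub, hg, restrict_withDensity hm,
      Measure.restrict_restrict_of_subset hsub]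
  have hpow : Measurable fun z : RN N => ENNReal.ofReal (‖z‖ ^ q) :=
    (measurable_norm.pow_const q).ennreal_ofReal
  rw [h1, lintegral_withDensity_eq_lintegral_mul _ hgm hpow,
    ← lintegral_const_mul _ (measurable_norm.pow_const _).ennreal_ofReal]
  refine setLIntegral_mono' hm fun z hz => ?_
  have hz0 : 0 < ‖z‖ := (hs0 hz).1
  refine (mul_le_mul_left (hgb z (norm_pos_iff.1 hz0) (hs0 hz).2) _).trans_eq ?_
  rw [← ENNReal.ofReal_mul (by positivity), ← ENNReal.ofReal_mul hC.le, Real.rpow_sub hz0]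
  congr 1
  ring

/-- The radial integrand `r^(m-σ-1)` is integrable at `0` because `m ≥ 2 > σ`. Dividing by `2 - σ`
instead of `m - σ` makes the constant independent of `m`. -/
lemma exists_small_jump_bound (hσ₂ : σ < 2) (h : P.LevyDensityBound σ) :
    ∃ K : ℝ, 0 < K ∧ ∀ (α : A) (δ : ℝ) (m : ℕ), 2 ≤ m → 0 < δ → δ ≤ 1 →
      ∫⁻ z in ball 0 δ \ {0}, ENNReal.ofReal (‖z‖ ^ m) ∂P.ν α
        ≤ ENNReal.ofReal (K * δ ^ ((m : ℝ) - σ)) := by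
  obtain ⟨C, hC, hd⟩ := h
  refine ⟨C * (N * volume.real (ball (0 : RN N) 1) / (2 - σ)) + 1, by
    have : 0 < 2 - σ := by linarith
    positivity, fun α δ m hm hδ hδ1 => ?_⟩
  have hm2 : (2 : ℝ) ≤ m := by exact_mod_cast hm
  have hset : ball (0 : RN N) δ \ {0} = {z : RN N | ‖z‖ ∈ Ioo 0 δ} := by
    ext z
    simp [and_comm]
  rw [hset]
  rcases eq_or_ne N 0 with rfl | hN
  · have : {z : RN 0 | ‖z‖ ∈ Ioo 0 δ} = ∅ := by
      ext z
      simp [Subsingleton.elim z 0]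
    rw [this]
    simp
  obtain ⟨g, hgm, hg, hgb⟩ := hd α
  have h1 := lintegral_le_of_density hC hgm hg hgb (s := Ioo 0 δ) measurableSet_Ioo
    (Ioo_subset_Ioo_right hδ1) m
  simp only [Real.rpow_natCast] at h1
  refine h1.trans ?_
  have hexp : (N : ℝ) - 1 + (m - (N + σ)) = m - σ - 1 := by ring
  have hgt : -1 < (m : ℝ) - σ - 1 := by linarith
  have hint : IntegrableOn (fun r : ℝ => r ^ ((m : ℝ) - σ - 1)) (Ioo 0 δ) :=
    (intervalIntegral.integrableOn_Ioo_rpow_iff hδ).2 hgt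
  rw [lintegral_norm_rpow hN measurableSet_Ioo Ioo_subset_Ioi_self _ (by rwa [hexp]), hexp,
    ← ENNReal.ofReal_mul hC.le, ← integral_Ioc_eq_integral_Ioo,
    ← intervalIntegral.integral_of_le hδ.le, integral_rpow (Or.inl hgt)]
  refine ENNReal.ofReal_le_ofReal ?_
  rw [sub_add_cancel, Real.zero_rpow (by linarith), sub_zero]
  have hp : 0 < δ ^ ((m : ℝ) - σ) := Real.rpow_pos_of_pos hδ _
  have h2 : δ ^ ((m : ℝ) - σ) / (m - σ) ≤ δ ^ ((m : ℝ) - σ) / (2 - σ) := by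
    gcongr
  calc _ ≤ C * (N * volume.real (ball (0 : RN N) 1) * (δ ^ ((m : ℝ) - σ) / (2 - σ))) := by
        gcongr
    _ = C * (N * volume.real (ball (0 : RN N) 1) / (2 - σ)) * δ ^ ((m : ℝ) - σ) := by ring
    _ ≤ _ := by gcongr; linarith

/-- The density controls `‖z‖ < 1` and the Lévy bound controls `‖z‖ > 1`. The unit sphere, in
neither region, is covered by the second moment on the closed ball. Bounded contributions are
absorbed since `δ^(-σ) ≥ 1`. -/
lemma exists_tail_bound (hσ₀ : 0 < σ) (h : P.LevyDensityBound σ) (h_levy : P.LevyBound) :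
    ∃ K : ℝ, 0 < K ∧ ∀ (α : A) (δ : ℝ), 0 < δ → δ < 1 →
      P.ν α {z | δ < ‖z‖} ≤ ENNReal.ofReal (K * δ ^ (-σ)) := by
  obtain ⟨C, hC, hd⟩ := h
  obtain ⟨K, hK⟩ := h_levy
  refine ⟨C * (N * volume.real (ball (0 : RN N) 1) / σ) + 2 * |K| + 1, by positivity,
    fun α δ hδ hδ1 => ?_⟩
  have hsub : {z : RN N | δ < ‖z‖} ⊆ {z | ‖z‖ ∈ Ioo δ 1} ∪ (sphere 0 1 ∪ {z | 1 < ‖z‖}) := by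
    intro z hz
    have hz : δ < ‖z‖ := hz
    rcases lt_trichotomy ‖z‖ 1 with h | h | h
    · exact Or.inl ⟨hz, h⟩
    · exact Or.inr (Or.inl (by simpa using h))
    · exact Or.inr (Or.inr h)
  have hKabs : ENNReal.ofReal K ≤ ENNReal.ofReal |K| := ENNReal.ofReal_le_ofReal (le_abs_self K)
  have hout : P.ν α {z | 1 < ‖z‖} ≤ ENNReal.ofReal |K| :=
    (le_add_self.trans (hK α)).trans hKabs
  have hsph : P.ν α (sphere 0 1) ≤ ENNReal.ofReal |K| := by
    refine le_trans ?_ ((le_self_add.trans (hK α)).trans hKabs)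
    calc P.ν α (sphere 0 1) = ∫⁻ _ in sphere 0 1, 1 ∂P.ν α := by simp
      _ = ∫⁻ z in sphere 0 1, ENNReal.ofReal (‖z‖ ^ 2) ∂P.ν α :=
          setLIntegral_congr_fun isClosed_sphere.measurableSet fun z hz => by
            have : ‖z‖ = 1 := by simpa using hz
            simp [this]
      _ ≤ _ := lintegral_mono_set sphere_subset_closedBall
  have hp1 : 1 ≤ δ ^ (-σ) := Real.one_le_rpow_of_pos_of_le_one_of_nonpos hδ hδ1.le (by linarith)
  have hin : P.ν α {z | ‖z‖ ∈ Ioo δ 1}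
      ≤ ENNReal.ofReal (C * (N * volume.real (ball (0 : RN N) 1) / σ) * δ ^ (-σ)) := by
    rcases eq_or_ne N 0 with rfl | hN
    · have : {z : RN 0 | ‖z‖ ∈ Ioo δ 1} = ∅ := by
        ext z
        simp [Subsingleton.elim z 0, hδ.le]
      rw [this]
      simp
    obtain ⟨g, hgm, hg, hgb⟩ := hd α
    have h1 := lintegral_le_of_density hC hgm hg hgb (s := Ioo δ 1) measurableSet_Ioo
      (Ioo_subset_Ioo_left hδ.le) 0
    simp only [Real.rpow_zero, ENNReal.ofReal_one, setLIntegral_const, one_mul] at h1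
    refine h1.trans ?_
    have hexp : (N : ℝ) - 1 + (0 - (N + σ)) = -σ - 1 := by ring
    have hlt : -σ - 1 < -1 := by linarith
    have hsub' : {z : RN N | ‖z‖ ∈ Ioo δ 1} ⊆ {z | ‖z‖ ∈ Ioi δ} := fun z hz => hz.1
    refine (mul_le_mul_right (lintegral_mono_set hsub') _).trans ?_
    rw [lintegral_norm_rpow hN measurableSet_Ioi (Ioi_subset_Ioi hδ.le) _
      (by rw [hexp]; exact integrableOn_Ioi_rpow_of_lt hlt hδ), hexp,
      ← ENNReal.ofReal_mul hC.le, integral_Ioi_rpow_of_lt hlt hδ]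
    refine ENNReal.ofReal_le_ofReal (le_of_eq ?_)
    rw [sub_add_cancel]
    field_simp
  refine (measure_mono hsub).trans ((measure_union_le _ _).trans
    ((add_le_add hin ((measure_union_le _ _).trans (add_le_add hsph hout))).trans ?_))
  rw [← ENNReal.ofReal_add (by positivity) (by positivity),
    ← ENNReal.ofReal_add (by positivity) (by positivity)]
  refine ENNReal.ofReal_le_ofReal ?_
  have := mul_le_mul_of_nonneg_left hp1 (abs_nonneg K)
  nlinarith

/-- The scheme treats `‖z‖ < δ` as diffusion and `‖z‖ > δ` as jumps, so the sphere in between must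
carry no mass. -/
lemma measure_sphere_eq_zero (h : P.LevyDensityBound σ) (α : A) {δ : ℝ} (hδ : 0 < δ)
    (hδ1 : δ < 1) : P.ν α (sphere 0 δ) = 0 := by
  obtain ⟨C, hC, hd⟩ := h
  obtain ⟨g, hgm, hg, hgb⟩ := hd α
  have hsub : sphere (0 : RN N) δ ⊆ ball 0 1 := fun z hz => by
    have : ‖z‖ = δ := by simpa using hz
    simpa [this] using hδ1
  have h0 : volume.restrict (ball (0 : RN N) 1) (sphere 0 δ) = 0 := by
    refine le_antisymm ((Measure.restrict_apply_le _ _).trans ?_) zero_le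
    rw [Measure.addHaar_sphere_of_ne_zero _ _ hδ.ne']
  have := withDensity_absolutelyContinuous (volume.restrict (ball (0 : RN N) 1)) g h0
  rwa [← hg, Measure.restrict_apply isClosed_sphere.measurableSet,
    inter_eq_self_of_subset_left hsub] at this

lemma setIntegral_neg_eq (h : P.LevySymmetric) (α : A) {F : Type*} [NormedAddCommGroup F]
    [NormedSpace ℝ F] (f : RN N → F) {s : Set (RN N)}
    (hs1 : s ⊆ ball 0 1) (hneg : ∀ z, -z ∈ s ↔ z ∈ s) :
    ∫ z in s, f (-z) ∂P.ν α = ∫ z in s, f z ∂P.ν α := by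
  have he : MeasurableEmbedding fun z : RN N => -z := (Homeomorph.neg (RN N)).measurableEmbedding
  have h1 : (P.ν α).restrict s = ((P.ν α).restrict (ball 0 1)).restrict s := by
    rw [Measure.restrict_restrict_of_subset hs1]
  have hpre : (fun z : RN N => -z) ⁻¹' s = s := by
    ext z
    exact hneg z
  have h2 := he.setIntegral_map (μ := (P.ν α).restrict (ball 0 1)) f s
  rw [h α, hpre] at h2
  rw [h1, h2]

end HJBData

/-! ### Quantitative assumptions and the generator on smooth functions -/

namespace HJBData

variable {N : ℕ} {A : Type*} {P : HJBData N A} {σ lam K : ℝ}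

/-- Quantitative form of the assumptions on the coefficients, with a single constant `K`. -/
structure Admissible (P : HJBData N A) (σ lam K : ℝ) : Prop where
  lam_pos : 0 < lam
  one_le : 1 ≤ K
  le_c : ∀ α x, lam ≤ P.c α x
  f_bdd : ∀ α x, |P.f α x| ≤ K
  f_lip : ∀ α x y, |P.f α x - P.f α y| ≤ K * ‖x - y‖
  c_bdd : ∀ α x, |P.c α x| ≤ K
  c_lip : ∀ α x y, |P.c α x - P.c α y| ≤ K * ‖x - y‖
  b_bdd : ∀ α, ‖P.b α‖ ≤ K
  eta_bdd : ∀ α z, ‖P.η α z‖ ≤ K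
  eta_cont : ∀ α, Continuous (P.η α)
  eta_lin : ∀ α z, ‖z‖ < 1 → ‖P.η α z‖ ≤ K * ‖z‖
  tail : ∀ α δ, 0 < δ → δ < 1 → P.ν α {z | δ < ‖z‖} ≤ ENNReal.ofReal (K * δ ^ (-σ))
  small : ∀ α δ (m : ℕ), 2 ≤ m → 0 < δ → δ ≤ 1 →
    ∫⁻ z in ball 0 δ \ {0}, ENNReal.ofReal (‖z‖ ^ m) ∂P.ν α
      ≤ ENNReal.ofReal (K * δ ^ ((m : ℝ) - σ))
  drift : ∀ δ α, 0 < δ → δ < 1 → ‖P.effectiveDrift δ α‖ ≤ K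
  sphere : ∀ α δ, 0 < δ → δ < 1 → P.ν α (sphere 0 δ) = 0
  symm : P.LevySymmetric

/-- Symmetry of the measure replaces `η` by its even part, which the second difference condition
makes quadratically small. The drift thus stays bounded as `δ → 0`, even when `‖η‖` is not
integrable near the origin. -/
lemma effectiveDrift_le {K₀ K₁ K₂ K₃ C : ℝ} (hK₁ : 0 ≤ K₁) (hb : ∀ α, ‖P.b α‖ ≤ K₀)
    (hη : ∀ α, Continuous (P.η α)) (hη1 : ∀ α z, ‖P.η α z‖ ≤ K₀)
    (hη0 : ∀ α, P.η α 0 = 0) (hsymm : P.LevySymmetric)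
    (hsec : ∀ α z, ‖z‖ < 1 → ‖P.η α z - (2 : ℝ) • P.η α 0 + P.η α (-z)‖ ≤ K₁ * ‖z‖ ^ 2)
    (hlevy : ∀ α, ∫⁻ z in closedBall 0 1, ENNReal.ofReal (‖z‖ ^ 2) ∂(P.ν α) ≤ ENNReal.ofReal K₂)
    (hK₂ : 0 ≤ K₂)
    (htail : ∀ α δ, 0 < δ → δ < 1 → P.ν α {z | δ < ‖z‖} ≤ ENNReal.ofReal (C * δ ^ (-K₃)))
    {δ : ℝ} (α : A) (hδ : 0 < δ) (hδ1 : δ < 1) :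
    ‖P.effectiveDrift δ α‖ ≤ K₀ + K₁ * K₂ := by
  set s : Set (RN N) := {z | δ < ‖z‖ ∧ ‖z‖ < 1} with hs
  have hsm : MeasurableSet s :=
    (measurableSet_lt measurable_const measurable_norm).inter
      (measurableSet_lt measurable_norm measurable_const)
  have hfin : P.ν α s < ⊤ :=
    (measure_mono fun z hz => hz.1).trans_lt ((htail α δ hδ hδ1).trans_lt ENNReal.ofReal_lt_top)
  have hint : IntegrableOn (P.η α) s (P.ν α) :=
    Measure.integrableOn_of_bounded hfin.ne (hη α).aestronglyMeasurable
      (Filter.Eventually.of_forall fun z => hη1 α z)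
  have hint' : IntegrableOn (fun z => P.η α (-z)) s (P.ν α) :=
    Measure.integrableOn_of_bounded hfin.ne ((hη α).comp continuous_neg).aestronglyMeasurable
      (Filter.Eventually.of_forall fun z => hη1 α (-z))
  have hsym := setIntegral_neg_eq hsymm α (P.η α) (s := s) (fun z hz => by simpa using hz.2)
    (fun z => by simp [hs])
  have h2 : ‖∫ z in s, (P.η α z + P.η α (-z)) ∂P.ν α‖ ≤ K₁ * K₂ := by
    refine (norm_integral_le_lintegral_norm _).trans ?_
    refine ENNReal.toReal_le_of_le_ofReal (by positivity) ?_
    calc _ ≤ ∫⁻ z in s, ENNReal.ofReal K₁ * ENNReal.ofReal (‖z‖ ^ 2) ∂P.ν α := by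
          refine setLIntegral_mono' hsm fun z hz => ?_
          rw [← ENNReal.ofReal_mul hK₁]
          refine ENNReal.ofReal_le_ofReal ?_
          simpa [hη0] using hsec α z hz.2
      _ ≤ ENNReal.ofReal K₁ * ENNReal.ofReal K₂ := by
          rw [lintegral_const_mul _ (by fun_prop)]
          gcongr
          exact (lintegral_mono_set fun z hz => by simpa using hz.2.le).trans (hlevy α)
      _ = _ := (ENNReal.ofReal_mul hK₁).symm
  rw [integral_add hint hint', hsym, ← two_smul ℝ, norm_smul] at h2
  have h3 : ‖∫ z in s, P.η α z ∂P.ν α‖ ≤ K₁ * K₂ := by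
    have : 0 ≤ ‖∫ z in s, P.η α z ∂P.ν α‖ := norm_nonneg _
    norm_num at h2
    linarith
  exact (norm_sub_le _ _).trans (add_le_add (hb α) h3)

lemma exists_admissible [TopologicalSpace A] (hσ₀ : 0 < σ) (hσ₂ : σ < 2)
    (h_cont : P.ContinuousCoercive) (h_bdd : P.UniformlyBounded)
    (h_jump : P.JumpLinearGrowth) (h_levy : P.LevyBound)
    (h_symm : P.LevySymmetric) (h_dens : P.LevyDensityBound σ)
    (h_second : P.JumpSecondDifference) : ∃ lam K, P.Admissible σ lam K := by
  obtain ⟨K₁, hK₁, htail⟩ := exists_tail_bound hσ₀ h_dens h_levy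
  obtain ⟨K₂, hK₂, hsmall⟩ := exists_small_jump_bound hσ₂ h_dens
  obtain ⟨⟨lam, hlam, hc⟩, -, -, -, -, hη, -⟩ := h_cont
  obtain ⟨K₃, hK₃⟩ := h_bdd
  obtain ⟨K₄, hK₄⟩ := h_jump
  obtain ⟨K₅, hK₅⟩ := h_levy
  obtain ⟨K₆, hK₆⟩ := h_second
  have hη0 : ∀ α, P.η α 0 = 0 := fun α => by
    have := hK₄ α 0 (by simp)
    simpa using this
  have hdrift : ∀ δ α, 0 < δ → δ < 1 → ‖P.effectiveDrift δ α‖ ≤ K₃ + |K₆| * |K₅| :=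
    fun δ α hδ hδ1 => effectiveDrift_le (K₁ := |K₆|) (K₂ := |K₅|) (C := K₁) (K₃ := σ) (abs_nonneg _)
      (fun α => (hK₃ α).2.2.2.2.1) hη (fun α => (hK₃ α).2.2.2.2.2) hη0 h_symm
      (fun α z hz => (hK₆ α z hz).trans (by gcongr; exact le_abs_self _))
      (fun α => (le_self_add.trans (hK₅ α)).trans (ENNReal.ofReal_le_ofReal (le_abs_self _)))
      (abs_nonneg _) htail α hδ hδ1
  set K := K₁ + K₂ + |K₃| + |K₄| + |K₆| * |K₅| + 1 with hK
  have a3 := abs_nonneg K₃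
  have a4 := abs_nonneg K₄
  have a56 : 0 ≤ |K₆| * |K₅| := by positivity
  have l3 : K₃ ≤ K := by linarith [le_abs_self K₃]
  have l4 : K₄ ≤ K := by linarith [le_abs_self K₄]
  refine ⟨lam, K, hlam, by linarith, hc, fun α x => ((hK₃ α).1 x).trans l3,
    fun α x y => ((hK₃ α).2.1 x y).trans (by gcongr),
    fun α x => ((hK₃ α).2.2.1 x).trans l3,
    fun α x y => ((hK₃ α).2.2.2.1 x y).trans (by gcongr),
    fun α => (hK₃ α).2.2.2.2.1.trans l3, fun α z => ((hK₃ α).2.2.2.2.2 z).trans l3,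
    hη, fun α z hz => (hK₄ α z hz).trans (by gcongr), fun α δ hδ hδ1 => ?_,
    fun α δ m hm hδ hδ1 => ?_, fun δ α hδ hδ1 => (hdrift δ α hδ hδ1).trans ?_,
    fun α δ hδ hδ1 => measure_sphere_eq_zero h_dens α hδ hδ1, h_symm⟩
  · refine (htail α δ hδ hδ1).trans (ENNReal.ofReal_le_ofReal ?_)
    gcongr
    linarith
  · refine (hsmall α δ m hm hδ hδ1).trans (ENNReal.ofReal_le_ofReal ?_)
    gcongr
    linarith
  · linarith [le_abs_self K₃]

/-- The linear operator `φ ↦ b^α · ∇φ + I^α[φ]`. -/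
def generator (P : HJBData N A) (α : A) (φ : RN N → ℝ) (x : RN N) : ℝ :=
  fderiv ℝ φ x (P.b α) + P.nonlocal α φ x

/-- The integrand of the nonlocal operator. -/
def jumpIntegrand (P : HJBData N A) (α : A) (φ : RN N → ℝ) (x z : RN N) : ℝ :=
  φ (x + P.η α z) - φ x - (ball (0 : RN N) 1).indicator (fun z => fderiv ℝ φ x (P.η α z)) z

lemma nonlocal_eq (P : HJBData N A) (α : A) (φ : RN N → ℝ) (x : RN N) :
    P.nonlocal α φ x = ∫ z in {0}ᶜ, P.jumpIntegrand α φ x z ∂P.ν α := rfl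

namespace Admissible

variable {φ ψ : RN N → ℝ} {S ε : ℝ}

lemma pos (h : P.Admissible σ lam K) : 0 < K := zero_lt_one.trans_le h.one_le

lemma finite_tail (h : P.Admissible σ lam K) (α : A) {δ : ℝ} (hδ : 0 < δ) (hδ1 : δ < 1) :
    P.ν α {z | δ < ‖z‖} < ⊤ := (h.tail α δ hδ hδ1).trans_lt ENNReal.ofReal_lt_top

lemma measureReal_tail_le (h : P.Admissible σ lam K) (α : A) {δ : ℝ} (hδ : 0 < δ) (hδ1 : δ < 1) :
    (P.ν α).real {z | δ < ‖z‖} ≤ K * δ ^ (-σ) :=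
  ENNReal.toReal_le_of_le_ofReal (by have := h.pos; positivity) (h.tail α δ hδ hδ1)

lemma integrableOn_tail (h : P.Admissible σ lam K) (α : A) {δ : ℝ} (hδ : 0 < δ) (hδ1 : δ < 1)
    {F : Type*} [NormedAddCommGroup F] {f : RN N → F} (hf : StronglyMeasurable f) {B : ℝ}
    (hB : ∀ z, ‖f z‖ ≤ B) : IntegrableOn f {z | δ < ‖z‖} (P.ν α) :=
  Measure.integrableOn_of_bounded (h.finite_tail α hδ hδ1).ne hf.aestronglyMeasurable
    (Filter.Eventually.of_forall hB)

/-- The common estimate near the origin: `m = 2` gives integrability, `m = 3` and `m = 4` give the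
truncation errors. -/
lemma integrableOn_small (h : P.Admissible σ lam K) (α : A) {δ B : ℝ} (hδ : 0 < δ) (hδ1 : δ ≤ 1)
    {m : ℕ} (hm : 2 ≤ m) {f : RN N → ℝ} (hf : StronglyMeasurable f)
    (hB : ∀ z, ‖z‖ < δ → |f z| ≤ B * ‖z‖ ^ m) (hB0 : 0 ≤ B) :
    IntegrableOn f (ball 0 δ \ {0}) (P.ν α) ∧
    |∫ z in ball 0 δ \ {0}, f z ∂P.ν α| ≤ B * (K * δ ^ ((m : ℝ) - σ)) := by
  have hms : MeasurableSet (ball (0 : RN N) δ \ {0}) :=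
    measurableSet_ball.diff (measurableSet_singleton 0)
  have hKδ : 0 ≤ K * δ ^ ((m : ℝ) - σ) := mul_nonneg h.pos.le (Real.rpow_nonneg hδ.le _)
  have key : ∫⁻ z in ball 0 δ \ {0}, ENNReal.ofReal ‖f z‖ ∂P.ν α
      ≤ ENNReal.ofReal (B * (K * δ ^ ((m : ℝ) - σ))) := by
    calc _ ≤ ∫⁻ z in ball 0 δ \ {0}, ENNReal.ofReal B * ENNReal.ofReal (‖z‖ ^ m) ∂P.ν α := by
          refine setLIntegral_mono' hms fun z hz => ?_
          rw [← ENNReal.ofReal_mul hB0]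
          exact ENNReal.ofReal_le_ofReal (hB z (by simpa using hz.1))
      _ ≤ _ := by
          rw [lintegral_const_mul _ (by fun_prop), ENNReal.ofReal_mul hB0]
          gcongr
          exact h.small α δ m hm hδ hδ1
  refine ⟨⟨hf.aestronglyMeasurable, ?_⟩, ?_⟩
  · rw [hasFiniteIntegral_iff_norm]
    exact key.trans_lt ENNReal.ofReal_lt_top
  · exact (norm_integral_le_lintegral_norm _).trans
      (ENNReal.toReal_le_of_le_ofReal (by positivity) key)

lemma integral_split (h : P.Admissible σ lam K) (α : A) {δ : ℝ} (hδ : 0 < δ) (hδ1 : δ < 1)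
    {f : RN N → ℝ} (hf1 : IntegrableOn f (ball 0 δ \ {0}) (P.ν α))
    (hf2 : IntegrableOn f {z | δ < ‖z‖} (P.ν α)) :
    IntegrableOn f {0}ᶜ (P.ν α) ∧ ∫ z in {0}ᶜ, f z ∂P.ν α
      = ∫ z in ball 0 δ \ {0}, f z ∂P.ν α + ∫ z in {z | δ < ‖z‖}, f z ∂P.ν α := by
  have hset : (({0}ᶜ : Set (RN N))) =ᵐ[P.ν α]
      ((ball 0 δ \ {0}) ∪ {z | δ < ‖z‖} : Set (RN N)) := by
    have h0 : ∀ᵐ z ∂P.ν α, z ∉ Metric.sphere (0 : RN N) δ :=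
      measure_eq_zero_iff_ae_notMem.1 (h.sphere α δ hδ hδ1)
    filter_upwards [h0] with z hz
    have hz : ‖z‖ ≠ δ := by simpa using hz
    apply propext
    change z ∉ ({0} : Set (RN N)) ↔ (z ∈ ball 0 δ ∧ z ∉ ({0} : Set (RN N))) ∨ δ < ‖z‖
    simp only [mem_singleton_iff, mem_ball_zero_iff]
    constructor
    · intro hz0
      rcases lt_or_gt_of_ne hz with h1 | h1
      · exact Or.inl ⟨h1, hz0⟩
      · exact Or.inr h1
    · rintro (h1 | h1)
      · exact h1.2
      · rintro rfl
        rw [norm_zero] at h1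
        linarith
  have hd : Disjoint (ball (0 : RN N) δ \ {0}) {z | δ < ‖z‖} := by
    rw [Set.disjoint_left]
    rintro z ⟨hz, -⟩ hz'
    have h1 : ‖z‖ < δ := by simpa using hz
    have h2 : δ < ‖z‖ := hz'
    linarith
  constructor
  · rw [integrableOn_congr_set_ae hset]
    exact hf1.union hf2
  · rw [setIntegral_congr_set hset, setIntegral_union hd
      (measurableSet_lt measurable_const measurable_norm) hf1 hf2]

lemma stronglyMeasurable_jumpIntegrand (h : P.Admissible σ lam K) (hφ : TaylorBd φ S ε) (α : A)
    (x : RN N) : StronglyMeasurable (P.jumpIntegrand α φ x) := by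
  have h1 := h.eta_cont α
  have h2 := hφ.continuous
  refine StronglyMeasurable.sub (Continuous.stronglyMeasurable (by fun_prop)) ?_
  exact (Continuous.stronglyMeasurable (by fun_prop)).indicator measurableSet_ball

lemma jumpIntegrand_small (h : P.Admissible σ lam K) (hφ : TaylorBd φ S ε) (hS : 0 ≤ S)
    (α : A) (x : RN N) {z : RN N} (hz : ‖z‖ < 1) :
    |P.jumpIntegrand α φ x z| ≤ S / ε ^ 2 * K ^ 2 * ‖z‖ ^ 2 := by
  rw [jumpIntegrand, indicator_of_mem (by simpa using hz)]
  refine (hφ.abs_sub_sub_le x _).trans ?_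
  rw [mul_assoc, ← mul_pow]
  gcongr
  exact h.eta_lin α z hz

lemma jumpIntegrand_bounded (h : P.Admissible σ lam K) (hφ : TaylorBd φ S ε) (hS : 0 ≤ S)
    (hε : 0 < ε) (α : A) (x z : RN N) :
    |P.jumpIntegrand α φ x z| ≤ 2 * (S / ε * K + S / ε ^ 2 * K ^ 2) := by
  have h1 := hφ.abs_sub_le x (P.η α z)
  have h2 := hφ.abs_fderiv_le x (P.η α z)
  have h3 : S / ε * ‖P.η α z‖ + S / ε ^ 2 * ‖P.η α z‖ ^ 2 ≤ S / ε * K + S / ε ^ 2 * K ^ 2 := by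
    gcongr <;> exact h.eta_bdd α z
  have h4 : S / ε * ‖P.η α z‖ ≤ S / ε * K := by
    gcongr
    exact h.eta_bdd α z
  have h5 : 0 ≤ S / ε ^ 2 * K ^ 2 := by positivity
  have h6 : |(ball (0 : RN N) 1).indicator (fun z => fderiv ℝ φ x (P.η α z)) z|
      ≤ S / ε * K := by
    by_cases hz : z ∈ ball (0 : RN N) 1
    · rw [indicator_of_mem hz]
      exact h2.trans h4
    · rw [indicator_of_notMem hz, abs_zero]
      have := h.pos
      positivity
  rw [jumpIntegrand]
  rw [abs_le] at *
  constructor <;> linarith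

lemma nonlocal_split (h : P.Admissible σ lam K) (hφ : TaylorBd φ S ε) (hS : 0 ≤ S)
    (hε : 0 < ε) (α : A) (x : RN N) {δ : ℝ} (hδ : 0 < δ) (hδ1 : δ < 1) :
    IntegrableOn (P.jumpIntegrand α φ x) {0}ᶜ (P.ν α) ∧ P.nonlocal α φ x
      = ∫ z in ball 0 δ \ {0}, P.jumpIntegrand α φ x z ∂P.ν α
        + ∫ z in {z | δ < ‖z‖}, P.jumpIntegrand α φ x z ∂P.ν α := by
  have hm := h.stronglyMeasurable_jumpIntegrand hφ α x
  exact h.integral_split α hδ hδ1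
    (h.integrableOn_small α hδ hδ1.le le_rfl hm
      (fun z hz => h.jumpIntegrand_small hφ hS α x (hz.trans hδ1)) (by positivity)).1
    (h.integrableOn_tail α hδ hδ1 hm (h.jumpIntegrand_bounded hφ hS hε α x))

lemma generator_sub_const_mul (h : P.Admissible σ lam K) {S' ε' : ℝ} (hφ : TaylorBd φ S ε)
    (hS : 0 ≤ S) (hε : 0 < ε) (hψ : TaylorBd ψ S' ε') (hS' : 0 ≤ S') (hε' : 0 < ε') (κ : ℝ)
    (α : A) (x : RN N) :
    P.generator α (fun y => φ y - κ * ψ y) x = P.generator α φ x - κ * P.generator α ψ x := by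
  have hd : fderiv ℝ (fun y => φ y - κ * ψ y) x = fderiv ℝ φ x - κ • fderiv ℝ ψ x :=
    ((hφ.hasFDerivAt x).sub ((hψ.hasFDerivAt x).const_mul κ)).fderiv
  have hi1 := (h.nonlocal_split hφ hS hε α x one_half_pos one_half_lt_one).1
  have hi2 := (h.nonlocal_split hψ hS' hε' α x one_half_pos one_half_lt_one).1
  have hn : P.nonlocal α (fun y => φ y - κ * ψ y) x
      = P.nonlocal α φ x - κ * P.nonlocal α ψ x := by
    rw [nonlocal_eq, nonlocal_eq, nonlocal_eq, ← integral_const_mul,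
      ← integral_sub hi1 (hi2.const_mul κ)]
    congr 1 with z
    simp only [jumpIntegrand, hd]
    by_cases hz : z ∈ ball (0 : RN N) 1
    · simp only [indicator_of_mem hz, sub_apply, smul_apply,
        smul_eq_mul]
      ring
    · simp only [indicator_of_notMem hz]
      ring
  rw [generator, generator, generator, hn, hd]
  simp only [sub_apply, smul_apply, smul_eq_mul]
  ring

/-- Uniformity in `α` and `φ` is the point: it lets a penalization `κ ζ` disappear as `κ → 0`, and
it yields constants fixed before any approximation of the generator is chosen. -/
lemma exists_generator_bound (h : P.Admissible σ lam K) {S ε : ℝ} (hS : 0 ≤ S) (hε : 0 < ε) :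
    ∃ C : ℝ, 0 ≤ C ∧ ∀ α φ x, TaylorBd φ S ε → |P.generator α φ x| ≤ C := by
  have hK := h.pos
  refine ⟨S / ε * K + (S / ε ^ 2 * K ^ 2 * (K * (1 / 2) ^ (((2 : ℕ) : ℝ) - σ))
    + 2 * (S / ε * K + S / ε ^ 2 * K ^ 2) * (K * (1 / 2) ^ (-σ))), by positivity,
    fun α φ x hφ => ?_⟩
  have hm := h.stronglyMeasurable_jumpIntegrand hφ α x
  rw [generator, (h.nonlocal_split hφ hS hε α x one_half_pos one_half_lt_one).2]
  refine (abs_add_le _ _).trans (add_le_add ((hφ.abs_fderiv_le _ _).trans ?_)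
    ((abs_add_le _ _).trans (add_le_add ?_ ?_)))
  · gcongr
    exact h.b_bdd α
  · exact (h.integrableOn_small α one_half_pos one_half_lt_one.le le_rfl hm
      (fun z hz => h.jumpIntegrand_small hφ hS α x (hz.trans one_half_lt_one)) (by positivity)).2
  · refine (norm_setIntegral_le_of_norm_le_const
      (f := P.jumpIntegrand α φ x) (h.finite_tail α one_half_pos one_half_lt_one)
      (fun z _ => h.jumpIntegrand_bounded hφ hS hε α x z)).trans ?_
    gcongr
    exact h.measureReal_tail_le α one_half_pos one_half_lt_one

end Admissible

lemma generator_shift (φ : RN N → ℝ) (α : A) (e x : RN N) :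
    P.generator α (fun y => φ (y + e)) x = P.generator α φ (x + e) := by
  simp only [generator, nonlocal, fderiv_comp_add_right, add_right_comm x _ e]

end HJBData

/-! ### Multilinear interpolation and monotonicity of the scheme -/

namespace HJBData

variable {N : ℕ} {A : Type*} {P : HJBData N A} {σ lam K : ℝ}

section Interp

/-- Only the nodes `⌊t⌋` and `⌊t⌋ + 1` contribute. The two identities express that interpolation
reproduces constants and linear functions. -/
lemma hat_one_sums (t : ℝ) {s : Finset ℤ} (h0 : ⌊t⌋ ∈ s) (h1 : ⌊t⌋ + 1 ∈ s) :
    ∑ j ∈ s, max 0 (1 - |t - (j : ℝ)|) = 1 ∧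
    ∑ j ∈ s, ((j : ℝ) - t) * max 0 (1 - |t - (j : ℝ)|) = 0 := by
  have hsub : ({⌊t⌋, ⌊t⌋ + 1} : Finset ℤ) ⊆ s := by
    intro j hj
    simp only [Finset.mem_insert, Finset.mem_singleton] at hj
    rcases hj with rfl | rfl <;> assumption
  have hl := Int.floor_le t
  have hu := Int.lt_floor_add_one t
  have hz : ∀ j ∈ s, j ∉ ({⌊t⌋, ⌊t⌋ + 1} : Finset ℤ) → max 0 (1 - |t - (j : ℝ)|) = 0 := by
    intro j _ hj
    simp only [Finset.mem_insert, Finset.mem_singleton, not_or] at hj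
    refine max_eq_left ?_
    rcases lt_or_gt_of_ne hj.1 with h | h
    · have : (j : ℝ) + 1 ≤ ⌊t⌋ := by exact_mod_cast h
      have := le_abs_self (t - j)
      linarith
    · have h2 : ⌊t⌋ + 2 ≤ j := by
        have := hj.2
        omega
      have : (⌊t⌋ : ℝ) + 2 ≤ j := by exact_mod_cast h2
      have := neg_abs_le (t - j)
      linarith
  have hne : ⌊t⌋ ≠ ⌊t⌋ + 1 := by omega
  have e0 : max 0 (1 - |t - (⌊t⌋ : ℝ)|) = 1 - (t - ⌊t⌋) := by
    rw [abs_of_nonneg (by linarith), max_eq_right (by linarith)]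
  have e1 : max 0 (1 - |t - ((⌊t⌋ + 1 : ℤ) : ℝ)|) = t - ⌊t⌋ := by
    push_cast
    rw [abs_of_neg (by linarith), max_eq_right (by linarith)]
    ring
  constructor
  · rw [← Finset.sum_subset hsub hz, Finset.sum_pair hne, e0, e1]
    ring
  · rw [← Finset.sum_subset hsub (fun j hj hj' => by rw [hz j hj hj', mul_zero]),
      Finset.sum_pair hne, e0, e1]
    push_cast
    ring

/-- Indices of the grid points needed to interpolate inside the ball of radius `R`. -/
def gridIndex (N : ℕ) (h R : ℝ) : Finset (Fin N → ℤ) :=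
  Fintype.piFinset fun _ => Finset.Icc (-(⌈R / h⌉ + 1)) (⌈R / h⌉ + 1)

variable {h R : ℝ} {y : RN N}

lemma floor_mem_Icc (hh : 0 < h) (hy : ‖y‖ ≤ R) (i : Fin N) :
    ⌊y i / h⌋ ∈ Finset.Icc (-(⌈R / h⌉ + 1)) (⌈R / h⌉ + 1) ∧
    ⌊y i / h⌋ + 1 ∈ Finset.Icc (-(⌈R / h⌉ + 1)) (⌈R / h⌉ + 1) := by
  have h1 : |y i| ≤ R := (PiLp.norm_apply_le y i).trans hy
  obtain ⟨h2, h3⟩ := abs_le.1 h1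
  have h4 : y i / h ≤ R / h := by gcongr
  have h5 : -(R / h) ≤ y i / h := by
    rw [← neg_div]
    gcongr
  have h6 : ⌊y i / h⌋ ≤ ⌈R / h⌉ := by
    exact (Int.cast_le (R := ℝ)).1 ((Int.floor_le _).trans (h4.trans (Int.le_ceil _)))
  have h7 : -⌈R / h⌉ ≤ ⌊y i / h⌋ := by
    rw [Int.le_floor]
    push_cast
    linarith [Int.le_ceil (R / h)]
  simp only [Finset.mem_Icc]
  omega

lemma hat_nonneg (h : ℝ) (j : Fin N → ℤ) (y : RN N) : 0 ≤ hat h j y :=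
  Finset.prod_nonneg fun _ _ => le_max_left _ _

lemma hat_le_one (h : ℝ) (j : Fin N → ℤ) (y : RN N) : hat h j y ≤ 1 :=
  Finset.prod_le_one (fun _ _ => le_max_left _ _) fun i _ =>
    max_le zero_le_one (by linarith [abs_nonneg (y i / h - (j i : ℝ))])

lemma continuous_hat (h : ℝ) (j : Fin N → ℤ) : Continuous (hat h j) := by
  unfold hat
  fun_prop

lemma abs_lt_of_hat_ne_zero {j : Fin N → ℤ} (hj : hat h j y ≠ 0) (i : Fin N) :
    |y i / h - (j i : ℝ)| < 1 := by
  by_contra! hcon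
  exact hj (Finset.prod_eq_zero (Finset.mem_univ i) (max_eq_left (by linarith)))

lemma hat_eq_zero (hh : 0 < h) (hy : ‖y‖ ≤ R) {j : Fin N → ℤ} (hj : j ∉ gridIndex N h R) :
    hat h j y = 0 := by
  by_contra hne
  refine hj (Fintype.mem_piFinset.2 fun i => ?_)
  have h1 := abs_lt.1 (abs_lt_of_hat_ne_zero hne i)
  obtain ⟨h2, h3⟩ := floor_mem_Icc hh hy i
  have h4 : ⌊y i / h⌋ < j i + 1 := by
    rw [Int.floor_lt]
    push_cast
    linarith
  have h5 : j i - 1 ≤ ⌊y i / h⌋ := by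
    rw [Int.le_floor]
    push_cast
    linarith
  rw [Finset.mem_Icc] at *
  omega

lemma sum_hat (hh : 0 < h) (hy : ‖y‖ ≤ R) : ∑ j ∈ gridIndex N h R, hat h j y = 1 := by
  unfold hat gridIndex
  rw [← Finset.prod_univ_sum (fun _ => Finset.Icc (-(⌈R / h⌉ + 1)) (⌈R / h⌉ + 1))
    (fun i j => max 0 (1 - |y i / h - (j : ℝ)|))]
  exact Finset.prod_eq_one fun i _ =>
    (hat_one_sums _ (floor_mem_Icc hh hy i).1 (floor_mem_Icc hh hy i).2).1

lemma sum_moment_hat (hh : 0 < h) (hy : ‖y‖ ≤ R) (i : Fin N) :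
    ∑ j ∈ gridIndex N h R, hat h j y * (gridPoint h j i - y i) = 0 := by
  -- Writing the moment as a product over coordinates makes the grid sum factor, and the `i`-th
  -- factor vanishes.
  have e : ∀ j : Fin N → ℤ, hat h j y * (gridPoint h j i - y i)
      = h * ∏ r, (if r = i then ((j r : ℝ) - y r / h) else 1)
        * max 0 (1 - |y r / h - (j r : ℝ)|) := fun j => by
    rw [Finset.prod_mul_distrib, Finset.prod_ite_eq' Finset.univ i, if_pos (Finset.mem_univ _)]
    simp only [hat, gridPoint]
    field_simp
  rw [Finset.sum_congr rfl fun j _ => e j, ← Finset.mul_sum]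
  unfold gridIndex
  rw [← Finset.prod_univ_sum (fun _ => Finset.Icc (-(⌈R / h⌉ + 1)) (⌈R / h⌉ + 1))
    (fun r j => (if r = i then ((j : ℝ) - y r / h) else 1) * max 0 (1 - |y r / h - (j : ℝ)|)),
    Finset.prod_eq_zero (Finset.mem_univ i), mul_zero]
  simpa using (hat_one_sums _ (floor_mem_Icc hh hy i).1 (floor_mem_Icc hh hy i).2).2

lemma interp_eq_sum (hh : 0 < h) (hy : ‖y‖ ≤ R) (g : RN N → ℝ) :
    interp h g y = ∑ j ∈ gridIndex N h R, g (gridPoint h j) * hat h j y :=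
  tsum_eq_sum fun j hj => by rw [hat_eq_zero hh hy hj, mul_zero]

lemma interp_sub_eq_sum (hh : 0 < h) (hy : ‖y‖ ≤ R) (g : RN N → ℝ) (a : ℝ) :
    interp h g y - a = ∑ j ∈ gridIndex N h R, hat h j y * (g (gridPoint h j) - a) := by
  simp only [mul_sub, Finset.sum_sub_distrib, ← Finset.sum_mul, sum_hat hh hy, one_mul]
  rw [interp_eq_sum hh hy]
  simp only [mul_comm]

lemma norm_gridPoint_sub_sq_le (hh : 0 < h) {j : Fin N → ℤ} (hj : hat h j y ≠ 0) :
    ‖gridPoint h j - y‖ ^ 2 ≤ N * h ^ 2 := by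
  rw [EuclideanSpace.norm_sq_eq]
  calc _ ≤ ∑ _i : Fin N, h ^ 2 := by
        refine Finset.sum_le_sum fun i _ => ?_
        have h1 := abs_lt_of_hat_ne_zero hj i
        rw [Real.norm_eq_abs]
        have h2 : (gridPoint h j - y) i = -(h * (y i / h - j i)) := by
          simp only [gridPoint, PiLp.sub_apply]
          field_simp
          ring
        rw [h2, abs_neg, abs_mul, abs_of_pos hh]
        have : h * |y i / h - j i| ≤ h := mul_le_of_le_one_right hh.le h1.le
        gcongr
    _ = _ := by simp

lemma euclidean_sum_single (v : RN N) :
    v = ∑ i, v i • EuclideanSpace.single i (1 : ℝ) := by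
  conv_lhs => rw [← (EuclideanSpace.basisFun (Fin N) ℝ).sum_repr v]
  simp

/-- Second order accuracy of multilinear interpolation. -/
lemma abs_interp_sub_le (hh : 0 < h) {g : RN N → ℝ} {p : RN N →L[ℝ] ℝ} {B : ℝ} (hB : 0 ≤ B)
    (hg : ∀ v, |g (y + v) - g y - p v| ≤ B * ‖v‖ ^ 2) :
    |interp h g y - g y| ≤ B * (N * h ^ 2) := by
  -- The linear part of `g` has zero weighted sum, so it can be subtracted freely and only the
  -- quadratic remainder is left.
  have hp : ∑ j ∈ gridIndex N h ‖y‖, hat h j y * p (gridPoint h j - y) = 0 := by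
    have : ∀ j, hat h j y * p (gridPoint h j - y)
        = ∑ i, hat h j y * (gridPoint h j i - y i) * p (EuclideanSpace.single i 1) := fun j => by
      conv_lhs => rw [euclidean_sum_single (gridPoint h j - y), map_sum, Finset.mul_sum]
      refine Finset.sum_congr rfl fun i _ => ?_
      rw [map_smul, smul_eq_mul, PiLp.sub_apply]
      ring
    simp_rw [this]
    rw [Finset.sum_comm]
    refine Finset.sum_eq_zero fun i _ => ?_
    rw [← Finset.sum_mul, sum_moment_hat hh le_rfl, zero_mul]
  rw [interp_sub_eq_sum hh le_rfl, ← sub_zero (∑ j ∈ _, _), ← hp, ← Finset.sum_sub_distrib]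
  calc _ ≤ ∑ j ∈ gridIndex N h ‖y‖, hat h j y * (B * (N * h ^ 2)) := by
        refine (Finset.abs_sum_le_sum_abs _ _).trans (Finset.sum_le_sum fun j _ => ?_)
        rw [← mul_sub, abs_mul, abs_of_nonneg (hat_nonneg h j y)]
        rcases eq_or_ne (hat h j y) 0 with h0 | h0
        · simp [h0]
        · have := hg (gridPoint h j - y)
          rw [add_sub_cancel] at this
          exact mul_le_mul_of_nonneg_left (this.trans (mul_le_mul_of_nonneg_left
            (norm_gridPoint_sub_sq_le hh h0) hB)) (hat_nonneg h j y)
    _ = _ := by rw [← Finset.sum_mul, sum_hat hh le_rfl, one_mul]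

/-- Interpolation is an average of grid values, because the hats are nonnegative and sum to one. -/
lemma isJump_interp (hh : 0 < h) (y : RN N) :
    IsJump (fun φ x => interp h (fun y => φ (x + y)) y - φ x) 1 := by
  have h1 := IsJump.sum (gridIndex N h ‖y‖) (T := fun j φ x =>
    hat h j y * (φ (x + gridPoint h j) - φ x)) (Λ := fun j => hat h j y * 1)
    (fun j => (IsJump.difference _).const_mul (hat_nonneg h j y))
  simp only [mul_one, sum_hat hh le_rfl] at h1
  convert h1 using 3
  exact interp_sub_eq_sum hh le_rfl _ _

end Interp

/-- The full discrete operator of the scheme. -/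
def schemeOp (P : HJBData N A) (h k δ : ℝ) (α : A) (φ : RN N → ℝ) (x : RN N) : ℝ :=
  P.discreteDiffusion h k δ α φ x + P.upwindDrift h δ α φ x + P.discreteNonlocal h δ α φ x

lemma isJump_discreteDiffusion (P : HJBData N A) {h k δ : ℝ} (hh : 0 < h) (α : A) :
    IsJump (P.discreteDiffusion h k δ α) (N * ((k ^ 2)⁻¹ * 2)) := by
  have h1 := IsJump.sum Finset.univ (fun i : Fin N =>
    ((isJump_interp hh (k • P.sqrtCol δ α i)).add
      (isJump_interp hh (-(k • P.sqrtCol δ α i)))).const_mul (inv_nonneg.2 (sq_nonneg k)))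
  convert h1 using 1
  · ext φ x
    refine Finset.sum_congr rfl fun i _ => ?_
    rw [div_eq_inv_mul]
    ring
  · simp
    norm_num

lemma isJump_upwindDrift (P : HJBData N A) {h δ : ℝ} (hh : 0 < h) (α : A) :
    IsJump (P.upwindDrift h δ α) (∑ i, |P.effectiveDrift δ α i| / h) := by
  have h1 := IsJump.sum Finset.univ (fun i : Fin N =>
    ((IsJump.difference (EuclideanSpace.single i h)).const_mul
      (a := max (P.effectiveDrift δ α i) 0 / h) (by positivity)).add
    ((IsJump.difference (-EuclideanSpace.single i h)).const_mul
      (a := max (-P.effectiveDrift δ α i) 0 / h) (by positivity)))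
  convert h1 using 1
  · ext φ x
    refine Finset.sum_congr rfl fun i _ => ?_
    rw [← sub_eq_add_neg]
    ring
  · refine Finset.sum_congr rfl fun i _ => ?_
    rw [mul_one, mul_one, ← add_div, max_zero_add_max_neg_zero_eq_abs_self]

namespace Admissible

lemma weight_nonneg (P : HJBData N A) (h δ : ℝ) (α : A) (j : Fin N → ℤ) :
    0 ≤ P.weight h δ α j := integral_nonneg fun _ => hat_nonneg _ _ _

lemma integrableOn_hat (hP : P.Admissible σ lam K) (h : ℝ) {δ : ℝ} (hδ : 0 < δ) (hδ1 : δ < 1)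
    (α : A) (j : Fin N → ℤ) :
    IntegrableOn (fun z => hat h j (P.η α z)) {z | δ < ‖z‖} (P.ν α) :=
  hP.integrableOn_tail α hδ hδ1
    ((continuous_hat h j).comp (hP.eta_cont α)).stronglyMeasurable (B := 1) fun z => by
      rw [Real.norm_eq_abs, abs_of_nonneg (hat_nonneg _ _ _)]
      exact hat_le_one _ _ _

lemma discreteNonlocal_eq_sum (hP : P.Admissible σ lam K) {h : ℝ} (hh : 0 < h) (δ : ℝ) (α : A)
    (φ : RN N → ℝ) (x : RN N) : P.discreteNonlocal h δ α φ x
      = ∑ j ∈ gridIndex N h K, P.weight h δ α j * (φ (x + gridPoint h j) - φ x) := by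
  rw [discreteNonlocal, tsum_eq_sum (s := gridIndex N h K)]
  · exact Finset.sum_congr rfl fun j _ => mul_comm _ _
  · intro j hj
    have : P.weight h δ α j = 0 := by
      rw [weight]
      simp only [hat_eq_zero hh (hP.eta_bdd α _) hj, integral_zero]
    rw [this, mul_zero]

/-- Exchanging sum and integral presents the quadrature as an exact tail integral of the
interpolated function, so its error is an interpolation error times the tail mass. -/
lemma discreteNonlocal_eq_integral (hP : P.Admissible σ lam K) {h δ : ℝ} (hh : 0 < h) (hδ : 0 < δ)
    (hδ1 : δ < 1) (α : A) (φ : RN N → ℝ) (x : RN N) :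
    IntegrableOn (fun z => interp h (fun y => φ (x + y)) (P.η α z) - φ x) {z | δ < ‖z‖} (P.ν α) ∧
    P.discreteNonlocal h δ α φ x
      = ∫ z in {z | δ < ‖z‖}, (interp h (fun y => φ (x + y)) (P.η α z) - φ x) ∂P.ν α := by
  simp only [interp_sub_eq_sum hh (hP.eta_bdd α _)]
  have hi : ∀ j ∈ gridIndex N h K, IntegrableOn
      (fun z => hat h j (P.η α z) * (φ (x + gridPoint h j) - φ x)) {z | δ < ‖z‖} (P.ν α) :=
    fun j _ => (hP.integrableOn_hat h hδ hδ1 α j).mul_const _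
  refine ⟨integrable_finsetSum _ hi, ?_⟩
  rw [integral_finsetSum _ hi, hP.discreteNonlocal_eq_sum hh]
  refine Finset.sum_congr rfl fun j _ => ?_
  rw [integral_mul_const, weight]

lemma isJump_discreteNonlocal (hP : P.Admissible σ lam K) {h δ : ℝ} (hh : 0 < h) (hδ : 0 < δ)
    (hδ1 : δ < 1) (α : A) : IsJump (P.discreteNonlocal h δ α) (K * δ ^ (-σ)) := by
  have h1 := IsJump.sum (gridIndex N h K) (fun j =>
    (IsJump.difference (gridPoint h j)).const_mul (weight_nonneg P h δ α j))
  have h2 : ∑ j ∈ gridIndex N h K, P.weight h δ α j * 1 ≤ K * δ ^ (-σ) := by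
    refine le_of_eq_of_le ?_ (hP.measureReal_tail_le α hδ hδ1)
    simp only [mul_one, weight]
    rw [← integral_finsetSum _ fun j _ => hP.integrableOn_hat h hδ hδ1 α j]
    simp only [sum_hat hh (hP.eta_bdd α _)]
    simp
  have h3 := h1.mono h2
  convert h3 using 1
  ext φ x
  exact hP.discreteNonlocal_eq_sum hh δ α φ x

/-- This is the monotonicity of the scheme. The mass blows up as the parameters vanish, which is
harmless because the maximum principle only needs it uniform in `α`. -/
lemma exists_isJump_schemeOp (hP : P.Admissible σ lam K) {h k δ : ℝ} (hh : 0 < h)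
    (hδ : 0 < δ) (hδ1 : δ < 1) : ∃ Λ, ∀ α, IsJump (P.schemeOp h k δ α) Λ := by
  refine ⟨N * ((k ^ 2)⁻¹ * 2) + N * (K / h) + K * δ ^ (-σ), fun α => ?_⟩
  refine IsJump.add (IsJump.add (P.isJump_discreteDiffusion hh α)
    ((P.isJump_upwindDrift hh α).mono ?_)) (hP.isJump_discreteNonlocal hh hδ hδ1 α)
  calc _ ≤ ∑ _i : Fin N, K / h := Finset.sum_le_sum fun i _ => by
        gcongr
        exact (PiLp.norm_apply_le (P.effectiveDrift δ α) i).trans (hP.drift δ α hδ hδ1)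
    _ = _ := by simp

end Admissible

end HJBData

/-! ### Truncation errors -/

namespace HJBData

variable {N : ℕ} {A : Type*} {P : HJBData N A} {σ lam K : ℝ}

namespace Admissible

variable {φ : RN N → ℝ} {S ε h k δ : ℝ}

/-- No negative power of `δ` appears because the effective drift is bounded uniformly in `δ`. -/
lemma upwind_error (hP : P.Admissible σ lam K) (hφ : TaylorBd φ S ε) (hS : 0 ≤ S) (hh : 0 < h)
    (hδ : 0 < δ) (hδ1 : δ < 1) (α : A) (x : RN N) :
    |P.upwindDrift h δ α φ x - fderiv ℝ φ x (P.effectiveDrift δ α)|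
      ≤ N * (K * (S / ε ^ 2 * h)) := by
  set B := P.effectiveDrift δ α with hB
  have hd : fderiv ℝ φ x B = ∑ i, B i * fderiv ℝ φ x (EuclideanSpace.single i 1) := by
    conv_lhs => rw [euclidean_sum_single B, map_sum]
    simp
  have hq : ∀ v : RN N, |(φ (x + h • v) - φ x) / h - fderiv ℝ φ x v| ≤ S / ε ^ 2 * ‖v‖ ^ 2 * h := by
    intro v
    have h1 := hφ.abs_sub_sub_le x (h • v)
    rw [map_smul, norm_smul, Real.norm_eq_abs, abs_of_pos hh, smul_eq_mul] at h1
    have h2 : (φ (x + h • v) - φ x) / h - fderiv ℝ φ x v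
        = (φ (x + h • v) - φ x - h * fderiv ℝ φ x v) / h := by
      field_simp
    rw [h2, abs_div, abs_of_pos hh, div_le_iff₀ hh]
    exact h1.trans_eq (by ring)
  rw [hd, upwindDrift, ← Finset.sum_sub_distrib]
  calc _ ≤ ∑ _i : Fin N, K * (S / ε ^ 2 * h) := by
        refine (Finset.abs_sum_le_sum_abs _ _).trans (Finset.sum_le_sum fun i _ => ?_)
        have hs : EuclideanSpace.single i h = h • (EuclideanSpace.single i (1 : ℝ) : RN N) := by
          ext r
          by_cases hr : r = i <;> simp [hr]
        have h1 := hq (EuclideanSpace.single i 1)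
        have h2 := hq (-EuclideanSpace.single i 1)
        rw [smul_neg, ← sub_eq_add_neg] at h2
        simp only [norm_neg, PiLp.norm_single, norm_one, one_pow, mul_one, map_neg,
          ← hs] at h1 h2
        have hb : |B i| ≤ K := (PiLp.norm_apply_le B i).trans (hP.drift δ α hδ hδ1)
        have e : B i = max (B i) 0 - max (-B i) 0 :=
          (max_zero_sub_eq_self (B i)).symm.trans (by simp)
        have e2 := max_zero_add_max_neg_zero_eq_abs_self (B i)
        have p1 : 0 ≤ max (B i) 0 := le_max_right _ _
        have p2 : 0 ≤ max (-B i) 0 := le_max_right _ _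
        set u := max (B i) 0
        set w := max (-B i) 0
        have e3 : u * ((φ (x + EuclideanSpace.single i h) - φ x) / h)
            + w * ((φ (x - EuclideanSpace.single i h) - φ x) / h)
            - B i * fderiv ℝ φ x (EuclideanSpace.single i 1)
            = u * ((φ (x + EuclideanSpace.single i h) - φ x) / h
                - fderiv ℝ φ x (EuclideanSpace.single i 1))
              + w * ((φ (x - EuclideanSpace.single i h) - φ x) / h
                - -fderiv ℝ φ x (EuclideanSpace.single i 1)) := by
          rw [e]
          ring
        rw [e3]
        refine (abs_add_le _ _).trans ?_
        rw [abs_mul, abs_mul, abs_of_nonneg p1, abs_of_nonneg p2]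
        calc _ ≤ u * (S / ε ^ 2 * h) + w * (S / ε ^ 2 * h) := by gcongr
          _ = |B i| * (S / ε ^ 2 * h) := by rw [← add_mul, e2]
          _ ≤ _ := by gcongr
    _ = _ := by simp

lemma abs_interp_shift_le (hφ : TaylorBd φ S ε) (hS : 0 ≤ S) (hh : 0 < h) (x y : RN N) :
    |interp h (fun y => φ (x + y)) y - φ (x + y)| ≤ S / ε ^ 2 * (N * h ^ 2) :=
  abs_interp_sub_le hh (g := fun y => φ (x + y)) (p := fderiv ℝ φ (x + y)) (by positivity)
    fun v => by rw [← add_assoc]; exact hφ.abs_sub_sub_le (x + y) v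

lemma integrableOn_increment (hP : P.Admissible σ lam K) (hφ : TaylorBd φ S ε) (hS : 0 ≤ S)
    (hε : 0 < ε) (hδ : 0 < δ) (hδ1 : δ < 1) (α : A) (x : RN N) :
    IntegrableOn (fun z => φ (x + P.η α z) - φ x) {z | δ < ‖z‖} (P.ν α) := by
  have c1 := hφ.continuous
  have c2 := hP.eta_cont α
  refine hP.integrableOn_tail α hδ hδ1 (Continuous.stronglyMeasurable (by fun_prop))
    (B := S / ε * K + S / ε ^ 2 * K ^ 2) fun z => (hφ.abs_sub_le x _).trans ?_
  gcongr <;> exact hP.eta_bdd α z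

lemma quadrature_error (hP : P.Admissible σ lam K) (hφ : TaylorBd φ S ε) (hS : 0 ≤ S)
    (hε : 0 < ε) (hh : 0 < h) (hδ : 0 < δ) (hδ1 : δ < 1) (α : A) (x : RN N) :
    |P.discreteNonlocal h δ α φ x - ∫ z in {z | δ < ‖z‖}, (φ (x + P.η α z) - φ x) ∂P.ν α|
      ≤ S / ε ^ 2 * (N * h ^ 2) * (K * δ ^ (-σ)) := by
  obtain ⟨hi, he⟩ := hP.discreteNonlocal_eq_integral hh hδ hδ1 α φ x
  rw [he, ← integral_sub hi (hP.integrableOn_increment hφ hS hε hδ hδ1 α x)]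
  simp only [sub_sub_sub_cancel_right]
  refine (norm_setIntegral_le_of_norm_le_const
    (f := fun z => interp h (fun y => φ (x + y)) (P.η α z) - φ (x + P.η α z))
    (hP.finite_tail α hδ hδ1)
    (fun z _ => abs_interp_shift_le hφ hS hh x (P.η α z))).trans ?_
  gcongr
  exact hP.measureReal_tail_le α hδ hδ1

lemma tail_integral_eq (hP : P.Admissible σ lam K) (hφ : TaylorBd φ S ε) (hS : 0 ≤ S)
    (hε : 0 < ε) (hδ : 0 < δ) (hδ1 : δ < 1) (α : A) (x : RN N) :
    ∫ z in {z | δ < ‖z‖}, P.jumpIntegrand α φ x z ∂P.ν α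
      = ∫ z in {z | δ < ‖z‖}, (φ (x + P.η α z) - φ x) ∂P.ν α
        - fderiv ℝ φ x (∫ z in {z | δ < ‖z‖ ∧ ‖z‖ < 1}, P.η α z ∂P.ν α) := by
  have hc := hP.eta_cont α
  have hη : IntegrableOn (P.η α) {z | δ < ‖z‖} (P.ν α) :=
    hP.integrableOn_tail α hδ hδ1 hc.stronglyMeasurable (hP.eta_bdd α)
  have hset : ({z : RN N | δ < ‖z‖} ∩ ball 0 1) = {z | δ < ‖z‖ ∧ ‖z‖ < 1} := by
    ext z
    simp
  have hi : Integrable (fun z => fderiv ℝ φ x (P.η α z)) ((P.ν α).restrict {z | δ < ‖z‖}) :=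
    (fderiv ℝ φ x).integrable_comp hη
  have hη' : Integrable (P.η α) ((P.ν α).restrict {z | δ < ‖z‖ ∧ ‖z‖ < 1}) :=
    hη.mono_set fun z hz => hz.1
  rw [show P.jumpIntegrand α φ x = fun z => (φ (x + P.η α z) - φ x)
      - (ball (0 : RN N) 1).indicator (fun z => fderiv ℝ φ x (P.η α z)) z from rfl,
    integral_sub (hP.integrableOn_increment hφ hS hε hδ hδ1 α x)
      (hi.indicator measurableSet_ball), setIntegral_indicator measurableSet_ball, hset,
    (fderiv ℝ φ x).integral_comp_comm hη']

lemma integrable_eta_mul (hP : P.Admissible σ lam K) (hδ : 0 < δ) (hδ1 : δ < 1) (α : A)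
    (r c : Fin N) :
    IntegrableOn (fun z => P.η α z r * P.η α z c) (ball 0 δ \ {0}) (P.ν α) ∧
    |∫ z in ball 0 δ \ {0}, P.η α z r * P.η α z c ∂P.ν α|
      ≤ K ^ 2 * (K * δ ^ (((2 : ℕ) : ℝ) - σ)) := by
  have hc := hP.eta_cont α
  refine hP.integrableOn_small α hδ hδ1.le le_rfl (Continuous.stronglyMeasurable (by fun_prop))
    (fun z hz => ?_) (by positivity)
  rw [abs_mul, ← mul_pow, sq]
  have h1 := hP.eta_lin α z (hz.trans hδ1)
  have := hP.pos
  gcongr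
  · exact (PiLp.norm_apply_le (P.η α z) r).trans h1
  · exact (PiLp.norm_apply_le (P.η α z) c).trans h1

lemma eta_zero (hP : P.Admissible σ lam K) (α : A) : P.η α 0 = 0 := by
  simpa using hP.eta_lin α 0 (by simp)

lemma diffusion_apply (hP : P.Admissible σ lam K) (α : A) (r c : Fin N) :
    P.diffusion δ α r c
      = 1 / 2 * ∫ z in ball 0 δ \ {0}, P.η α z r * P.η α z c ∂P.ν α := by
  rw [diffusion, Matrix.of_apply,
    setIntegral_eq_of_subset_of_forall_sdiff_eq_zero measurableSet_ball sdiff_subset]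
  rintro z ⟨hz, hz'⟩
  have : z = 0 := by
    by_contra hne
    exact hz' ⟨hz, hne⟩
  simp [this, hP.eta_zero]

lemma bilin_eq_sum (q : RN N →L[ℝ] RN N →L[ℝ] ℝ) (v : RN N) :
    q v v = ∑ r, ∑ c, q (EuclideanSpace.single r 1) (EuclideanSpace.single c 1) * (v r * v c) := by
  conv_lhs => rw [euclidean_sum_single v]
  simp only [map_sum, map_smul, sum_apply, smul_apply,
    smul_eq_mul, Finset.mul_sum]
  rw [Finset.sum_comm]
  exact Finset.sum_congr rfl fun r _ => Finset.sum_congr rfl fun c _ => by ring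

lemma integral_bilin (hP : P.Admissible σ lam K) (hδ : 0 < δ) (hδ1 : δ < 1) (α : A)
    (q : RN N →L[ℝ] RN N →L[ℝ] ℝ) :
    IntegrableOn (fun z => 1 / 2 * q (P.η α z) (P.η α z)) (ball 0 δ \ {0}) (P.ν α) ∧
    ∫ z in ball 0 δ \ {0}, 1 / 2 * q (P.η α z) (P.η α z) ∂P.ν α
      = ∑ r, ∑ c, q (EuclideanSpace.single r 1) (EuclideanSpace.single c 1)
          * P.diffusion δ α r c := by
  have hi : ∀ r c, IntegrableOn (fun z => q (EuclideanSpace.single r 1) (EuclideanSpace.single c 1)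
      * (P.η α z r * P.η α z c)) (ball 0 δ \ {0}) (P.ν α) := fun r c =>
    (hP.integrable_eta_mul hδ hδ1 α r c).1.const_mul _
  simp only [bilin_eq_sum q]
  refine ⟨(integrable_finsetSum _ fun r _ => integrable_finsetSum _ fun c _ =>
    hi r c).const_mul _, ?_⟩
  rw [integral_const_mul, integral_finsetSum _ fun r _ => integrable_finsetSum _ fun c _ => hi r c,
    Finset.mul_sum]
  refine Finset.sum_congr rfl fun r _ => ?_
  rw [integral_finsetSum _ fun c _ => hi r c, Finset.mul_sum]
  refine Finset.sum_congr rfl fun c _ => ?_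
  rw [integral_const_mul, hP.diffusion_apply]
  ring

section
open scoped MatrixOrder

lemma diffusion_nonneg (hP : P.Admissible σ lam K) (hδ : 0 < δ) (hδ1 : δ < 1) (α : A) :
    0 ≤ P.diffusion δ α := by
  rw [Matrix.nonneg_iff_posSemidef]
  refine Matrix.PosSemidef.of_dotProduct_mulVec_nonneg ?_ fun v => ?_
  · ext r c
    simp only [Matrix.conjTranspose_apply, star_trivial, hP.diffusion_apply, mul_comm]
  · have hi : ∀ r c, IntegrableOn (fun z => v r * v c * (P.η α z r * P.η α z c))
        (ball 0 δ \ {0}) (P.ν α) := fun r c =>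
      (hP.integrable_eta_mul hδ hδ1 α r c).1.const_mul _
    have e : star v ⬝ᵥ (P.diffusion δ α).mulVec v
        = 1 / 2 * ∫ z in ball 0 δ \ {0}, (∑ r, v r * P.η α z r) ^ 2 ∂P.ν α := by
      have e1 : ∀ z, (∑ r, v r * P.η α z r) ^ 2
          = ∑ r, ∑ c, v r * v c * (P.η α z r * P.η α z c) := fun z => by
        rw [sq, Finset.sum_mul_sum]
        exact Finset.sum_congr rfl fun r _ => Finset.sum_congr rfl fun c _ => by ring
      simp only [e1]
      rw [integral_finsetSum _ fun r _ => integrable_finsetSum _ fun c _ => hi r c,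
        Finset.mul_sum]
      simp only [dotProduct, Matrix.mulVec, star_trivial, Finset.mul_sum]
      refine Finset.sum_congr rfl fun r _ => ?_
      rw [integral_finsetSum _ fun c _ => hi r c, Finset.mul_sum]
      refine Finset.sum_congr rfl fun c _ => ?_
      rw [integral_const_mul, hP.diffusion_apply]
      ring
    rw [e]
    exact mul_nonneg (by norm_num) (integral_nonneg fun z => sq_nonneg _)

lemma sum_sqrtCol_mul (hP : P.Admissible σ lam K) (hδ : 0 < δ) (hδ1 : δ < 1) (α : A)
    (r c : Fin N) : ∑ i, P.sqrtCol δ α i r * P.sqrtCol δ α i c = P.diffusion δ α r c := by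
  have h0 := hP.diffusion_nonneg hδ hδ1 α
  have hsq := CFC.sqrt_mul_sqrt_self (P.diffusion δ α) h0
  have hsym : (CFC.sqrt (P.diffusion δ α)).IsHermitian :=
    (Matrix.nonneg_iff_posSemidef.1 (CFC.sqrt_nonneg (P.diffusion δ α))).isHermitian
  conv_rhs => rw [← hsq, Matrix.mul_apply]
  refine Finset.sum_congr rfl fun i _ => ?_
  simp only [sqrtCol]
  rw [← hsym.apply c i, star_trivial]

end

/-- Together with `integral_bilin` this identifies the second order terms of the discrete diffusion
and of the small jumps, for whichever form `q` the Taylor bounds supply. -/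
lemma sum_bilin_sqrtCol (hP : P.Admissible σ lam K) (hδ : 0 < δ) (hδ1 : δ < 1) (α : A)
    (q : RN N →L[ℝ] RN N →L[ℝ] ℝ) :
    ∑ i, q (P.sqrtCol δ α i) (P.sqrtCol δ α i)
      = ∑ r, ∑ c, q (EuclideanSpace.single r 1) (EuclideanSpace.single c 1)
          * P.diffusion δ α r c := by
  simp only [bilin_eq_sum q]
  rw [Finset.sum_comm]
  refine Finset.sum_congr rfl fun r _ => ?_
  rw [Finset.sum_comm]
  refine Finset.sum_congr rfl fun c _ => ?_
  rw [← Finset.mul_sum, hP.sum_sqrtCol_mul hδ hδ1]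

/-- The squared lengths of the columns add up to the trace of the diffusion matrix, which is of
order `δ^(2-σ)`. -/
lemma norm_sqrtCol_sq_le (hP : P.Admissible σ lam K) (hδ : 0 < δ) (hδ1 : δ < 1) (α : A)
    (i : Fin N) : ‖P.sqrtCol δ α i‖ ^ 2 ≤ N * (K ^ 3 * δ ^ (2 - σ)) := by
  have h1 : ‖P.sqrtCol δ α i‖ ^ 2 ≤ ∑ j, ‖P.sqrtCol δ α j‖ ^ 2 :=
    Finset.single_le_sum (f := fun j => ‖P.sqrtCol δ α j‖ ^ 2) (fun j _ => sq_nonneg _)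
      (Finset.mem_univ i)
  refine h1.trans ?_
  simp only [EuclideanSpace.norm_sq_eq]
  rw [Finset.sum_comm]
  calc _ = ∑ r, P.diffusion δ α r r := by
        refine Finset.sum_congr rfl fun r _ => ?_
        rw [← hP.sum_sqrtCol_mul hδ hδ1]
        refine Finset.sum_congr rfl fun j _ => ?_
        rw [Real.norm_eq_abs, sq_abs, sq]
    _ ≤ ∑ _r : Fin N, K ^ 3 * δ ^ (2 - σ) := by
        refine Finset.sum_le_sum fun r _ => ?_
        have h2 := (abs_le.1 (hP.integrable_eta_mul hδ hδ1 α r r).2).2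
        have h3 : 0 ≤ K ^ 3 * δ ^ (2 - σ) := by have := hP.pos; positivity
        rw [hP.diffusion_apply]
        push_cast at h2
        nlinarith
    _ = _ := by simp

/-- The first term is the error of two interpolations divided by `k²`. The second is the fourth
order remainder at step `k s_i`, with `‖s_i‖⁴` of order `δ^(2(2-σ))`. -/
lemma diffusion_error (hP : P.Admissible σ lam K) (hφ : TaylorBd φ S ε) (hS : 0 ≤ S)
    (hh : 0 < h) (hk : 0 < k) (hδ : 0 < δ) (hδ1 : δ < 1) (α : A) (x : RN N)
    (q : RN N →L[ℝ] RN N →L[ℝ] ℝ)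
    (hq : ∀ v, |φ (x + v) + φ (x - v) - 2 * φ x - q v v| ≤ S / ε ^ 4 * ‖v‖ ^ 4) :
    |P.discreteDiffusion h k δ α φ x - ∑ i, q (P.sqrtCol δ α i) (P.sqrtCol δ α i)|
      ≤ N * (2 * (S / ε ^ 2 * (N * h ^ 2)) / k ^ 2
        + S / ε ^ 4 * k ^ 2 * (N * (K ^ 3 * δ ^ (2 - σ))) ^ 2) := by
  rw [discreteDiffusion, ← Finset.sum_sub_distrib]
  calc _ ≤ ∑ _i : Fin N, (2 * (S / ε ^ 2 * (N * h ^ 2)) / k ^ 2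
        + S / ε ^ 4 * k ^ 2 * (N * (K ^ 3 * δ ^ (2 - σ))) ^ 2) := by
        refine (Finset.abs_sum_le_sum_abs _ _).trans (Finset.sum_le_sum fun i _ => ?_)
        set s := P.sqrtCol δ α i with hs
        have h1 := abs_interp_shift_le hφ hS hh x (k • s)
        have h2 := abs_interp_shift_le hφ hS hh x (-(k • s))
        have h3 := hq (k • s)
        rw [← sub_eq_add_neg] at h2
        have h4 : q (k • s) (k • s) = k ^ 2 * q s s := by
          simp only [map_smul, smul_apply, smul_eq_mul]
          ring
        rw [h4, norm_smul, Real.norm_eq_abs, abs_of_pos hk] at h3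
        have h5 : ‖s‖ ^ 4 ≤ (N * (K ^ 3 * δ ^ (2 - σ))) ^ 2 := by
          have := hP.norm_sqrtCol_sq_le hδ hδ1 α i
          calc ‖s‖ ^ 4 = (‖s‖ ^ 2) ^ 2 := by ring
            _ ≤ _ := by gcongr
        have h6 : S / ε ^ 4 * (k * ‖s‖) ^ 4
            ≤ S / ε ^ 4 * k ^ 2 * (N * (K ^ 3 * δ ^ (2 - σ))) ^ 2 * k ^ 2 := by
          calc _ = S / ε ^ 4 * k ^ 4 * ‖s‖ ^ 4 := by ring
            _ ≤ S / ε ^ 4 * k ^ 4 * (N * (K ^ 3 * δ ^ (2 - σ))) ^ 2 := by gcongr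
            _ = _ := by ring
        set I1 := interp h (fun y => φ (x + y)) (k • s)
        set I2 := interp h (fun y => φ (x + y)) (-(k • s))
        have h7 : (I1 + I2 - 2 * φ x) / k ^ 2 - q s s
            = (I1 + I2 - 2 * φ x - k ^ 2 * q s s) / k ^ 2 := by
          field_simp
        have hk2 : 0 < k ^ 2 := by positivity
        rw [h7, abs_div, abs_of_pos hk2, div_le_iff₀ hk2, add_mul, div_mul_cancel₀ _ hk2.ne']
        rw [abs_le] at *
        constructor <;> linarith
    _ = _ := by
        rw [Finset.sum_const, Finset.card_univ, Fintype.card_fin, nsmul_eq_mul]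

/-- Truncation error of replacing small jumps by a diffusion. -/
lemma small_jump_error (hP : P.Admissible σ lam K) (hφ : TaylorBd φ S ε) (hS : 0 ≤ S)
    (hε : 0 < ε) (hδ : 0 < δ) (hδ1 : δ < 1) (α : A) (x : RN N)
    (q : RN N →L[ℝ] RN N →L[ℝ] ℝ)
    (hq : ∀ v, |φ (x + v) - φ x - fderiv ℝ φ x v - 1 / 2 * q v v| ≤ S / ε ^ 3 * ‖v‖ ^ 3) :
    |∫ z in ball 0 δ \ {0}, P.jumpIntegrand α φ x z ∂P.ν α
      - ∫ z in ball 0 δ \ {0}, 1 / 2 * q (P.η α z) (P.η α z) ∂P.ν α|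
      ≤ S / ε ^ 3 * K ^ 3 * (K * δ ^ (((3 : ℕ) : ℝ) - σ)) := by
  have hm := hP.stronglyMeasurable_jumpIntegrand hφ α x
  have hc := hP.eta_cont α
  have hi := (hP.integrableOn_small α hδ hδ1.le le_rfl hm
      (fun z hz => hP.jumpIntegrand_small hφ hS α x (hz.trans hδ1)) (by positivity)).1
  rw [← integral_sub hi (hP.integral_bilin hδ hδ1 α q).1]
  refine (hP.integrableOn_small α hδ hδ1.le (by norm_num)
    (hm.sub (Continuous.stronglyMeasurable (by fun_prop)))
    (fun z hz => ?_) (by have := hP.pos; positivity)).2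
  have hz1 := hz.trans hδ1
  simp only [Pi.sub_apply]
  rw [jumpIntegrand, indicator_of_mem (by simpa using hz1)]
  refine (hq _).trans ?_
  rw [mul_assoc, ← mul_pow]
  gcongr
  exact hP.eta_lin α z hz1

/-- Pairing `z` with `-z` turns the integrand into a symmetric second difference, which has no third
order term. -/
lemma small_jump_error_odd (hP : P.Admissible σ lam K) (hodd : P.JumpOdd) (hφ : TaylorBd φ S ε)
    (hS : 0 ≤ S) (hε : 0 < ε) (hδ : 0 < δ) (hδ1 : δ < 1) (α : A) (x : RN N)
    (q : RN N →L[ℝ] RN N →L[ℝ] ℝ)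
    (hq : ∀ v, |φ (x + v) + φ (x - v) - 2 * φ x - q v v| ≤ S / ε ^ 4 * ‖v‖ ^ 4) :
    |∫ z in ball 0 δ \ {0}, P.jumpIntegrand α φ x z ∂P.ν α
      - ∫ z in ball 0 δ \ {0}, 1 / 2 * q (P.η α z) (P.η α z) ∂P.ν α|
      ≤ S / ε ^ 4 * K ^ 4 * (K * δ ^ (((4 : ℕ) : ℝ) - σ)) := by
  have hm := hP.stronglyMeasurable_jumpIntegrand hφ α x
  have hc := hP.eta_cont α
  have hc2 := hφ.continuous
  have hi := (hP.integrableOn_small α hδ hδ1.le le_rfl hm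
      (fun z hz => hP.jumpIntegrand_small hφ hS α x (hz.trans hδ1)) (by positivity)).1
  have hi' : IntegrableOn (fun z => P.jumpIntegrand α φ x (-z)) (ball 0 δ \ {0}) (P.ν α) :=
    (hP.integrableOn_small α hδ hδ1.le le_rfl (hm.comp_measurable measurable_neg)
      (fun z hz => (hP.jumpIntegrand_small hφ hS α x (z := -z)
        (by rw [norm_neg]; exact hz.trans hδ1)).trans_eq (by rw [norm_neg])) (by positivity)).1
  have hsub : ball (0 : RN N) δ \ {0} ⊆ ball 0 1 := fun z hz => ball_subset_ball hδ1.le hz.1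
  have hsym := setIntegral_neg_eq hP.symm α (P.jumpIntegrand α φ x) hsub (fun z => by simp)
  have hq2 := (hP.integral_bilin hδ hδ1 α q).1
  have e : 2 * (∫ z in ball 0 δ \ {0}, P.jumpIntegrand α φ x z ∂P.ν α
      - ∫ z in ball 0 δ \ {0}, 1 / 2 * q (P.η α z) (P.η α z) ∂P.ν α)
      = ∫ z in ball 0 δ \ {0}, (P.jumpIntegrand α φ x z + P.jumpIntegrand α φ x (-z)
        - 2 * (1 / 2 * q (P.η α z) (P.η α z))) ∂P.ν α := by
    rw [integral_add_sub hi hi' (hq2.const_mul 2), hsym, integral_const_mul (2 : ℝ)]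
    ring
  have h2 := (hP.integrableOn_small α hδ hδ1.le (m := 4) (B := S / ε ^ 4 * K ^ 4)
    (f := fun z => P.jumpIntegrand α φ x z + P.jumpIntegrand α φ x (-z)
        - 2 * (1 / 2 * q (P.η α z) (P.η α z))) (by norm_num)
    ((hm.add (hm.comp_measurable measurable_neg)).sub
      (Continuous.stronglyMeasurable (by fun_prop)))
    (fun z hz => ?_) (by positivity)).2
  · rw [← e, abs_mul, abs_of_pos two_pos] at h2
    have := abs_nonneg (∫ z in ball 0 δ \ {0}, P.jumpIntegrand α φ x z ∂P.ν α
      - ∫ z in ball 0 δ \ {0}, 1 / 2 * q (P.η α z) (P.η α z) ∂P.ν α)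
    linarith
  · have hz1 := hz.trans hδ1
    rw [jumpIntegrand, jumpIntegrand, indicator_of_mem (by simpa using hz1),
      indicator_of_mem (by simpa using hz1), hodd α z hz1, map_neg, ← sub_eq_add_neg]
    calc _ = |φ (x + P.η α z) + φ (x - P.η α z) - 2 * φ x - q (P.η α z) (P.η α z)| := by
          congr 1
          ring
      _ ≤ _ := (hq _).trans ?_
    rw [mul_assoc, ← mul_pow]
    gcongr
    exact hP.eta_lin α z hz1

/-- After splitting at `‖z‖ = δ`, the compensator of the jumps with `δ < ‖z‖ < 1` joins `b` to form
the effective drift, and each remaining piece has its own discrete counterpart. -/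
lemma consistency_aux (hP : P.Admissible σ lam K) (hφ : TaylorBd φ S ε) (hS : 0 ≤ S)
    (hε : 0 < ε) (hh : 0 < h) (hk : 0 < k) (hδ : 0 < δ) (hδ1 : δ < 1) (α : A) (x : RN N)
    (q : RN N →L[ℝ] RN N →L[ℝ] ℝ) (E : ℝ)
    (hq : ∀ v, |φ (x + v) + φ (x - v) - 2 * φ x - q v v| ≤ S / ε ^ 4 * ‖v‖ ^ 4)
    (hE : |∫ z in ball 0 δ \ {0}, P.jumpIntegrand α φ x z ∂P.ν α
      - ∫ z in ball 0 δ \ {0}, 1 / 2 * q (P.η α z) (P.η α z) ∂P.ν α| ≤ E) :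
    |P.generator α φ x - P.schemeOp h k δ α φ x| ≤ E
      + N * (2 * (S / ε ^ 2 * (N * h ^ 2)) / k ^ 2
        + S / ε ^ 4 * k ^ 2 * (N * (K ^ 3 * δ ^ (2 - σ))) ^ 2)
      + N * (K * (S / ε ^ 2 * h)) + S / ε ^ 2 * (N * h ^ 2) * (K * δ ^ (-σ)) := by
  have h1 := hP.upwind_error hφ hS hh hδ hδ1 α x
  have h2 := hP.quadrature_error hφ hS hε hh hδ hδ1 α x
  have h3 := hP.diffusion_error hφ hS hh hk hδ hδ1 α x q hq
  rw [hP.sum_bilin_sqrtCol hδ hδ1, ← (hP.integral_bilin hδ hδ1 α q).2] at h3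
  have h4 := (hP.nonlocal_split hφ hS hε α x hδ hδ1).2
  rw [hP.tail_integral_eq hφ hS hε hδ hδ1] at h4
  have h5 : fderiv ℝ φ x (P.effectiveDrift δ α) = fderiv ℝ φ x (P.b α)
      - fderiv ℝ φ x (∫ z in {z | δ < ‖z‖ ∧ ‖z‖ < 1}, P.η α z ∂P.ν α) := by
    rw [effectiveDrift, map_sub]
  rw [h5] at h1
  rw [generator, h4, schemeOp]
  rw [abs_le] at *
  constructor <;> linarith

/-- Consistency of the scheme; the exponent of the small jump error is `m = 3` in general, and
`m = 4` for odd jumps. -/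
lemma consistency (hP : P.Admissible σ lam K) {m : ℕ} (hm : m = 3 ∨ (m = 4 ∧ P.JumpOdd)) :
    ∃ C : ℝ, 0 < C ∧ ∀ (S ε h k δ : ℝ) (φ : RN N → ℝ), TaylorBd φ S ε → 0 ≤ S → 0 < ε → 0 < h →
      0 < k → 0 < δ → δ < 1 → ∀ α x, |P.generator α φ x - P.schemeOp h k δ α φ x|
        ≤ C * S * (δ ^ ((m : ℝ) - σ) / ε ^ m + h ^ 2 / k ^ 2 / ε ^ 2
          + k ^ 2 * (δ ^ (2 - σ)) ^ 2 / ε ^ 4 + h / ε ^ 2 + h ^ 2 * δ ^ (-σ) / ε ^ 2) := by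
  have hK := hP.pos
  set C := K ^ m * K + 2 * N ^ 2 + N * (N * K ^ 3) ^ 2 + N * K + N * K + 1 with hC
  refine ⟨C, by positivity, fun S ε h k δ φ hφ hS hε hh hk hδ hδ1 α x => ?_⟩
  obtain ⟨-, q, hq⟩ := hφ.taylor x
  have key : |P.generator α φ x - P.schemeOp h k δ α φ x|
      ≤ S / ε ^ m * K ^ m * (K * δ ^ ((m : ℝ) - σ))
      + N * (2 * (S / ε ^ 2 * (N * h ^ 2)) / k ^ 2
        + S / ε ^ 4 * k ^ 2 * (N * (K ^ 3 * δ ^ (2 - σ))) ^ 2)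
      + N * (K * (S / ε ^ 2 * h)) + S / ε ^ 2 * (N * h ^ 2) * (K * δ ^ (-σ)) := by
    refine hP.consistency_aux hφ hS hε hh hk hδ hδ1 α x q _ (fun v => (hq v).2.2) ?_
    rcases hm with rfl | ⟨rfl, hodd⟩
    · exact hP.small_jump_error hφ hS hε hδ hδ1 α x q fun v => (hq v).2.1
    · exact hP.small_jump_error_odd hodd hφ hS hε hδ hδ1 α x q fun v => (hq v).2.2
  refine key.trans ?_
  have t1 : 0 ≤ S * (δ ^ ((m : ℝ) - σ) / ε ^ m) := by positivity
  have t2 : 0 ≤ S * (h ^ 2 / k ^ 2 / ε ^ 2) := by positivity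
  have t3 : 0 ≤ S * (k ^ 2 * (δ ^ (2 - σ)) ^ 2 / ε ^ 4) := by positivity
  have t4 : 0 ≤ S * (h / ε ^ 2) := by positivity
  have t5 : 0 ≤ S * (h ^ 2 * δ ^ (-σ) / ε ^ 2) := by positivity
  have c1 : 0 ≤ K ^ m * K := by positivity
  have c2 : (0 : ℝ) ≤ 2 * N ^ 2 := by positivity
  have c3 : 0 ≤ N * (N * K ^ 3) ^ 2 := by positivity
  have c4 : 0 ≤ N * K := by positivity
  calc _ = K ^ m * K * (S * (δ ^ ((m : ℝ) - σ) / ε ^ m))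
        + 2 * N ^ 2 * (S * (h ^ 2 / k ^ 2 / ε ^ 2))
        + N * (N * K ^ 3) ^ 2 * (S * (k ^ 2 * (δ ^ (2 - σ)) ^ 2 / ε ^ 4))
        + N * K * (S * (h / ε ^ 2)) + N * K * (S * (h ^ 2 * δ ^ (-σ) / ε ^ 2)) := by ring
    _ ≤ C * (S * (δ ^ ((m : ℝ) - σ) / ε ^ m)) + C * (S * (h ^ 2 / k ^ 2 / ε ^ 2))
        + C * (S * (k ^ 2 * (δ ^ (2 - σ)) ^ 2 / ε ^ 4))
        + C * (S * (h / ε ^ 2)) + C * (S * (h ^ 2 * δ ^ (-σ) / ε ^ 2)) := by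
      gcongr <;> linarith
    _ = _ := by ring

end Admissible

end HJBData

/-! ### Limits in a parameter and comparison principles -/

section Elementary

lemma le_of_forall_pos_mul {a b M : ℝ} (h : ∀ κ, 0 < κ → a ≤ b + κ * M) : a ≤ b := by
  by_contra! hcon
  have hM : 0 < 2 * (|M| + 1) := by positivity
  have h1 := h ((a - b) / (2 * (|M| + 1))) (div_pos (by linarith) hM)
  have h2 : (a - b) / (2 * (|M| + 1)) * M ≤ (a - b) / 2 := by
    rw [div_mul_eq_mul_div, div_le_div_iff₀ hM two_pos]
    nlinarith [le_abs_self M, abs_nonneg M]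
  linarith

lemma mollify_le_of_le {N : ℕ} {w : RN N → ℝ} (hw : Continuous w) {ε a : ℝ} (hε : 0 ≤ ε)
    (h : ∀ z, w z ≤ a) (x : RN N) : mollify ε w x ≤ a := by
  have := mollify_mono (x := x) hw (continuous_const (y := a)) hε fun z _ => h z
  rwa [mollify_const] at this

end Elementary

namespace HJBData

variable {N : ℕ} {A : Type*} {P : HJBData N A} {σ lam K : ℝ}

namespace IsSchemeSolution

variable {h k δ : ℝ} {v : RN N →ᵇ ℝ}

lemma le_zero (hv : P.IsSchemeSolution h k δ v) (α : A) (x : RN N) :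
    P.f α x + P.c α x * v x - P.schemeOp h k δ α v x ≤ 0 := by
  have h1 := (le_iSup (fun α => ((P.f α x + P.c α x * v x
      - (P.discreteDiffusion h k δ α v x + P.upwindDrift h δ α v x)
      - P.discreteNonlocal h δ α v x : ℝ) : EReal)) α).trans_eq (hv x)
  have h2 : P.f α x + P.c α x * v x
      - (P.discreteDiffusion h k δ α v x + P.upwindDrift h δ α v x)
      - P.discreteNonlocal h δ α v x ≤ 0 := by exact_mod_cast h1
  rw [schemeOp]
  linarith

lemma exists_gt (hv : P.IsSchemeSolution h k δ v) (x : RN N) {τ : ℝ} (hτ : 0 < τ) :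
    ∃ α, -τ < P.f α x + P.c α x * v x - P.schemeOp h k δ α v x := by
  have h0 : ((-τ : ℝ) : EReal) < ⨆ α, ((P.f α x + P.c α x * v x
      - (P.discreteDiffusion h k δ α v x + P.upwindDrift h δ α v x)
      - P.discreteNonlocal h δ α v x : ℝ) : EReal) := by
    rw [hv x]
    exact_mod_cast neg_lt_zero.2 hτ
  obtain ⟨α, hα⟩ := lt_iSup_iff.1 h0
  have h2 := EReal.coe_lt_coe_iff.1 hα
  exact ⟨α, by rw [schemeOp]; linarith⟩

end IsSchemeSolution

namespace Admissible

variable {h k δ : ℝ}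

lemma c_pos (hP : P.Admissible σ lam K) (α : A) (x : RN N) : 0 < P.c α x :=
  hP.lam_pos.trans_le (hP.le_c α x)

/-- Comparison principle for the scheme. -/
lemma scheme_comparison (hP : P.Admissible σ lam K) (hh : 0 < h) (hδ : 0 < δ) (hδ1 : δ < 1)
    {v : RN N →ᵇ ℝ} (hv : P.IsSchemeSolution h k δ v) {w : RN N → ℝ} {B E : ℝ}
    (hw : ∀ x, |w x| ≤ B) (hE : 0 ≤ E)
    (hsub : ∀ α x, P.f α x + P.c α x * w x - P.schemeOp h k δ α w x ≤ E) (x : RN N) :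
    w x - v x ≤ E / lam := by
  obtain ⟨Λ, hΛ⟩ := hP.exists_isJump_schemeOp (k := k) hh hδ hδ1
  refine jump_max_principle (d := fun x => w x - v x) (Λ := Λ) (M₀ := B + ‖v‖) hP.lam_pos hE
    (fun x => ?_) (fun x _ τ hτ => ?_) x
  · have h1 := (abs_le.1 (hw x)).2
    have h2 := (abs_le.1 (v.norm_coe_le_norm x)).1
    linarith
  · obtain ⟨α, hα⟩ := hv.exists_gt x hτ
    refine ⟨P.schemeOp h k δ α, P.c α x, hΛ α, hP.le_c α x, ?_⟩
    rw [(hΛ α).map_sub w v]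
    linarith [hsub α x]

lemma abs_schemeSolution_le (hP : P.Admissible σ lam K) (hh : 0 < h) (hδ : 0 < δ) (hδ1 : δ < 1)
    {v : RN N →ᵇ ℝ} (hv : P.IsSchemeSolution h k δ v) (x : RN N) : |v x| ≤ K / lam := by
  obtain ⟨Λ, hΛ⟩ := hP.exists_isJump_schemeOp (k := k) hh hδ hδ1
  have hlam := hP.lam_pos
  have hK := hP.pos
  have h1 : -(K / lam) - v x ≤ 0 / lam := by
    refine hP.scheme_comparison hh hδ hδ1 hv (w := fun _ => -(K / lam)) (B := |K / lam|)
      (fun _ => by rw [abs_neg]) le_rfl (fun α x => ?_) x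
    rw [(hΛ α).map_const]
    have h2 := (abs_le.1 (hP.f_bdd α x)).2
    have h3 : K ≤ P.c α x * (K / lam) := by
      calc K = lam * (K / lam) := by field_simp
        _ ≤ _ := by gcongr; exact hP.le_c α x
    linarith
  have h2 : v x ≤ K / lam := by
    refine jump_max_principle (d := v) (Λ := Λ) (M₀ := ‖v‖) hP.lam_pos hK.le
      (fun x => (abs_le.1 (v.norm_coe_le_norm x)).2) (fun x _ τ hτ => ?_) x
    -- This only supplies an index. The inequality used is `le_zero`, valid for every `α`, which
    -- gives `c v - T v ≤ -f ≤ K`.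
    obtain ⟨α, hα⟩ := hv.exists_gt x hτ
    refine ⟨P.schemeOp h k δ α, P.c α x, hΛ α, hP.le_c α x, ?_⟩
    have h3 := hv.le_zero α x
    have h4 := (abs_le.1 (hP.f_bdd α x)).1
    linarith
  rw [zero_div] at h1
  rw [abs_le]
  constructor <;> linarith

lemma coeff_shift_le (hP : P.Admissible σ lam K) (α : A) (x y : RN N) {a B : ℝ} (ha : |a| ≤ B) :
    P.f α x + P.c α x * a ≤ P.f α y + P.c α y * a + K * ‖x - y‖ * (1 + B) := by
  have h1 := (abs_le.1 (hP.f_lip α x y)).2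
  have h2 : (P.c α x - P.c α y) * a ≤ K * ‖x - y‖ * B := by
    refine (le_abs_self _).trans ?_
    rw [abs_mul]
    have := hP.pos
    gcongr
    exact hP.c_lip α x y
  linarith

/-- A translate of `v` solves the scheme up to the variation of `f` and `c`, hence can be compared
with `v`. The constant does not depend on `h`, `k`, `δ`. -/
lemma lipschitz_schemeSolution (hP : P.Admissible σ lam K) (hh : 0 < h) (hδ : 0 < δ) (hδ1 : δ < 1)
    {v : RN N →ᵇ ℝ} (hv : P.IsSchemeSolution h k δ v) (x y : RN N) :
    |v x - v y| ≤ K * (1 + K / lam) / lam * ‖x - y‖ := by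
  obtain ⟨Λ, hΛ⟩ := hP.exists_isJump_schemeOp (k := k) hh hδ hδ1
  have hlam := hP.lam_pos
  have hK := hP.pos
  have one : ∀ x y, v x - v y ≤ K * (1 + K / lam) / lam * ‖x - y‖ := fun x y => by
    have h1 := hP.scheme_comparison hh hδ hδ1 hv (w := fun z => v (z + (x - y)))
      (E := K * ‖x - y‖ * (1 + K / lam)) (fun z => v.norm_coe_le_norm _) (by positivity)
      (fun α z => by
        rw [(hΛ α).shift v]
        have h2 := hv.le_zero α (z + (x - y))
        have h3 := hP.coeff_shift_le α z (z + (x - y))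
          (hP.abs_schemeSolution_le hh hδ hδ1 hv (z + (x - y)))
        rw [sub_add_cancel_left, norm_neg] at h3
        linarith) y
    rw [add_sub_cancel] at h1
    exact h1.trans_eq (by ring)
  rw [abs_le]
  have h1 := one x y
  have h2 := one y x
  rw [norm_sub_rev] at h2
  constructor <;> linarith

/-- Regularization of a linear inequality with Lipschitz coefficients. -/
lemma mollify_subsolution (hP : P.Admissible σ lam K) (α : A) {w R : RN N → ℝ} {B E ε : ℝ}
    (hw : Continuous w) (hR : Continuous R) (hε : 0 ≤ ε) (hB : ∀ x, |w x| ≤ B)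
    (h : ∀ x, P.f α x + P.c α x * w x + R x ≤ E) (x : RN N) :
    P.f α x + P.c α x * mollify ε w x + mollify ε R x ≤ E + K * ε * (1 + B) := by
  have hB0 : 0 ≤ B := (abs_nonneg _).trans (hB 0)
  -- The coefficients are frozen at `x` so that averaging acts on `w` and `R` alone. Their variation
  -- over the ball of radius `ε` costs `K ε (1 + B)`.
  have e : P.f α x + P.c α x * mollify ε w x + mollify ε R x
      = mollify ε (fun z => P.f α x + P.c α x * w z + R z) x := by
    rw [mollify_add (w := fun z => P.f α x + P.c α x * w z) (by fun_prop) hR,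
      mollify_add (w' := fun z => P.c α x * w z) (by fun_prop) (by fun_prop), mollify_const,
      mollify_const_mul]
  rw [e, ← mollify_const ε (E + K * ε * (1 + B)) x]
  refine mollify_mono (by fun_prop) continuous_const hε fun z hz => ?_
  have h1 := hP.coeff_shift_le α x z (hB z)
  rw [norm_sub_rev] at h1
  have h2 : K * ‖z - x‖ * (1 + B) ≤ K * ε * (1 + B) := by
    have := hP.pos
    gcongr
  linarith [h z]

/-- Comparison of a smooth subsolution with a viscosity solution. -/
lemma le_viscositySolution (hP : P.Admissible σ lam K) {u : RN N →ᵇ ℝ}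
    (hu : P.IsViscositySolution u) {w : RN N → ℝ} {S ε B E : ℝ} (hw : TaylorBd w S ε)
    (hS : 0 ≤ S) (hε : 0 < ε) (hB : ∀ x, |w x| ≤ B) (hE : 0 ≤ E)
    (hsub : ∀ α x, P.f α x + P.c α x * w x - P.generator α w x ≤ E) (y : RN N) :
    w y - u y ≤ E / lam := by
  obtain ⟨ζ, Sζ, hSζ, hζ, hζ'⟩ := exists_penalization N
  obtain ⟨C, hC, hgen⟩ := hP.exists_generator_bound hSζ one_pos
  have hlam := hP.lam_pos
  refine le_of_forall_pos_mul (M := (1 + C) / lam + (ζ y + 1)) fun κ hκ => ?_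
  obtain ⟨x, hx⟩ := exists_penalized_max (v := fun x => w x - u x) (B := B + ‖u‖)
    (hw.continuous.sub u.continuous) (fun x => (abs_sub _ _).trans
      (add_le_add (hB x) (u.norm_coe_le_norm x))) hζ.continuous hζ' hκ
  have hham := hu.2 (fun z => w z - κ * ζ z) x (hw.contDiff.sub (contDiff_const.mul hζ.contDiff))
    fun z => by linarith [hx z]
  -- The supremum need not be attained; an index within `κ` suffices, because the subsolution
  -- inequality for `w` holds for every `α`.
  have h0 : ((-κ : ℝ) : EReal) < P.hamiltonian (u x) (fun z => w z - κ * ζ z) x :=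
    lt_of_lt_of_le (by exact_mod_cast neg_lt_zero.2 hκ) hham
  obtain ⟨α, hα⟩ := lt_iSup_iff.1 h0
  have h1 := EReal.coe_lt_coe_iff.1 hα
  have h2 := hP.generator_sub_const_mul hw hS hε hζ hSζ one_pos κ α x
  rw [generator] at h2
  have h3 := mul_le_mul_of_nonneg_left (abs_le.1 (hgen α ζ x hζ)).2 hκ.le
  have h4 := hsub α x
  have h5 : P.c α x * (w x - u x) ≤ E + κ * (1 + C) := by linarith
  have h6 : w x - u x ≤ (E + κ * (1 + C)) / lam := by
    rw [le_div_iff₀ hlam]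
    rcases le_or_gt (w x - u x) 0 with hneg | hpos
    · have : 0 ≤ E + κ * (1 + C) := by positivity
      nlinarith
    · nlinarith [hP.le_c α x]
  have h7 : -1 ≤ ζ x := by linarith [hζ' x, norm_nonneg x]
  have h8 := mul_le_mul_of_nonneg_left h7 hκ.le
  have h9 : (E + κ * (1 + C)) / lam = E / lam + κ * ((1 + C) / lam) := by ring
  linarith [hx y]

/-- Comparison of a viscosity subsolution with a smooth supersolution of a linear equation. -/
lemma viscosity_le_of_linear (hP : P.Admissible σ lam K) (α : A) {u G w : RN N → ℝ}
    {S ε B E μ : ℝ} (hu : Continuous u) (hBu : ∀ x, |u x| ≤ B)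
    (hv : ∀ (φ : RN N → ℝ) (x : RN N), ContDiff ℝ 2 φ → (∀ y, u y - φ y ≤ u x - φ x) →
      -P.generator α φ x ≤ G x)
    (hw : TaylorBd w S ε) (hS : 0 ≤ S) (hε : 0 < ε) (hB : ∀ x, |w x| ≤ B) (hμ : 0 < μ)
    (hsup : ∀ x, μ * u x + G x - E ≤ μ * w x - P.generator α w x) (y : RN N) :
    u y - w y ≤ E / μ := by
  obtain ⟨ζ, Sζ, hSζ, hζ, hζ'⟩ := exists_penalization N
  obtain ⟨C, hC, hgen⟩ := hP.exists_generator_bound hSζ one_pos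
  refine le_of_forall_pos_mul (M := C / μ + (ζ y + 1)) fun κ hκ => ?_
  obtain ⟨x, hx⟩ := exists_penalized_max (v := fun x => u x - w x) (B := B + B)
    (hu.sub hw.continuous) (fun x => (abs_sub _ _).trans
      (add_le_add (hBu x) (hB x))) hζ.continuous hζ' hκ
  -- The test function is `w + κ ζ`, written with `-κ` so that `generator_sub_const_mul` applies.
  have h1 := hv (fun z => w z - (-κ) * ζ z) x
    (hw.contDiff.sub (contDiff_const.mul hζ.contDiff)) fun z => by linarith [hx z]
  rw [hP.generator_sub_const_mul hw hS hε hζ hSζ one_pos (-κ) α x] at h1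
  have h3 := mul_le_mul_of_nonneg_left (abs_le.1 (hgen α ζ x hζ)).2 hκ.le
  have h4 := hsup x
  have h6 : u x - w x ≤ (E + κ * C) / μ := by
    rw [le_div_iff₀ hμ]
    linarith
  have h7 : -1 ≤ ζ x := by linarith [hζ' x, norm_nonneg x]
  have h8 := mul_le_mul_of_nonneg_left h7 hκ.le
  have h9 : (E + κ * C) / μ = E / μ + κ * (C / μ) := by ring
  linarith [hx y]

/-- Jump operators approximate the generator on smooth functions. -/
lemma exists_jump_approx (hP : P.Admissible σ lam K) (hσ₂ : σ < 2) (α : A) {S ε τ : ℝ}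
    (hS : 0 ≤ S) (hε : 0 < ε) (hτ : 0 < τ) :
    ∃ T Λ, IsJump (N := N) T Λ ∧
      ∀ φ, TaylorBd φ S ε → ∀ x, |P.generator α φ x - T φ x| ≤ τ := by
  -- The scheme itself provides the operator, with mesh `t²` and `k = δ = t`: every truncation term
  -- is then at most `t` times a fixed power of `1 / ε`.
  obtain ⟨C, hC, hcons⟩ := hP.consistency (m := 3) (Or.inl rfl)
  set M : ℝ := 1 / ε ^ 3 + 1 / ε ^ 2 + 1 / ε ^ 4 + 1 / ε ^ 2 + 1 / ε ^ 2 with hM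
  have hM0 : 0 < M := by positivity
  set t := min (1 / 2) (τ / (C * S * M + 1)) with ht
  have hden : 0 < C * S * M + 1 := by positivity
  have ht0 : 0 < t := lt_min one_half_pos (by positivity)
  have ht1 : t < 1 := (min_le_left _ _).trans_lt one_half_lt_one
  have htτ : t * (C * S * M + 1) ≤ τ := by
    rw [← le_div_iff₀ hden]
    exact min_le_right _ _
  obtain ⟨Λ, hΛ⟩ := hP.exists_isJump_schemeOp (k := t) (h := t ^ 2) (by positivity) ht0 ht1
  refine ⟨_, Λ, hΛ α, fun φ hφ x =>
    (hcons S ε (t ^ 2) t t φ hφ hS hε (by positivity) ht0 ht0 ht1 α x).trans ?_⟩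
  have hpow : ∀ a : ℝ, 1 ≤ a → t ^ a ≤ t := fun a ha => by
    simpa using Real.rpow_le_rpow_of_exponent_ge ht0 ht1.le ha
  have hsq : t ^ 2 ≤ t := by nlinarith
  have e1 : t ^ (((3 : ℕ) : ℝ) - σ) ≤ t := hpow _ (by push_cast; linarith)
  have e2 : (t ^ 2) ^ 2 / t ^ 2 ≤ t := by
    rw [sq (t ^ 2), mul_div_cancel_right₀ _ (by positivity)]
    exact hsq
  have e3 : t ^ 2 * (t ^ (2 - σ)) ^ 2 ≤ t := by
    have : t ^ (2 - σ) ≤ 1 := Real.rpow_le_one ht0.le ht1.le (by linarith)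
    have h2 : (t ^ (2 - σ)) ^ 2 ≤ 1 := pow_le_one₀ (by positivity) this
    calc t ^ 2 * (t ^ (2 - σ)) ^ 2 ≤ t ^ 2 * 1 := by gcongr
      _ ≤ t := by linarith
  have e5 : (t ^ 2) ^ 2 * t ^ (-σ) ≤ t := by
    have : (t ^ 2) ^ 2 * t ^ (-σ) = t ^ (4 - σ) := by
      rw [← pow_mul, ← Real.rpow_natCast, ← Real.rpow_add ht0]
      congr 1
    rw [this]
    exact hpow _ (by linarith)
  calc _ ≤ C * S * (t / ε ^ 3 + t / ε ^ 2 + t / ε ^ 4 + t / ε ^ 2 + t / ε ^ 2) := by gcongr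
    _ = t * (C * S * M) := by rw [hM]; ring
    _ ≤ t * (C * S * M + 1) := by gcongr; linarith
    _ ≤ τ := htτ

end Admissible

end HJBData

/-! ### Sup-convolution -/

section SupConvolution

variable {N : ℕ}

/-- Lipschitz regularization from above. -/
lemma exists_supConvolution {u : RN N → ℝ} (hu : Continuous u) {B θ : ℝ} (hB : ∀ x, |u x| ≤ B)
    (hθ : 0 < θ) : ∃ w : RN N → ℝ, (∀ x y, u y - ‖x - y‖ / θ ≤ w x) ∧
      (∀ x, ∃ y, ‖x - y‖ ≤ 2 * B * θ ∧ w x = u y - ‖x - y‖ / θ) ∧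
      (∀ x, u x ≤ w x) ∧ (∀ x, |w x| ≤ B) ∧ ∀ x y, |w x - w y| ≤ 1 / θ * ‖x - y‖ := by
  have hmax : ∀ x, ∃ y, ∀ y', u y' - ‖x - y'‖ / θ ≤ u y - ‖x - y‖ / θ := fun x => by
    -- The constant `‖x‖` gives the required growth `‖y‖ - 1 ≤ ζ y` and does not affect the
    -- maximizer.
    obtain ⟨y, hy⟩ := exists_penalized_max (v := u) (ζ := fun y => ‖x - y‖ + ‖x‖) (κ := 1 / θ)
      hu hB (by fun_prop) (fun y => by
        have := norm_sub_norm_le y x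
        rw [norm_sub_rev] at this
        linarith [norm_nonneg x]) (by positivity)
    refine ⟨y, fun y' => ?_⟩
    have := hy y'
    have e : ∀ z, 1 / θ * (‖x - z‖ + ‖x‖) = ‖x - z‖ / θ + ‖x‖ / θ := fun z => by ring
    rw [e, e] at this
    linarith
  choose Y hY using hmax
  have hle : ∀ x, u x ≤ u (Y x) - ‖x - Y x‖ / θ := fun x => by simpa using hY x x
  have hnn : ∀ x, 0 ≤ ‖x - Y x‖ / θ := fun x => by positivity
  have one : ∀ x y, (u (Y x) - ‖x - Y x‖ / θ) - (u (Y y) - ‖y - Y y‖ / θ) ≤ 1 / θ * ‖x - y‖ :=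
    fun x y => by
      have h1 := hY y (Y x)
      have h2 : ‖y - Y x‖ ≤ ‖x - Y x‖ + ‖x - y‖ := by
        have := norm_sub_le (x - Y x) (x - y)
        rwa [sub_sub_sub_cancel_left, ← norm_neg, neg_sub, norm_sub_rev] at this
      have h3 : ‖y - Y x‖ / θ ≤ ‖x - Y x‖ / θ + 1 / θ * ‖x - y‖ := by
        rw [one_div_mul_eq_div, ← add_div]
        gcongr
      linarith
  refine ⟨fun x => u (Y x) - ‖x - Y x‖ / θ, hY, fun x => ⟨Y x, ?_, rfl⟩, hle, fun x => ?_,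
    fun x y => ?_⟩
  · have h1 := (abs_le.1 (hB x)).1
    have h2 := (abs_le.1 (hB (Y x))).2
    rw [← div_le_iff₀ hθ]
    linarith [hle x]
  · have h1 := (abs_le.1 (hB x)).1
    have h2 := (abs_le.1 (hB (Y x))).2
    rw [abs_le]
    constructor <;> linarith [hle x, hnn x]
  · have h1 := one x y
    have h2 := one y x
    rw [norm_sub_rev y x] at h2
    rw [abs_le]
    constructor <;> linarith

end SupConvolution

/-! ### Regularization and Lipschitz continuity of viscosity solutions -/

namespace HJBData

variable {N : ℕ} {A : Type*} {P : HJBData N A} {σ lam K : ℝ}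

lemma IsViscositySolution.generator_le {u : RN N →ᵇ ℝ}
    (hu : P.IsViscositySolution u) (α : A) (φ : RN N → ℝ) (x : RN N) (hφ : ContDiff ℝ 2 φ)
    (hx : ∀ y, u y - φ y ≤ u x - φ x) :
    P.f α x + P.c α x * u x - P.generator α φ x ≤ 0 := by
  have h1 := (le_iSup (fun α => ((P.f α x + P.c α x * u x - fderiv ℝ φ x (P.b α)
    - P.nonlocal α φ x : ℝ) : EReal)) α).trans (hu.1 φ x hφ hx)
  have h2 : P.f α x + P.c α x * u x - fderiv ℝ φ x (P.b α) - P.nonlocal α φ x ≤ 0 := by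
    exact_mod_cast h1
  rw [generator]
  linarith

namespace Admissible

/-- Viscosity subsolutions of a linear equation are classical subsolutions after regularization. -/
lemma neg_generator_mollify_le (hP : P.Admissible σ lam K) (hσ₂ : σ < 2) (α : A)
    {u G : RN N → ℝ} {l B ε : ℝ} (hl : 0 ≤ l) (hε : 0 < ε)
    (hul : ∀ x y, |u x - u y| ≤ l * ‖x - y‖) (huB : ∀ x, |u x| ≤ B)
    (hGl : ∀ x y, |G x - G y| ≤ l * ‖x - y‖) (hGB : ∀ x, |G x| ≤ B)
    (hv : ∀ (φ : RN N → ℝ) (x : RN N), ContDiff ℝ 2 φ → (∀ y, u y - φ y ≤ u x - φ x) →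
      -P.generator α φ x ≤ G x) (x : RN N) :
    -P.generator α (mollify ε (mollify ε u)) x ≤ mollify ε (mollify ε G) x := by
  obtain ⟨C₁, hC₁, hT₁⟩ := exists_taylorBd_lipschitz N
  obtain ⟨C₂, hC₂, hT₂⟩ := exists_taylorBd_bounded N
  have hB0 : 0 ≤ B := (abs_nonneg _).trans (huB 0)
  have cu := continuous_of_lipschitz hul
  have cG := continuous_of_lipschitz hGl
  have cu1 := continuous_mollify cu hε.ne'
  have cG1 := continuous_mollify cG hε.ne'
  have hul1 := lipschitz_mollify hε.le hul
  have tu1 := hT₁ u l ε hl hε hul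
  have tu2 := hT₁ _ l ε hl hε hul1
  have hS₁ : 0 ≤ C₁ * (l * ε) := by positivity
  obtain ⟨Cg, hCg, hgen⟩ := hP.exists_generator_bound hS₁ hε
  have hS₂ : 0 ≤ C₂ * (B + (Cg + 1)) := by positivity
  obtain ⟨Cg', hCg', hgen'⟩ := hP.exists_generator_bound hS₂ hε
  -- Let `T` be a jump operator close to the generator and `μ v - T v = μ u + G`. The viscosity
  -- property gives `u ≤ v + 1/μ²`, so the twice mollified difference `d` of `v` and `u` satisfies
  -- `μ d ≥ -1/μ`. Moreover `μ d - T d = H`, where `H` is the twice mollified `G` plus `T` of the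
  -- twice mollified `u`. Since `T d` is bounded above by `O(1/μ)`, `H` is bounded below by
  -- `-O(1/μ)`. The constants `Cg`, `Cg'` are fixed before `μ`.
  suffices key : ∀ μ : ℝ, 1 ≤ μ → -P.generator α (mollify ε (mollify ε u)) x
      ≤ mollify ε (mollify ε G) x + 1 / μ * (Cg' + 3) by
    refine le_of_forall_pos_mul (M := Cg' + 3) fun κ hκ => ?_
    refine (key (max 1 (1 / κ)) (le_max_left _ _)).trans ?_
    have : 1 / max 1 (1 / κ) ≤ κ := by
      rw [one_div_le (by positivity) hκ]
      exact le_max_right _ _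
    gcongr
  intro μ hμ
  have hμ0 : 0 < μ := zero_lt_one.trans_le hμ
  have hμ1 : 1 / μ ≤ 1 := by rw [div_le_one hμ0]; exact hμ
  set l' := μ * l + l with hl'
  have hl'0 : 0 ≤ l' := by positivity
  -- With `l' s ≤ 1/(4μ)`, all errors in comparing `u` with `v` add up to at most `1/μ²`. The bound
  -- `s ≤ ε` lets Taylor bounds at scale `ε` be used at scale `s`.
  set s := min ε (1 / (4 * μ * (l' + 1))) with hs
  have hs0 : 0 < s := lt_min hε (by positivity)
  have hsε : s ≤ ε := min_le_left _ _
  have hsl : l' * s ≤ 1 / (4 * μ) := by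
    calc l' * s ≤ (l' + 1) * (1 / (4 * μ * (l' + 1))) := by
          gcongr
          · linarith
          · exact min_le_right _ _
      _ = 1 / (4 * μ) := by field_simp
  -- One size serving all functions on which `T` is compared with the generator: `mollify s v`, the
  -- mollifications of `u`, and `H`.
  set S := C₁ * (l' / μ * s) + C₁ * (l * ε) + C₂ * (B + (Cg + 1)) with hS
  have hS₃ : 0 ≤ C₁ * (l' / μ * s) := by positivity
  have hS0 : 0 ≤ S := by positivity
  have hτ0 : 0 < 1 / (2 * μ) := by positivity
  obtain ⟨T, Λ, hT, happ⟩ := hP.exists_jump_approx hσ₂ α hS0 hs0 hτ0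
  -- the resolvent
  have hgl : ∀ x y, |(μ * u x + G x) - (μ * u y + G y)| ≤ l' * ‖x - y‖ := fun x y => by
    have h1 := hul x y
    have h2 := hGl x y
    calc _ = |μ * (u x - u y) + (G x - G y)| := by congr 1; ring
      _ ≤ μ * |u x - u y| + |G x - G y| := by
          refine (abs_add_le _ _).trans ?_
          rw [abs_mul, abs_of_pos hμ0]
      _ ≤ μ * (l * ‖x - y‖) + l * ‖x - y‖ := by gcongr
      _ = _ := by rw [hl']; ring
  have hgB : ∀ x, |μ * u x + G x| ≤ μ * B + B := fun x => by
    refine (abs_add_le _ _).trans ?_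
    rw [abs_mul, abs_of_pos hμ0]
    gcongr
    · exact huB x
    · exact hGB x
  obtain ⟨v, B', hvB, hvl, hveq⟩ := hT.exists_resolvent hμ0 hl'0 hgB hgl
  have cv := continuous_of_lipschitz hvl
  have hlμ : 0 ≤ l' / μ := by positivity
  -- comparison of `u` with the regularized resolvent
  have tv := hT₁ v (l' / μ) s hlμ hs0 hvl
  have hcomp : ∀ y, u y - mollify s v y ≤ (l' * s + 1 / (2 * μ)) / μ := by
    refine hP.viscosity_le_of_linear α cu (fun z => (huB z).trans (le_max_left B B')) hv tv
      (by positivity) hs0 (abs_mollify_le cv hs0.le fun z => (hvB z).trans (le_max_right B B'))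
      hμ0 fun y => ?_
    have h1 := (abs_le.1 (happ _ (tv.mono (by rw [hS]; linarith) hS0 hs0 le_rfl) y)).2
    have h2 : T (mollify s v) y = μ * mollify s v y - mollify s (fun z => μ * u z + G z) y := by
      rw [← hT.mollify_comm cv, ← mollify_const_mul, ← mollify_sub (w := fun z => μ * v z)
        (by fun_prop) (by fun_prop)]
      congr 1
      funext z
      linarith [hveq z]
    have h3 := (abs_le.1 (abs_mollify_sub_self_le hs0.le hl'0 hgl y)).1
    linarith
  have huv : ∀ y, u y - v y ≤ 1 / μ / μ := fun y => by
    have h1 := hcomp y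
    have h2 := (abs_le.1 (abs_mollify_sub_self_le hs0.le hlμ hvl y)).2
    have h3 : (l' * s + 1 / (2 * μ)) / μ + l' / μ * s = (2 * (l' * s) + 1 / (2 * μ)) / μ := by ring
    have h4 : 2 * (l' * s) + 1 / (2 * μ) ≤ 1 / μ := by
      calc _ ≤ 2 * (1 / (4 * μ)) + 1 / (2 * μ) := by gcongr
        _ = 1 / μ := by field_simp; norm_num
    have h5 : (2 * (l' * s) + 1 / (2 * μ)) / μ ≤ 1 / μ / μ := by gcongr
    linarith
  -- second order estimate
  have cv1 := continuous_mollify cv hε.ne'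
  have huv2 : ∀ y, mollify ε (mollify ε u) y - mollify ε (mollify ε v) y ≤ 1 / μ / μ := fun y => by
    rw [← mollify_sub cu1 cv1]
    refine mollify_le_of_le (w := fun z => mollify ε u z - mollify ε v z) (cu1.sub cv1) hε.le
      (fun z => ?_) y
    rw [← mollify_sub cu cv]
    exact mollify_le_of_le (w := fun z => u z - v z) (cu.sub cv) hε.le huv z
  have cTu1 := hT.continuous cu1
  -- The reason for mollifying twice: `mollify ε G + T (mollify ε u)` is merely bounded, and a
  -- second mollification gives `H` Taylor bounds that control `T H` independently of `μ`.
  set H : RN N → ℝ := mollify ε (fun z => mollify ε G z + T (mollify ε u) z) with hH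
  have hHeq : ∀ y, H y = mollify ε (mollify ε G) y + T (mollify ε (mollify ε u)) y := fun y => by
    rw [hH, mollify_add cG1 cTu1, hT.mollify_comm cu1]
  have tu1' := tu1.mono (show _ ≤ S by rw [hS]; linarith) hS0 hs0 hsε
  have tu2' := tu2.mono (show _ ≤ S by rw [hS]; linarith) hS0 hs0 hsε
  have hHb : ∀ z, |mollify ε G z + T (mollify ε u) z| ≤ B + (Cg + 1) := fun z => by
    refine (abs_add_le _ _).trans (add_le_add (abs_mollify_le cG hε.le hGB z) ?_)
    have h1 := happ _ tu1' z
    have h2 := hgen α _ z tu1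
    have h3 : 1 / (2 * μ) ≤ 1 := by
      rw [div_le_one (by positivity)]
      linarith
    rw [abs_le] at *
    constructor <;> linarith
  have tH : TaylorBd H (C₂ * (B + (Cg + 1))) ε := hT₂ _ _ ε (cG1.add cTu1) hε hHb
  have hTH : ∀ y, T H y ≤ Cg' + 1 := fun y => by
    have h1 := happ _ (tH.mono (show _ ≤ S by rw [hS]; linarith) hS0 hs0 hsε) y
    have h2 := hgen' α _ y tH
    have h3 : 1 / (2 * μ) ≤ 1 := by
      rw [div_le_one (by positivity)]
      linarith
    rw [abs_le] at *
    linarith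
  set d : RN N → ℝ := fun y => mollify ε (mollify ε v) y - mollify ε (mollify ε u) y with hd
  have hTv : ∀ y, T (mollify ε (mollify ε v)) y = μ * mollify ε (mollify ε v) y
      - (μ * mollify ε (mollify ε u) y + mollify ε (mollify ε G) y) := fun y => by
    rw [← hT.mollify_comm cv1, ← mollify_const_mul, ← mollify_const_mul,
      ← mollify_add (w := fun z => μ * mollify ε u z) (by fun_prop) cG1,
      ← mollify_sub (w := fun z => μ * mollify ε v z) (by fun_prop) (by fun_prop)]
    congr 1
    funext z
    rw [← hT.mollify_comm cv, ← mollify_const_mul, ← mollify_const_mul,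
      ← mollify_add (w := fun z => μ * u z) (by fun_prop) cG,
      ← mollify_sub (w := fun z => μ * v z) (by fun_prop) (by fun_prop)]
    congr 1
    funext z
    linarith [hveq z]
  have hdeq : ∀ y, μ * d y - T d y = H y := fun y => by
    rw [hd, hT.map_sub, hTv, hHeq]
    ring
  -- Applying `T` to `μ d - T d = H` gives a resolvent equation for `T d` with right-hand side `T
  -- H`, and the maximum principle gains the factor `1/μ`.
  have hD : ∀ y, T d y ≤ (Cg' + 1) / μ := by
    have e : ∀ y, T d y = μ * d y - H y := fun y => by linarith [hdeq y]
    have eT : T (T d) = fun y => μ * T d y - T H y := by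
      funext y
      rw [show T d = fun y => μ * d y - H y from funext e, hT.map_sub (fun y => μ * d y),
        hT.map_const_mul, e]
    have hHb' : ∀ y, |H y| ≤ B + (Cg + 1) := abs_mollify_le (cG1.add cTu1) hε.le hHb
    have hv2 : ∀ y, |mollify ε (mollify ε v) y| ≤ B' :=
      abs_mollify_le cv1 hε.le (abs_mollify_le cv hε.le hvB)
    have hu2 : ∀ y, |mollify ε (mollify ε u) y| ≤ B :=
      abs_mollify_le cu1 hε.le (abs_mollify_le cu hε.le huB)
    refine hT.max_principle (M₀ := μ * (B' + B) + (B + (Cg + 1))) hμ0 (by positivity)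
      (fun y => ?_) (fun y => ?_)
    · have h1 := (abs_le.1 (hv2 y)).2
      have h2 := (abs_le.1 (hu2 y)).1
      have h3 := (abs_le.1 (hHb' y)).1
      have h4 : μ * d y ≤ μ * (B' + B) := by
        gcongr
        rw [hd]
        linarith
      linarith [e y]
    · have : T (T d) y = μ * T d y - T H y := congrFun eT y
      linarith [hTH y]
  have h1 := (abs_le.1 (happ _ tu2' x)).1
  have h2 := hHeq x
  have h3 := hdeq x
  have h4 := hD x
  have h5 : -(1 / μ) ≤ μ * d x := by
    have := mul_le_mul_of_nonneg_left (huv2 x) hμ0.le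
    rw [mul_div_cancel₀ _ hμ0.ne'] at this
    rw [hd]
    linarith
  have h6 : 1 / (2 * μ) ≤ 1 / μ := by gcongr; linarith
  have h7 : 1 / μ * (Cg' + 3) = (Cg' + 1) / μ + 1 / μ + 1 / μ := by ring
  linarith

/-- Regularization of viscosity subsolutions. -/
lemma smooth_subsolution (hP : P.Admissible σ lam K) (hσ₂ : σ < 2) (α : A) {w : RN N → ℝ}
    {l B E ε : ℝ} (hl : 0 ≤ l) (hε : 0 < ε) (hwl : ∀ x y, |w x - w y| ≤ l * ‖x - y‖)
    (hwB : ∀ x, |w x| ≤ B)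
    (hv : ∀ (φ : RN N → ℝ) (x : RN N), ContDiff ℝ 2 φ → (∀ y, w y - φ y ≤ w x - φ x) →
      P.f α x + P.c α x * w x - P.generator α φ x ≤ E) (x : RN N) :
    P.f α x + P.c α x * mollify ε (mollify ε w) x - P.generator α (mollify ε (mollify ε w)) x
      ≤ E + 2 * (K * ε * (1 + B)) := by
  have hK := hP.pos
  have hB0 : 0 ≤ B := (abs_nonneg _).trans (hwB 0)
  have cw := continuous_of_lipschitz hwl
  -- The zeroth order terms become a Lipschitz right-hand side, which reduces the claim to the bare
  -- generator.
  set G : RN N → ℝ := fun x => E - (P.f α x + P.c α x * w x) with hG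
  have hGl : ∀ x y, |G x - G y| ≤ (l + (K + K * l + K * B)) * ‖x - y‖ := fun x y => by
    have h1 : |P.c α x * w x - P.c α y * w y| ≤ (K * l + K * B) * ‖x - y‖ := by
      calc _ = |P.c α x * (w x - w y) + (P.c α x - P.c α y) * w y| := by congr 1; ring
        _ ≤ |P.c α x| * |w x - w y| + |P.c α x - P.c α y| * |w y| := by
            refine (abs_add_le _ _).trans ?_
            rw [abs_mul, abs_mul]
        _ ≤ K * (l * ‖x - y‖) + K * ‖x - y‖ * B := by
            gcongr
            · exact hP.c_bdd α x
            · exact hwl x y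
            · exact hP.c_lip α x y
            · exact hwB y
        _ = _ := by ring
    have h2 := hP.f_lip α x y
    have h3 : 0 ≤ l * ‖x - y‖ := by positivity
    rw [hG]
    rw [abs_le] at *
    constructor <;> linarith
  have hGB : ∀ x, |G x| ≤ B + (|E| + K + K * B) := fun x => by
    have h1 : |P.c α x * w x| ≤ K * B := by
      rw [abs_mul]
      gcongr
      · exact hP.c_bdd α x
      · exact hwB x
    have h2 := hP.f_bdd α x
    have h3 := le_abs_self E
    have h4 := neg_abs_le E
    rw [hG]
    rw [abs_le] at *
    constructor <;> linarith
  have cG := continuous_of_lipschitz hGl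
  have h1 := hP.neg_generator_mollify_le hσ₂ α (l := l + (K + K * l + K * B))
    (B := B + (|E| + K + K * B)) (by positivity) hε
    (fun x y => (hwl x y).trans (by gcongr; have : 0 ≤ K + K * l + K * B := by positivity
                                    linarith)) (fun x => (hwB x).trans (by
      have : 0 ≤ |E| + K + K * B := by positivity
      linarith)) hGl hGB (fun φ x hφ hx => by
        rw [hG]
        linarith [hv φ x hφ hx]) x
  -- By definition `f + c w + G = E`. Mollifying this twice brings the coefficients back to `x`, at
  -- the cost `K ε (1 + B)` each time.
  have h2 := hP.mollify_subsolution α cw cG hε.le hwB (E := E) (fun x => by rw [hG]; linarith)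
  have h3 := hP.mollify_subsolution α (continuous_mollify cw hε.ne') (continuous_mollify cG hε.ne')
    hε.le (abs_mollify_le cw hε.le hwB) h2 x
  linarith

/-- Viscosity solutions are Lipschitz continuous. -/
lemma lipschitz_viscositySolution (hP : P.Admissible σ lam K) (hσ₂ : σ < 2) {u : RN N →ᵇ ℝ}
    (hu : P.IsViscositySolution u) (x y : RN N) :
    |u x - u y| ≤ K * (1 + ‖u‖) / lam * ‖x - y‖ := by
  have hK := hP.pos
  have hlam := hP.lam_pos
  set B := ‖u‖ with hBdef
  have hB0 : 0 ≤ B := norm_nonneg _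
  have huB : ∀ x, |u x| ≤ B := fun x => u.norm_coe_le_norm x
  have one : ∀ x y, u x - u y ≤ K * (1 + B) / lam * ‖x - y‖ := fun x y => by
    refine le_of_forall_pos_mul (M := 2 + 2 * (K * (1 + B) * (1 + B)) / lam) fun θ hθ => ?_
    obtain ⟨C₁, hC₁, hT₁⟩ := exists_taylorBd_lipschitz N
    obtain ⟨w, hw1, hw2, hw3, hwB, hwl⟩ := exists_supConvolution u.continuous huB hθ
    -- Mollifying the `1/θ`-Lipschitz function `w` costs `ε/θ`, hence `ε ≤ θ²`; the coefficient
    -- errors need `ε ≤ θ`.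
    set ε := θ * min θ 1 with hεdef
    have hε : 0 < ε := by positivity
    have hεθ : ε ≤ θ := mul_le_of_le_one_right hθ.le (min_le_right _ _)
    have hεθ2 : ε ≤ θ * θ := mul_le_mul_of_nonneg_left (min_le_left _ _) hθ.le
    have hl : 0 ≤ 1 / θ := by positivity
    have cw := continuous_of_lipschitz hwl
    have cw1 := continuous_mollify cw hε.ne'
    have hwl1 := lipschitz_mollify hε.le hwl
    set E := K * (2 * B * θ) * (1 + B) with hE
    have hvw : ∀ (α : A) (φ : RN N → ℝ) (x : RN N), ContDiff ℝ 2 φ →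
        (∀ y, w y - φ y ≤ w x - φ x) → P.f α x + P.c α x * w x - P.generator α φ x ≤ E := by
      intro α φ x hφ hx
      obtain ⟨y', hy', hwy⟩ := hw2 x
      -- A function touching `w` from above at `x` touches `u`, after translation, at the maximizer
      -- `y'`. The generator commutes with the translation, so only `f` and `c` are displaced, by at
      -- most `2 B θ`.
      have h1 := hu.generator_le α (fun z => φ (z + (x - y'))) y' (by fun_prop)
        (fun z => by
          have h2 := hx (z + (x - y'))
          have h3 := hw1 (z + (x - y')) z
          rw [add_sub_cancel_left] at h3
          rw [add_sub_cancel]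
          linarith)
      rw [generator_shift, add_sub_cancel] at h1
      have h2 := hP.coeff_shift_le α x y' (hwB x)
      have h3 : P.c α y' * w x ≤ P.c α y' * u y' := by
        refine mul_le_mul_of_nonneg_left ?_ (hP.c_pos α y').le
        have : 0 ≤ ‖x - y'‖ / θ := by positivity
        linarith
      have h4 : K * ‖x - y'‖ * (1 + B) ≤ E := by rw [hE]; gcongr
      linarith
    set φ := mollify ε (mollify ε w) with hφdef
    have hφB : ∀ z, |φ z| ≤ B := abs_mollify_le cw1 hε.le (abs_mollify_le cw hε.le hwB)
    have hφT : TaylorBd φ (C₁ * (1 / θ * ε)) ε := hT₁ _ _ ε hl hε hwl1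
    have hφw : ∀ z, w z - 2 * θ ≤ φ z := fun z => by
      have h1 := (abs_le.1 (abs_mollify_sub_self_le hε.le hl hwl z)).1
      have h2 := (abs_le.1 (abs_mollify_sub_self_le hε.le hl hwl1 z)).1
      have h3 : 1 / θ * ε ≤ θ := by
        rw [one_div_mul_eq_div, div_le_iff₀ hθ]
        exact hεθ2
      linarith
    have hsub : ∀ α z, P.f α z + P.c α z * φ (z + (x - y))
        - P.generator α (fun z => φ (z + (x - y))) z
        ≤ E + 2 * (K * ε * (1 + B)) + K * ‖x - y‖ * (1 + B) := fun α z => by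
      have h1 := hP.smooth_subsolution hσ₂ α hl hε hwl hwB (hvw α) (z + (x - y))
      have h2 := hP.coeff_shift_le α z (z + (x - y)) (hφB (z + (x - y)))
      rw [sub_add_cancel_left, norm_neg] at h2
      rw [generator_shift]
      linarith
    have hcomp := hP.le_viscositySolution hu (hφT.comp_add_right (x - y)) (by positivity) hε
      (fun z => hφB _) (by positivity) hsub y
    rw [add_sub_cancel] at hcomp
    have h1 := hφw x
    have h2 := hw3 x
    have h3 : (E + 2 * (K * ε * (1 + B)) + K * ‖x - y‖ * (1 + B)) / lam
        ≤ (E + 2 * (K * θ * (1 + B)) + K * ‖x - y‖ * (1 + B)) / lam := by gcongr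
    have h4 : (E + 2 * (K * θ * (1 + B)) + K * ‖x - y‖ * (1 + B)) / lam + 2 * θ
        = K * (1 + B) / lam * ‖x - y‖ + θ * (2 + 2 * (K * (1 + B) * (1 + B)) / lam) := by
      rw [hE]
      ring
    linarith
  rw [abs_le]
  have h1 := one x y
  have h2 := one y x
  rw [norm_sub_rev] at h2
  constructor <;> linarith

end Admissible

end HJBData

/-! ### Error bound and convergence rates -/

/-- Powers of quantities of the order of `h ^ p`. -/
lemma rpow_le_of_order {h δ c₁ c₂ p : ℝ} (hh : 0 < h) (hδ : 0 < δ) (hc₁ : 0 < c₁) (hc₂ : 0 < c₂)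
    (h₁ : c₁ * h ^ p ≤ δ) (h₂ : δ ≤ c₂ * h ^ p) (a : ℝ) :
    δ ^ a ≤ (c₁ ^ a + c₂ ^ a) * h ^ (p * a) := by
  have h0 : 0 < h ^ p := by positivity
  have h1 : 0 ≤ c₁ ^ a := by positivity
  have h2 : 0 ≤ c₂ ^ a := by positivity
  rw [Real.rpow_mul hh.le, add_mul, ← Real.mul_rpow hc₁.le h0.le, ← Real.mul_rpow hc₂.le h0.le]
  have h3 : 0 ≤ (c₁ * h ^ p) ^ a := by positivity
  have h4 : 0 ≤ (c₂ * h ^ p) ^ a := by positivity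
  rcases le_total 0 a with ha | ha
  · linarith [Real.rpow_le_rpow hδ.le h₂ ha]
  · linarith [Real.rpow_le_rpow_of_nonpos (by positivity) h₁ ha]

namespace HJBData

variable {N : ℕ} {A : Type*} {P : HJBData N A} {σ lam K : ℝ}

namespace Admissible

/-- The distance of viscosity solutions and solutions of the scheme, in terms of the parameters. -/
lemma exists_error_bound (hP : P.Admissible σ lam K) (hσ₂ : σ < 2) {m : ℕ}
    (hm : m = 3 ∨ (m = 4 ∧ P.JumpOdd)) {u : RN N →ᵇ ℝ} (hu : P.IsViscositySolution u) :
    ∃ C : ℝ, 0 < C ∧ ∀ ε h k δ : ℝ, 0 < ε → 0 < h → 0 < k → 0 < δ → δ < 1 →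
      ∀ uh : RN N →ᵇ ℝ, P.IsSchemeSolution h k δ uh → ∀ x, |u x - uh x| ≤ C * (ε
        + ε * (δ ^ ((m : ℝ) - σ) / ε ^ m + h ^ 2 / k ^ 2 / ε ^ 2
          + k ^ 2 * (δ ^ (2 - σ)) ^ 2 / ε ^ 4 + h / ε ^ 2 + h ^ 2 * δ ^ (-σ) / ε ^ 2)) := by
  have hK := hP.pos
  have hlam := hP.lam_pos
  obtain ⟨C₁, hC₁, hT₁⟩ := exists_taylorBd_lipschitz N
  obtain ⟨C₀, hC₀, hcons⟩ := hP.consistency hm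
  -- A common bound, and with it a common Lipschitz constant `l`, for `u` and every `u_h`,
  -- independent of `h`, `k`, `δ`.
  set B := max ‖u‖ (K / lam) with hB
  have hBu : ‖u‖ ≤ B := le_max_left _ _
  have hBK : K / lam ≤ B := le_max_right _ _
  have hB0 : 0 ≤ B := (norm_nonneg _).trans hBu
  set l := K * (1 + B) / lam with hl
  have hl0 : 0 ≤ l := by positivity
  have huB : ∀ x, |u x| ≤ B := fun x => (u.norm_coe_le_norm x).trans hBu
  have hul : ∀ x y, |u x - u y| ≤ l * ‖x - y‖ := fun x y =>
    (hP.lipschitz_viscositySolution hσ₂ hu x y).trans (by rw [hl]; gcongr)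
  have ul1 : ∀ {ε : ℝ}, 0 < ε → ∀ x y, |mollify ε u x - mollify ε u y| ≤ l * ‖x - y‖ :=
    fun hε => lipschitz_mollify hε.le hul
  refine ⟨2 * l + 2 * (K * (1 + B)) / lam + C₀ * (C₁ * l) / lam + 1, by positivity,
    fun ε h k δ hε hh hk hδ hδ1 uh huh x => ?_⟩
  set Q := δ ^ ((m : ℝ) - σ) / ε ^ m + h ^ 2 / k ^ 2 / ε ^ 2
    + k ^ 2 * (δ ^ (2 - σ)) ^ 2 / ε ^ 4 + h / ε ^ 2 + h ^ 2 * δ ^ (-σ) / ε ^ 2 with hQ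
  have hQ0 : 0 ≤ Q := by positivity
  have hS : 0 ≤ C₁ * (l * ε) := by positivity
  have hE : 0 ≤ 2 * (K * ε * (1 + B)) + C₀ * (C₁ * (l * ε)) * Q := by positivity
  have hvB : ∀ x, |uh x| ≤ B := fun x => (hP.abs_schemeSolution_le hh hδ hδ1 huh x).trans hBK
  have hvl : ∀ x y, |uh x - uh y| ≤ l * ‖x - y‖ := fun x y =>
    (hP.lipschitz_schemeSolution hh hδ hδ1 huh x y).trans (by rw [hl]; gcongr)
  have hfin : 2 * (l * ε) + (2 * (K * ε * (1 + B)) + C₀ * (C₁ * (l * ε)) * Q) / lam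
      ≤ (2 * l + 2 * (K * (1 + B)) / lam + C₀ * (C₁ * l) / lam + 1) * (ε + ε * Q) := by
    have e : (2 * l + 2 * (K * (1 + B)) / lam + C₀ * (C₁ * l) / lam + 1) * (ε + ε * Q)
        = 2 * (l * ε) + (2 * (K * ε * (1 + B)) + C₀ * (C₁ * (l * ε)) * Q) / lam
          + (C₀ * (C₁ * l) / lam * ε + ε + (2 * l + 2 * (K * (1 + B)) / lam + 1) * (ε * Q)) := by
      ring
    rw [e]
    have : 0 ≤ C₀ * (C₁ * l) / lam * ε + ε
        + (2 * l + 2 * (K * (1 + B)) / lam + 1) * (ε * Q) := by positivity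
    linarith
  refine le_trans ?_ hfin
  have upper : u x - uh x ≤ 2 * (l * ε)
      + (2 * (K * ε * (1 + B)) + C₀ * (C₁ * (l * ε)) * Q) / lam := by
    have cu1 := continuous_mollify u.continuous hε.ne'
    have hT := hT₁ _ l ε hl0 hε (ul1 hε)
    have h1 := hP.scheme_comparison hh hδ hδ1 huh (w := mollify ε (mollify ε u))
      (abs_mollify_le cu1 hε.le (abs_mollify_le u.continuous hε.le huB)) hE (fun α z => by
        have h2 := hP.smooth_subsolution hσ₂ α hl0 hε hul huB
          (fun φ y hφ hy => hu.generator_le α φ y hφ hy) z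
        have h3 := (abs_le.1 (hcons _ ε h k δ _ hT hS hε hh hk hδ hδ1 α z)).2
        linarith) x
    have h2 := (abs_le.1 (abs_mollify_sub_self_le hε.le hl0 hul x)).1
    have h3 := (abs_le.1 (abs_mollify_sub_self_le hε.le hl0 (ul1 hε) x)).1
    linarith
  -- The scheme holds pointwise and its operators commute with mollification, so here one
  -- mollification suffices, unlike in the upper bound.
  have lower : uh x - u x ≤ 2 * (l * ε)
      + (2 * (K * ε * (1 + B)) + C₀ * (C₁ * (l * ε)) * Q) / lam := by
    obtain ⟨Λ, hΛ⟩ := hP.exists_isJump_schemeOp (k := k) hh hδ hδ1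
    have hT := hT₁ _ l ε hl0 hε hvl
    have h1 := hP.le_viscositySolution hu hT hS hε (abs_mollify_le uh.continuous hε.le hvB) hE
      (fun α z => by
        have h2 := hP.mollify_subsolution α uh.continuous
          (R := fun y => (-1) * P.schemeOp h k δ α uh y)
          (E := 0) (continuous_const.mul ((hΛ α).continuous uh.continuous)) hε.le hvB
          (fun y => by linarith [huh.le_zero α y]) z
        rw [mollify_const_mul, (hΛ α).mollify_comm uh.continuous] at h2
        have h3 := (abs_le.1 (hcons _ ε h k δ _ hT hS hε hh hk hδ hδ1 α z)).1
        have h4 : 0 ≤ K * ε * (1 + B) := by positivity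
        linarith) x
    have h2 := (abs_le.1 (abs_mollify_sub_self_le hε.le hl0 hvl x)).1
    have h3 : 0 ≤ l * ε := by positivity
    linarith
  rw [abs_le]
  constructor <;> linarith

/-- Convergence rates for general exponents. -/
lemma hasRate (hP : P.Admissible σ lam K) (hσ₂ : σ < 2) {m : ℕ}
    (hm : m = 3 ∨ (m = 4 ∧ P.JumpOdd)) {u : RN N →ᵇ ℝ} (hu : P.IsViscositySolution u) {p r : ℝ}
    (h₁ : m * r ≤ p * (m - σ)) (h₂ : 2 * r ≤ p * (2 - σ / 2))
    (h₃ : 4 * r ≤ 2 + p * (2 - 3 * σ / 2)) (h₄ : 2 * r ≤ 1) (h₅ : 2 * r ≤ 2 - p * σ) :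
    P.HasRate σ u p r := by
  intro c₁ c₂ hc₁ hc₂
  obtain ⟨C, hC, hbd⟩ := hP.exists_error_bound hσ₂ hm hu
  set D : ℝ → ℝ := fun a => c₁ ^ a + c₂ ^ a with hD
  have hD0 : ∀ a, 0 < D a := fun a => by rw [hD]; positivity
  have hD1 := hD0 (m - σ)
  have hD2 := hD0 (2 - σ / 2)
  have hD3 := hD0 (2 - 3 * σ / 2)
  have hD4 := hD0 (-σ)
  refine ⟨C * (1 + (D (m - σ) + D (2 - σ / 2) / c₁ + c₂ * D (2 - 3 * σ / 2) + 1 + D (-σ))),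
    by positivity, fun h k δ hh hh1 hk hδ hδ1 hkX hδp uh huh x => ?_⟩
  have hr : 0 < h ^ r := by positivity
  -- With `ε = h^r` the hypotheses `h₁` to `h₅` keep bounded, in this order, the terms from small
  -- jumps, interpolation in the diffusion, the semi-Lagrangian remainder, upwinding and quadrature.
  have key := hbd (h ^ r) h k δ hr hh hk hδ hδ1 uh huh x
  have hpow := rpow_le_of_order hh hδ hc₁ hc₂ hδp.1 hδp.2
  have hmono : ∀ {s t : ℝ}, s ≤ t → h ^ t ≤ h ^ s := fun hst =>
    Real.rpow_le_rpow_of_exponent_ge hh hh1.le hst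
  have hrn : ∀ n : ℕ, (h ^ r) ^ n = h ^ (n * r) := fun n => by
    rw [← Real.rpow_natCast, ← Real.rpow_mul hh.le, mul_comm]
  have hX : 0 < δ ^ (2 - σ / 2) := by positivity
  have e1 : δ ^ ((m : ℝ) - σ) / (h ^ r) ^ m ≤ D (m - σ) := by
    rw [div_le_iff₀ (by positivity), hrn]
    exact (hpow _).trans (mul_le_mul_of_nonneg_left (hmono h₁) hD1.le)
  have e2 : h ^ 2 / k ^ 2 / (h ^ r) ^ 2 ≤ D (2 - σ / 2) / c₁ := by
    rw [div_le_iff₀ (by positivity), hrn, div_le_iff₀ (by positivity)]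
    have h1 := hkX.1
    rw [← mul_div_assoc, div_le_iff₀ hX] at h1
    have h2 := (hpow (2 - σ / 2)).trans
      (mul_le_mul_of_nonneg_left (hmono (by push_cast; exact h₂)) hD2.le :
        _ ≤ D _ * h ^ (((2 : ℕ) : ℝ) * r))
    have h3 := mul_le_mul_of_nonneg_left h2 (sq_nonneg k)
    rw [div_mul_eq_mul_div, div_mul_eq_mul_div, le_div_iff₀ hc₁]
    linarith
  have e3 : k ^ 2 * (δ ^ (2 - σ)) ^ 2 / (h ^ r) ^ 4 ≤ c₂ * D (2 - 3 * σ / 2) := by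
    rw [div_le_iff₀ (by positivity), hrn]
    calc k ^ 2 * (δ ^ (2 - σ)) ^ 2 ≤ c₂ * (h ^ 2 / δ ^ (2 - σ / 2)) * (δ ^ (2 - σ)) ^ 2 := by
          gcongr
          exact hkX.2
      _ = c₂ * (h ^ (2 : ℝ) * δ ^ (2 - 3 * σ / 2)) := by
          have : (δ ^ (2 - σ)) ^ 2 = δ ^ (2 - 3 * σ / 2) * δ ^ (2 - σ / 2) := by
            rw [← Real.rpow_add hδ, sq, ← Real.rpow_add hδ]
            congr 1
            ring
          rw [this, Real.rpow_two]
          field_simp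
      _ ≤ c₂ * (h ^ (2 : ℝ) * (D (2 - 3 * σ / 2) * h ^ (p * (2 - 3 * σ / 2)))) := by
          gcongr
          exact hpow _
      _ = c₂ * D (2 - 3 * σ / 2) * h ^ (2 + p * (2 - 3 * σ / 2)) := by
          rw [Real.rpow_add hh]
          ring
      _ ≤ _ := by
          exact mul_le_mul_of_nonneg_left (hmono (by push_cast; exact h₃)) (by positivity)
  have e4 : h / (h ^ r) ^ 2 ≤ 1 := by
    rw [div_le_one (by positivity), hrn]
    simpa using hmono (show ((2 : ℕ) : ℝ) * r ≤ 1 by push_cast; exact h₄)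
  have e5 : h ^ 2 * δ ^ (-σ) / (h ^ r) ^ 2 ≤ D (-σ) := by
    rw [div_le_iff₀ (by positivity), hrn]
    calc h ^ 2 * δ ^ (-σ) ≤ h ^ 2 * (D (-σ) * h ^ (p * -σ)) := by
          gcongr
          exact hpow _
      _ = D (-σ) * h ^ (2 - p * σ) := by
          rw [show 2 - p * σ = 2 + p * -σ by ring, Real.rpow_add hh, Real.rpow_two]
          ring
      _ ≤ _ := by
          exact mul_le_mul_of_nonneg_left (hmono (by push_cast; exact h₅)) hD4.le
  calc |u x - uh x| ≤ _ := key
    _ ≤ C * (h ^ r + h ^ r * (D (m - σ) + D (2 - σ / 2) / c₁ + c₂ * D (2 - 3 * σ / 2) + 1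
          + D (-σ))) := by gcongr
    _ = _ := by ring

end Admissible

end HJBData

end

/-! ### Choice of the exponents -/

theorem mainTheorem8 {N : ℕ} {A : Type*} [MetricSpace A] [TopologicalSpace.SeparableSpace A]
    (P : HJBData N A) (σ : ℝ) (hσ₀ : 0 < σ) (hσ₂ : σ < 2)
    (h_cont : P.ContinuousCoercive) (h_bdd : P.UniformlyBounded)
    (h_jump : P.JumpLinearGrowth) (h_levy : P.LevyBound)
    (h_symm : P.LevySymmetric) (h_dens : P.LevyDensityBound σ)
    (h_second : P.JumpSecondDifference)
    (u : BoundedContinuousFunction (RN N) ℝ) (hu : P.IsViscositySolution u) :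
    ((σ ≤ 6 / 5 → P.HasRate σ u (1 / σ) (1 / 2)) ∧
      (6 / 5 < σ → P.HasRate σ u (6 / (6 + σ)) (2 * (3 - σ) / (6 + σ)))) ∧
    (P.JumpOdd →
      (σ ≤ 4 / 3 → P.HasRate σ u (1 / σ) (1 / 2)) ∧
      (4 / 3 < σ → P.HasRate σ u (4 / (4 + σ)) ((4 - σ) / (4 + σ)))) := by
  obtain ⟨lam, K, hP⟩ := HJBData.exists_admissible hσ₀ hσ₂ h_cont h_bdd h_jump h_levy h_symm h_dens
    h_second
  have h6 : 0 < 6 + σ := by linarith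
  have h4 : 0 < 4 + σ := by linarith
  have e : ∀ a : ℝ, 1 / σ * (a - σ) = a / σ - 1 := fun a => by field_simp
  have e' : 1 / σ * (2 - 3 * σ / 2) = 2 / σ - 3 / 2 := by field_simp
  have e'' : 1 / σ * (2 - σ / 2) = 2 / σ - 1 / 2 := by field_simp
  have h2σ : 1 ≤ 2 / σ := by
    rw [le_div_iff₀ hσ₀]
    linarith
  have h2σ' : 3 / 2 ≤ 2 / σ ∨ 4 / 3 < σ := by
    rw [le_div_iff₀ hσ₀]
    by_contra! hc
    linarith
  refine ⟨⟨fun h => ?_, fun h => ?_⟩, fun hodd => ⟨fun h => ?_, fun h => ?_⟩⟩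
  -- Upwinding limits the rate to `1/2`, and `δ ≍ h^(1/σ)` makes the quadrature condition an
  -- equality. The small jump condition `3/2 ≤ 3/σ - 1` is exactly `σ ≤ 6/5`.
  · have h2 : 3 / 2 ≤ 2 / σ := h2σ'.resolve_right (by linarith)
    have h3 : 5 / 2 ≤ 3 / σ := by
      rw [le_div_iff₀ hσ₀]
      linarith
    refine hP.hasRate hσ₂ (.inl rfl) hu ?_ ?_ ?_ ?_ ?_
    · push_cast
      rw [e]
      linarith
    · rw [e'']
      linarith
    · rw [e']
      linarith
    · norm_num
    · rw [one_div_mul_cancel hσ₀.ne']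
      norm_num
  -- Here `δ` balances small jumps against quadrature, both conditions being equalities. The upwind
  -- condition `2 r ≤ 1` amounts to `σ ≥ 6/5`.
  · refine hP.hasRate hσ₂ (.inl rfl) hu ?_ ?_ ?_ ?_ ?_
    · push_cast
      rw [← mul_div_assoc, div_mul_eq_mul_div]
      refine div_le_div_of_nonneg_right ?_ h6.le
      linarith
    · rw [← mul_div_assoc, div_mul_eq_mul_div]
      refine div_le_div_of_nonneg_right ?_ h6.le
      linarith
    · rw [← mul_div_assoc, div_mul_eq_mul_div, div_le_iff₀ h6, add_mul, div_mul_cancel₀ _ h6.ne']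
      linarith
    · rw [← mul_div_assoc, div_le_one h6]
      linarith
    · rw [← mul_div_assoc, div_mul_eq_mul_div, div_le_iff₀ h6, sub_mul, div_mul_cancel₀ _ h6.ne']
      linarith
  -- With `m = 4` the small jump condition `2 ≤ 4/σ - 1` and the semi-Lagrangian one both become `σ
  -- ≤ 4/3`.
  · have h2 : 3 / 2 ≤ 2 / σ := h2σ'.resolve_right (by linarith)
    have h3 : 3 ≤ 4 / σ := by
      rw [le_div_iff₀ hσ₀]
      linarith
    refine hP.hasRate hσ₂ (.inr ⟨rfl, hodd⟩) hu ?_ ?_ ?_ ?_ ?_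
    · push_cast
      rw [e]
      linarith
    · rw [e'']
      linarith
    · rw [e']
      linarith
    · norm_num
    · rw [one_div_mul_cancel hσ₀.ne']
      norm_num
  -- All conditions but the upwind one are equalities here: the scheme is fully balanced. The upwind
  -- condition amounts to `σ ≥ 4/3`.
  · refine hP.hasRate hσ₂ (.inr ⟨rfl, hodd⟩) hu ?_ ?_ ?_ ?_ ?_
    · push_cast
      rw [← mul_div_assoc, div_mul_eq_mul_div]
    · rw [← mul_div_assoc, div_mul_eq_mul_div]
      refine div_le_div_of_nonneg_right ?_ h4.le
      linarith
    · rw [← mul_div_assoc, div_mul_eq_mul_div, div_le_iff₀ h4, add_mul, div_mul_cancel₀ _ h4.ne']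
      linarith
    · rw [← mul_div_assoc, div_le_one h4]
      linarith
    · rw [← mul_div_assoc, div_mul_eq_mul_div, div_le_iff₀ h4, sub_mul, div_mul_cancel₀ _ h4.ne']
      linarith
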